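/- **Theorem.** Write $|x|$ for the Euclidean norm on $\mathbb R^3$. There is a smooth Riemannian metric $g$ on $\mathbb R^3$, invariant under all rotations about the $x_1$-axis $\{x_2=x_3=0\}$, such that $(\mathbb R^3,g)$ is an asymptotically Schwarzschild manifold of mass $1$, that is, $g$ is complete and, with $g^S_{ij}=\bigl(1+\tfrac{1}{2|x|}\bigr)^4\delta_{ij}$, for every $k\ge 0$ there is $C_k$ with $$\bigl|D^k(g-g^S)(x)\bigr|\le C_k|x|^{-2-k}\qquad\text{for all } |x|>1,$$ and there are real numbers $H_0>H_1>H_2>\cdots>0$ with $H_n\to 0$ and three sequences of smoothly embedded $2$-spheres $\Sigma_n^1,\Sigma_n^2,\Sigma_n^3\subset\{|x|>1\}$, leaving every compact set as $n\to\infty$, such that for every $n$: 1. $\Sigma_n^1,\Sigma_n^2,\Sigma_n^3$ all have constant mean curvature $H_n$ in $(\mathbb R^3,g)$, where the mean curvature is the trace of the second fundamental form with respect to the outward unit normal; 2. each of $\Sigma_n^1,\Sigma_n^2,\Sigma_n^3$ is invariant under all rotations about the $x_1$-axis; 3. $\Sigma_n^3$ separates the compact part $\{|x|\le 1\}$ from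 infinity, i.e. $\{|x|\le 1\}$ lies in the bounded region enclosed by $\Sigma_n^3$; 4. $\Sigma_n^1$ and $\Sigma_n^2$ are outlying: for $i=1,2$ the compact region bounded by $\Sigma_n^i$ is disjoint from the ball $\{|x|<\inf_{y\in\Sigma_n^i}|y|\}$; 5. $\Sigma_n^3$ meets the $x_1$-axis in exactly two points (its poles) $P_n\neq Q_n$; $\Sigma_n^1$ meets $\Sigma_n^3$ exactly at $P_n$ and is tangent to it there, and $\Sigma_n^2$ meets $\Sigma_n^3$ exactly at $Q_n$ and is tangent to it there. (No stability of these surfaces is claimed.) -/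

import Mathlib

open Set Filter Topology Metric
open scoped Manifold ContDiff

noncomputable section

namespace CMC

/-- The space `ℝ³` with its standard coordinates `x 0, x 1, x 2`. -/
abbrev E3 : Type := EuclideanSpace ℝ (Fin 3)

instance factFinrankE3 : Fact (Module.finrank ℝ E3 = 2 + 1) :=
  ⟨by simp⟩

/-- The round unit sphere in `ℝ³`, with Mathlib's structure of a smooth 2-manifold. -/
abbrev S2 : Type := sphere (0 : E3) 1

/-- A smooth Riemannian metric on `ℝ³`. -/
structure Metric3 where
  toFun : E3 → E3 →L[ℝ] E3 →L[ℝ] ℝ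
  smooth : ContDiff ℝ ∞ toFun
  symm : ∀ x u v, toFun x u v = toFun x v u
  pos : ∀ x u, u ≠ 0 → 0 < toFun x u u

namespace Metric3

/-- The `g`-length of a curve parametrized by `[0, 1]`. -/
def curveLength (g : Metric3) (γ : ℝ → E3) : ℝ :=
  ∫ t in (0 : ℝ)..1, √(g.toFun (γ t) (deriv γ t) (deriv γ t))

/-- The Riemannian distance: the infimum of the lengths of the `C¹` curves from `x` to `y`. -/
def gdist (g : Metric3) (x y : E3) : ℝ :=
  sInf {L : ℝ | ∃ γ : ℝ → E3, ContDiff ℝ 1 γ ∧ γ 0 = x ∧ γ 1 = y ∧ L = g.curveLength γ}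

/-- Completeness of `(ℝ³, g)` as a metric space. -/
def Complete (g : Metric3) : Prop :=
  ∀ u : ℕ → E3,
    (∀ ε > 0, ∃ N : ℕ, ∀ m ≥ N, ∀ n ≥ N, g.gdist (u m) (u n) < ε) →
      ∃ x : E3, Tendsto (fun n => g.gdist (u n) x) atTop (𝓝 0)

/-- `⟨Γ(u, v), w⟩`, where `Γ` is the Christoffel map of the Levi-Civita connection of `g` in the
standard coordinates; `∇_u V = DV(u) + Γ(u, V)`. -/
def christoffel (g : Metric3) (x u v w : E3) : ℝ :=
  (fderiv ℝ g.toFun x u v w + fderiv ℝ g.toFun x v u w - fderiv ℝ g.toFun x w u v) / 2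

end Metric3

/-- The Euclidean metric `δ`. -/
def euclid : E3 →L[ℝ] E3 →L[ℝ] ℝ := innerSL ℝ

theorem euclid_apply (u v : E3) : euclid u v = inner ℝ u v := rfl

/-- The Schwarzschild metric of mass `m`, `(1 + m / (2 |x|))⁴ δ`. -/
def schwarzschild (m : ℝ) (x : E3) : E3 →L[ℝ] E3 →L[ℝ] ℝ :=
  (1 + m / (2 * ‖x‖)) ^ 4 • euclid

/-- `(ℝ³, g)` is an asymptotically Schwarzschild manifold of mass `m`: it is complete, and outside
the compact set `K = {|x| ≤ 1}` the metric is Schwarzschild up to `O(|x|⁻²)`, every derivative of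
order `k` of the difference being `O(|x|⁻²⁻ᵏ)`. -/
def IsAsymptoticallySchwarzschild (m : ℝ) (g : Metric3) : Prop :=
  g.Complete ∧
    ∀ k : ℕ, ∃ C : ℝ, ∀ x : E3, 1 < ‖x‖ →
      ‖iteratedFDeriv ℝ k (fun y => g.toFun y - schwarzschild m y) x‖ ≤ C / ‖x‖ ^ (2 + k)

/-- The rotation by the angle `θ` about the `x 0`-axis. -/
def rot (θ : ℝ) (x : E3) : E3 :=
  !₂[x 0, Real.cos θ * x 1 - Real.sin θ * x 2, Real.sin θ * x 1 + Real.cos θ * x 2]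

/-- The `x 0`-axis. -/
def axis : Set E3 := {x | x 1 = 0 ∧ x 2 = 0}

/-- The rotations about the `x 0`-axis (which are linear) are isometries of `g`. -/
def Metric3.IsAxisymmetric (g : Metric3) : Prop :=
  ∀ (θ : ℝ) (x u v : E3), g.toFun (rot θ x) (rot θ u) (rot θ v) = g.toFun x u v

/-- A smoothly embedded 2-sphere in `ℝ³`: an injective smooth immersion of the (compact) sphere. -/
structure EmbeddedSphere where
  toFun : S2 → E3
  smooth : ContMDiff (𝓡 2) 𝓘(ℝ, E3) ∞ toFun
  injective : Function.Injective toFun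
  immersion : ∀ p, Function.Injective (mfderiv (𝓡 2) 𝓘(ℝ, E3) toFun p)

namespace EmbeddedSphere

/-- The underlying surface. -/
def carrier (S : EmbeddedSphere) : Set E3 := range S.toFun

/-- The differential of the embedding. -/
def diff (S : EmbeddedSphere) (p : S2) : TangentSpace (𝓡 2) p →L[ℝ] E3 :=
  mfderiv (𝓡 2) 𝓘(ℝ, E3) S.toFun p

/-- The tangent plane of the surface at the point `S.toFun p`. -/
def tangentPlane (S : EmbeddedSphere) (p : S2) : Submodule ℝ E3 :=
  LinearMap.range (S.diff p).toLinearMap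

/-- The open region enclosed by the surface: the union of the bounded components of its
complement. -/
def enclosed (S : EmbeddedSphere) : Set E3 :=
  {x | x ∉ S.carrier ∧ Bornology.IsBounded (connectedComponentIn S.carrierᶜ x)}

/-- `ν` is the outward-pointing smooth `g`-unit normal field along the surface. -/
structure IsOutwardUnitNormal (S : EmbeddedSphere) (g : Metric3) (ν : S2 → E3) : Prop where
  smooth : ContMDiff (𝓡 2) 𝓘(ℝ, E3) ∞ ν
  unit : ∀ p, g.toFun (S.toFun p) (ν p) (ν p) = 1
  normal : ∀ p X, g.toFun (S.toFun p) (ν p) (S.diff p X) = 0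
  outward : ∀ p, ∀ᶠ t : ℝ in 𝓝[>] 0, S.toFun p + t • ν p ∉ S.enclosed

/-- The second fundamental form `⟨∇_X ν, Y⟩` at `p`, with the Levi-Civita connection of `g`. -/
def secondFundamentalForm (S : EmbeddedSphere) (g : Metric3) (ν : S2 → E3) (p : S2)
    (X Y : TangentSpace (𝓡 2) p) : ℝ :=
  g.toFun (S.toFun p) (mfderiv (𝓡 2) 𝓘(ℝ, E3) ν p X : E3) (S.diff p Y) +
    g.christoffel (S.toFun p) (S.diff p X) (ν p) (S.diff p Y)

/-- The surface has constant mean curvature `H` with respect to its outward unit normal: the trace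
of the second fundamental form, computed in any orthonormal basis of any tangent plane,
equals `H`. (Round spheres of radius `R` in flat space have `H = 2 / R`.) -/
def HasConstantMeanCurvature (S : EmbeddedSphere) (g : Metric3) (H : ℝ) : Prop :=
  ∃ ν : S2 → E3, S.IsOutwardUnitNormal g ν ∧
    ∀ (p : S2) (X Y : TangentSpace (𝓡 2) p),
      g.toFun (S.toFun p) (S.diff p X) (S.diff p X) = 1 →
      g.toFun (S.toFun p) (S.diff p Y) (S.diff p Y) = 1 →
      g.toFun (S.toFun p) (S.diff p X) (S.diff p Y) = 0 →
      S.secondFundamentalForm g ν p X X + S.secondFundamentalForm g ν p Y Y = H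

/-- The surface is a surface of revolution about the `x 0`-axis. -/
def IsAxisymmetric (S : EmbeddedSphere) : Prop :=
  ∀ θ : ℝ, rot θ '' S.carrier = S.carrier

/-- The surface lies in the end `|x| > 1` and encloses the compact part `K = {|x| ≤ 1}`. -/
def SeparatesCompactPart (S : EmbeddedSphere) : Prop :=
  S.carrier ⊆ {x | 1 < ‖x‖} ∧ closedBall (0 : E3) 1 ⊆ S.enclosed

/-- The surface lies in the end `|x| > 1`, and the compact region bounded by it is disjoint from
the ball about `0` of radius `l₀ = inf {|x| : x ∈ S}`. -/
def IsOutlying (S : EmbeddedSphere) : Prop :=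
  S.carrier ⊆ {x | 1 < ‖x‖} ∧
    Disjoint (S.carrier ∪ S.enclosed) (ball (0 : E3) (sInf (norm '' S.carrier)))

/-- The two surfaces meet exactly at the point `q`, and have the same tangent plane there. -/
def TangentExactlyAt (S T : EmbeddedSphere) (q : E3) : Prop :=
  S.carrier ∩ T.carrier = {q} ∧
    ∃ p p' : S2, S.toFun p = q ∧ T.toFun p' = q ∧ S.tangentPlane p = T.tangentPlane p'

end EmbeddedSphere

end CMC

end

/-!
All metrics in the proof are conformally flat. Write such a metric as `w⁻² δ`; then the mean
curvature of a fixed surface is linear in `w` and its gradient, so a surface can be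
*made* to have prescribed constant mean curvature by solving a linear equation for `w` along it.

Dilate the Schwarzschild metric of mass `1` by `ε`, so that the centred sphere of radius `ε⁻¹`
becomes the unit sphere and `w` becomes `(1 + ε / (2 r))⁻²`. Besides the unit sphere consider a
nearly round sphere `{⟪c, y⟫ = height ε ‖y‖}` of approximate centre `2 c`, touching the unit sphere
at the pole `c`. Its explicit first order deviation from a round sphere solves the linearized
equation, so its mean curvature in the dilated Schwarzschild metric differs from that of the unit
sphere only by `O(ε²)`. This defect is removed by adding `ε²` times a smooth function to `w`. Near
the pole that function has to preserve the mean curvature of the unit sphere as well; this holds for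
functions that are homogeneous of degree `1` (by Euler's identity) and for functions that vanish to
second order on the unit sphere, and the former match the defect to second order at the pole.

Because the correction has size `ε² = O(|x|⁻²)` at `|x| ≈ ε⁻¹` and is compactly supported in the
dilated picture, corrections at geometrically decreasing scales `ε` have disjoint supports, and
their superposition on the Schwarzschild metric, filled in near the origin, has the required decay.
-/

noncomputable section

namespace CMC

section Division

theorem contDiff_smul_of_tsupport_subset {E G : Type*} [NormedAddCommGroup E] [NormedSpace ℝ E]
    [NormedAddCommGroup G] [NormedSpace ℝ G] {χ : E → ℝ} {T : E → G} {U : Set E} {n : ℕ∞}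
    (hU : IsOpen U) (hχ : ContDiff ℝ n χ) (hT : ContDiffOn ℝ n T U) (hsupp : tsupport χ ⊆ U) :
    ContDiff ℝ n fun x => χ x • T x :=
  contMDiff_iff_contDiff.1 <| contMDiff_of_tsupport fun _ hx =>
    (hχ.contDiffAt.smul (hT.contDiffAt (hU.mem_nhds
      (hsupp (tsupport_smul_subset_left χ T hx))))).contMDiffAt

universe u

variable {E : Type u} [NormedAddCommGroup E] [NormedSpace ℝ E] [FiniteDimensional ℝ E]

theorem hasFDerivAt_parametric_intervalIntegral {G : Type*} [NormedAddCommGroup G]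
    [NormedSpace ℝ G] {F : E × ℝ → G} (hF : ContDiff ℝ 1 F) (a b : ℝ) (x₀ : E) :
    HasFDerivAt (fun x => ∫ s in a..b, F (x, s))
      (∫ s in a..b, (fderiv ℝ F (x₀, s)).comp (ContinuousLinearMap.inl ℝ E ℝ)) x₀ := by
  have hF' : Continuous fun p : E × ℝ => (fderiv ℝ F p).comp (ContinuousLinearMap.inl ℝ E ℝ) :=
    (hF.continuous_fderiv one_ne_zero).clm_comp continuous_const
  have hslice : ∀ x : E, Continuous fun s : ℝ => (x, s) := fun x => by fun_prop
  obtain ⟨C, hC⟩ := ((isCompact_closedBall x₀ 1).prod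
    (isCompact_uIcc (a := a) (b := b))).exists_bound_of_continuousOn hF'.continuousOn
  refine intervalIntegral.hasFDerivAt_integral_of_dominated_of_fderiv_le (bound := fun _ => C)
    (F' := fun x s => (fderiv ℝ F (x, s)).comp (ContinuousLinearMap.inl ℝ E ℝ))
    (closedBall_mem_nhds x₀ one_pos) ?_ ?_ ?_ ?_ intervalIntegrable_const ?_
  · exact .of_forall fun x => (hF.continuous.comp (hslice x)).aestronglyMeasurable
  · exact (hF.continuous.comp (hslice x₀)).intervalIntegrable _ _
  · exact (hF'.comp (hslice x₀)).aestronglyMeasurable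
  · exact .of_forall fun t ht x hx => hC (x, t) ⟨hx, uIoc_subset_uIcc ht⟩
  · exact .of_forall fun t _ x _ =>
      (hF.differentiable one_ne_zero (x, t)).hasFDerivAt.comp x (hasFDerivAt_prodMk_left x t)

theorem contDiff_parametric_intervalIntegral_nat (a b : ℝ) (n : ℕ) :
    ∀ {G : Type u} [NormedAddCommGroup G] [NormedSpace ℝ G] {F : E × ℝ → G},
      ContDiff ℝ n F → ContDiff ℝ n fun x => ∫ s in a..b, F (x, s) := by
  induction n with
  | zero =>
    intro G _ _ F hF
    rw [Nat.cast_zero, contDiff_zero] at hF ⊢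
    exact intervalIntegral.continuous_parametric_intervalIntegral_of_continuous'
      (f := fun x s => F (x, s)) hF a b
  | succ n ih =>
    intro G _ _ F hF
    have hF1 : ContDiff ℝ 1 F := hF.of_le (by exact_mod_cast Nat.le_add_left 1 n)
    rw [Nat.cast_succ, contDiff_succ_iff_hasFDerivAt (n := n)]
    refine ⟨_, ?_, hasFDerivAt_parametric_intervalIntegral hF1 a b⟩
    exact ih (F := fun p => (fderiv ℝ F p).comp (ContinuousLinearMap.inl ℝ E ℝ))
      ((hF.fderiv_right (m := n) (by norm_cast)).clm_comp contDiff_const)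

variable {G : Type u} [NormedAddCommGroup G] [NormedSpace ℝ G]

theorem contDiff_parametric_intervalIntegral {F : E × ℝ → G} (hF : ContDiff ℝ ∞ F) (a b : ℝ) :
    ContDiff ℝ ∞ fun x => ∫ s in a..b, F (x, s) :=
  contDiff_infty.2 fun n => contDiff_parametric_intervalIntegral_nat a b n (contDiff_infty.1 hF n)

/-- Hadamard's lemma: the quotient is the mean of `∂T/∂t` over the segment from `c` to `t`. -/
theorem exists_contDiff_eq_sub_smul [CompleteSpace G] {T : E × ℝ → G} (hT : ContDiff ℝ ∞ T)
    (c : ℝ) (hTc : ∀ x, T (x, c) = 0) :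
    ∃ S : E × ℝ → G, ContDiff ℝ ∞ S ∧ ∀ p, T p = (p.2 - c) • S p := by
  refine ⟨fun p => ∫ s in (0 : ℝ)..1, fderiv ℝ T (p.1, c + s * (p.2 - c)) (0, 1), ?_, ?_⟩
  · have := hT.fderiv_right (m := ∞) (by simp)
    exact contDiff_parametric_intervalIntegral (E := E × ℝ)
      (F := fun q => fderiv ℝ T (q.1.1, c + q.2 * (q.1.2 - c)) (0, 1)) (by fun_prop) 0 1
  · rintro ⟨x, t⟩
    have hderiv : ∀ s : ℝ, HasDerivAt (fun s => T (x, c + s * (t - c)))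
        ((t - c) • fderiv ℝ T (x, c + s * (t - c)) (0, 1)) s := by
      intro s
      have hpath : HasDerivAt (fun s : ℝ => (x, c + s * (t - c)))
          ((t - c) • ((0 : E), (1 : ℝ))) s :=
        (hasDerivAt_const s x).prodMk (((hasDerivAt_id s).mul_const (t - c)).const_add c)
          |>.congr_deriv (by simp)
      simpa only [map_smul, Function.comp_def] using
        (hT.differentiable (by simp) (x, c + s * (t - c))).hasFDerivAt.comp_hasDerivAt s hpath
    have hcont : Continuous fun s : ℝ => (t - c) • fderiv ℝ T (x, c + s * (t - c)) (0, 1) := by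
      have := hT.continuous_fderiv (by simp)
      fun_prop
    have hint := intervalIntegral.integral_eq_sub_of_hasDerivAt (fun s _ => hderiv s)
      (hcont.intervalIntegrable 0 1)
    rw [intervalIntegral.integral_smul] at hint
    simp [hint, hTc]

theorem exists_contDiff_eventuallyEq_sub_smul [CompleteSpace G] {U : Set (E × ℝ)}
    (hU : IsOpen U) {T : E × ℝ → G} (hT : ContDiffOn ℝ ∞ T U) (c : ℝ)
    (hTc : ∀ x, (x, c) ∈ U → T (x, c) = 0) {p₀ : E × ℝ} (hp₀ : p₀ ∈ U) :
    ∃ S : E × ℝ → G, ContDiff ℝ ∞ S ∧ ∀ᶠ p in 𝓝 p₀, T p = (p.2 - c) • S p := by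
  obtain ⟨δ, hδ, hball⟩ := nhds_basis_closedBall.mem_iff.1 (hU.mem_nhds hp₀)
  let χ : ContDiffBump p₀ := ⟨δ / 2, δ, by positivity, by linarith⟩
  have hχU : tsupport χ ⊆ U := χ.tsupport_eq ▸ hball
  obtain ⟨S, hS, hTS⟩ := exists_contDiff_eq_sub_smul
    (contDiff_smul_of_tsupport_subset hU χ.contDiff hT hχU) c fun x => by
      by_cases hx : (x, c) ∈ U
      · rw [hTc x hx, smul_zero]
      · rw [image_eq_zero_of_notMem_tsupport fun h => hx (hχU h), zero_smul]
  refine ⟨S, hS, ?_⟩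
  filter_upwards [χ.eventuallyEq_one] with p hp
  rw [← hTS p, hp, Pi.one_apply, one_smul]

theorem exists_contDiffOn_eq_sub_smul [CompleteSpace G] {U : Set (E × ℝ)} (hU : IsOpen U)
    {T : E × ℝ → G} (hT : ContDiffOn ℝ ∞ T U) (c : ℝ) (hTc : ∀ x, (x, c) ∈ U → T (x, c) = 0) :
    ∃ S : E × ℝ → G, ContDiffOn ℝ ∞ S U ∧ ∀ p ∈ U, T p = (p.2 - c) • S p := by
  classical
  refine ⟨fun p => if p.2 = c then fderiv ℝ T p (0, 1) else (p.2 - c)⁻¹ • T p, ?_, ?_⟩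
  · intro p₀ hp₀
    obtain ⟨S, hS, hTS⟩ := exists_contDiff_eventuallyEq_sub_smul hU hT c hTc hp₀
    refine (hS.contDiffAt.congr_of_eventuallyEq ?_).contDiffWithinAt
    filter_upwards [hTS.eventually_nhds] with p hp
    split_ifs with hpc
    · have hderiv := ((hasFDerivAt_snd (𝕜 := ℝ) (p := p)).sub_const c).smul
        (hS.differentiable (by simp) p).hasFDerivAt
      have hTderiv : HasFDerivAt T _ p := hderiv.congr_of_eventuallyEq hp
      simp [hTderiv.fderiv, hpc]
    · rw [hp.self_of_nhds, inv_smul_smul₀ (sub_ne_zero.2 hpc)]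
  · rintro ⟨x, t⟩ hp
    dsimp only
    split_ifs with htc
    · subst htc
      rw [hTc x hp, sub_self, zero_smul]
    · rw [smul_inv_smul₀ (sub_ne_zero.2 htc)]

theorem exists_contDiffOn_eq_sub_sq_smul [CompleteSpace G] {U : Set (E × ℝ)} (hU : IsOpen U)
    {T : E × ℝ → G} (hT : ContDiffOn ℝ ∞ T U) (c : ℝ) (hTc : ∀ x, (x, c) ∈ U → T (x, c) = 0)
    (hTc' : ∀ x, (x, c) ∈ U → HasDerivAt (fun t => T (x, t)) 0 c) :
    ∃ S : E × ℝ → G, ContDiffOn ℝ ∞ S U ∧ ∀ p ∈ U, T p = (p.2 - c) ^ 2 • S p := by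
  obtain ⟨S, hS, hTS⟩ := exists_contDiffOn_eq_sub_smul hU hT c hTc
  have hSc : ∀ x, (x, c) ∈ U → S (x, c) = 0 := by
    intro x hx
    have hSdiff : DifferentiableAt ℝ (fun t => S (x, t)) c :=
      ((hS.contDiffAt (hU.mem_nhds hx)).differentiableAt (by simp)).comp c
        (by fun_prop : DifferentiableAt ℝ (fun t : ℝ => (x, t)) c)
    have hslice : ContinuousAt (fun t : ℝ => (x, t)) c := by fun_prop
    have hTderiv : HasDerivAt (fun t => T (x, t)) (S (x, c)) c := by
      refine ((((hasDerivAt_id c).sub_const c).smul hSdiff.hasDerivAt).congr_of_eventuallyEq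
        ?_).congr_deriv (by simp)
      filter_upwards [hslice.eventually (hU.mem_nhds hx)] with t ht using hTS _ ht
    exact hTderiv.unique (hTc' x hx)
  obtain ⟨R, hR, hSR⟩ := exists_contDiffOn_eq_sub_smul hU hS c hSc
  exact ⟨R, hR, fun p hp => by rw [hTS p hp, hSR p hp, smul_smul, sq]⟩

end Division

section Interpolation

theorem hasDerivAt_comp_prodMk {E G : Type*} [NormedAddCommGroup E] [NormedSpace ℝ E]
    [NormedAddCommGroup G] [NormedSpace ℝ G] {h : E × ℝ → G} {x : E} {c : ℝ}
    (hh : DifferentiableAt ℝ h (x, c)) :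
    HasDerivAt (fun t => h (x, t)) (fderiv ℝ h (x, c) (0, 1)) c :=
  hh.hasFDerivAt.comp_hasDerivAt c ((hasDerivAt_const c x).prodMk (hasDerivAt_id c))

variable {E : Type} [NormedAddCommGroup E] [NormedSpace ℝ E] [FiniteDimensional ℝ E]

/-- The coefficients `β` and `γ` annihilate, in this order, the value and the first `t`-derivative
of `f + β a + γ b` on `{t = c}`; the remainder is then divisible by `(t - c) ^ 2`. -/
theorem exists_contDiffOn_add_mul_add_mul_add_sub_sq_mul_eq_zero {I : Set E} {J : Set ℝ}
    (hI : IsOpen I) (hJ : IsOpen J) {c : ℝ} (hc : c ∈ J) {f a b : E × ℝ → ℝ}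
    (hf : ContDiffOn ℝ ∞ f (I ×ˢ J))
    (ha : ContDiffOn ℝ ∞ a (I ×ˢ J)) (hb : ContDiffOn ℝ ∞ b (I ×ˢ J))
    (hac : ∀ x ∈ I, a (x, c) ≠ 0) (hbc : ∀ x ∈ I, b (x, c) = 0)
    (hbc' : ∀ x ∈ I, fderiv ℝ b (x, c) (0, 1) ≠ 0) :
    ∃ (β γ : E → ℝ) (m : E × ℝ → ℝ), ContDiffOn ℝ ∞ β I ∧ ContDiffOn ℝ ∞ γ I ∧
      ContDiffOn ℝ ∞ m (I ×ˢ J) ∧ ∀ x ∈ I, ∀ t ∈ J,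
        f (x, t) + β x * a (x, t) + γ x * b (x, t) + (t - c) ^ 2 * m (x, t) = 0 := by
  have hU : IsOpen (I ×ˢ J) := hI.prod hJ
  have restrict : ∀ {h : E × ℝ → ℝ}, ContDiffOn ℝ ∞ h (I ×ˢ J) →
      ContDiffOn ℝ ∞ (fun x => h (x, c)) I := fun hh =>
    hh.comp (f := fun x : E => (x, c)) (by fun_prop) fun x hx => ⟨hx, hc⟩
  have extend : ∀ {h : E → ℝ}, ContDiffOn ℝ ∞ h I →
      ContDiffOn ℝ ∞ (fun p : E × ℝ => h p.1) (I ×ˢ J) := fun hh =>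
    hh.comp (f := fun p : E × ℝ => p.1) (by fun_prop) fun p hp => hp.1
  have partial_smooth : ∀ {h : E × ℝ → ℝ}, ContDiffOn ℝ ∞ h (I ×ˢ J) →
      ContDiffOn ℝ ∞ (fun p => fderiv ℝ h p (0, 1)) (I ×ˢ J) := fun hh =>
    (hh.fderiv_of_isOpen hU (by simp)).clm_apply contDiffOn_const
  have differentiable : ∀ {h : E × ℝ → ℝ}, ContDiffOn ℝ ∞ h (I ×ˢ J) → ∀ x ∈ I,
      DifferentiableAt ℝ h (x, c) := fun hh x hx =>
    (hh.contDiffAt (hU.mem_nhds ⟨hx, hc⟩)).differentiableAt (by simp)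
  set β : E → ℝ := fun x => -f (x, c) / a (x, c) with hβ_def
  have hβ : ContDiffOn ℝ ∞ β I := (restrict hf).neg.div (restrict ha) hac
  set k : E × ℝ → ℝ := fun p => f p + β p.1 * a p with hk_def
  have hk : ContDiffOn ℝ ∞ k (I ×ˢ J) := hf.add ((extend hβ).mul ha)
  have hkc : ∀ x ∈ I, k (x, c) = 0 := fun x hx => by
    simp only [hk_def, hβ_def, div_mul_cancel₀ _ (hac x hx), add_neg_cancel]
  set γ : E → ℝ := fun x => -fderiv ℝ k (x, c) (0, 1) / fderiv ℝ b (x, c) (0, 1) with hγ_def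
  have hγ : ContDiffOn ℝ ∞ γ I :=
    (restrict (partial_smooth hk)).neg.div (restrict (partial_smooth hb)) hbc'
  obtain ⟨m, hm, hkm⟩ := exists_contDiffOn_eq_sub_sq_smul hU (T := fun p => k p + γ p.1 * b p)
    (hk.add ((extend hγ).mul hb)) c (fun x hx => by simp [hkc x hx.1, hbc x hx.1]) fun x hx =>
      ((hasDerivAt_comp_prodMk (differentiable hk x hx.1)).add
        ((hasDerivAt_comp_prodMk (differentiable hb x hx.1)).const_mul (γ x))).congr_deriv
          (by rw [hγ_def, div_mul_cancel₀ _ (hbc' x hx.1), add_neg_cancel])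
  refine ⟨β, γ, fun p => -m p, hβ, hγ, hm.neg, fun x hx t ht => ?_⟩
  linear_combination hkm (x, t) ⟨hx, ht⟩

end Interpolation

section Deviation

theorem hasDerivAt_log_add_const {a r : ℝ} (h : r + a ≠ 0) :
    HasDerivAt (fun r => Real.log (r + a)) (r + a)⁻¹ r :=
  (((hasDerivAt_id r).add_const a).log h).congr_deriv (one_div _)

theorem hasDerivAt_inv_add_const {a r : ℝ} (h : r + a ≠ 0) :
    HasDerivAt (fun r => (r + a)⁻¹) (-((r + a) ^ 2)⁻¹) r :=
  (((hasDerivAt_id r).add_const a).inv h).congr_deriv (by rw [neg_div, one_div, id])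

/-- The first order deviation, as a function of the distance `r` to the origin, of the outlying
spheres from the unit sphere about the point at distance `2` on the axis. It solves the linearized
constant mean curvature equation `deviation_equation`, whose kernel is spanned by `r ^ 2 - 5` (the
translations along the axis); the multiple of `r ^ 2 - 5` is chosen such that `deviation 1 = 0`. -/
def deviation (r : ℝ) : ℝ :=
  r - 3 - (r ^ 2 - 5) / 2 * (Real.log (r + 3) - Real.log (r + 1) - Real.log 2 + 1)

/-- The derivative of `deviation`. -/
def deviationDeriv (r : ℝ) : ℝ :=
  1 - r * (Real.log (r + 3) - Real.log (r + 1) - Real.log 2 + 1) -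
    (r ^ 2 - 5) / 2 * ((r + 3)⁻¹ - (r + 1)⁻¹)

/-- The second derivative of `deviation`. -/
def deviationDeriv₂ (r : ℝ) : ℝ :=
  -(Real.log (r + 3) - Real.log (r + 1) - Real.log 2 + 1) - 2 * r * ((r + 3)⁻¹ - (r + 1)⁻¹) -
    (r ^ 2 - 5) / 2 * (-((r + 3) ^ 2)⁻¹ + ((r + 1) ^ 2)⁻¹)

theorem deviation_one : deviation 1 = 0 := by
  have hlog : Real.log (1 + 3) = 2 * Real.log 2 := by
    rw [show (1 + 3 : ℝ) = 2 ^ 2 by norm_num, Real.log_pow, Nat.cast_ofNat]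
  rw [deviation, hlog, one_add_one_eq_two]
  ring

variable {r : ℝ}

theorem hasDerivAt_deviation (hr : 0 < r) : HasDerivAt deviation (deviationDeriv r) r := by
  have hlog := (((hasDerivAt_log_add_const (a := 3) (by positivity : r + 3 ≠ 0)).sub
    (hasDerivAt_log_add_const (a := 1) (by positivity : r + 1 ≠ 0))).sub_const
      (Real.log 2)).add_const 1
  refine (((hasDerivAt_id r).sub_const 3).sub
    ((((hasDerivAt_pow 2 r).sub_const 5).div_const 2).mul hlog)).congr_deriv ?_
  simp only [deviationDeriv, Pi.sub_apply]
  norm_num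
  ring

theorem hasDerivAt_deviationDeriv (hr : 0 < r) :
    HasDerivAt deviationDeriv (deviationDeriv₂ r) r := by
  have h3 : r + 3 ≠ 0 := by positivity
  have h1 : r + 1 ≠ 0 := by positivity
  have hlog := (((hasDerivAt_log_add_const h3).sub (hasDerivAt_log_add_const h1)).sub_const
    (Real.log 2)).add_const 1
  have hinv := (hasDerivAt_inv_add_const h3).sub (hasDerivAt_inv_add_const h1)
  refine ((((hasDerivAt_id r).mul hlog).const_sub 1).sub
    ((((hasDerivAt_pow 2 r).sub_const 5).div_const 2).mul hinv)).congr_deriv ?_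
  simp only [deviationDeriv₂, Pi.sub_apply, id]
  norm_num
  ring

theorem deviation_equation (hr : 0 < r) :
    -2 / r + 2 * (deviationDeriv₂ r + deviationDeriv r / r) -
      4 * (deviationDeriv r * (r ^ 2 - 3) / (2 * r) - deviation r) -
      (3 - r ^ 2) ^ 2 / (2 * r ^ 2) * (deviationDeriv₂ r - deviationDeriv r / r) +
      (3 - r ^ 2) / r ^ 3 + 4 = 0 := by
  have h3 : r + 3 ≠ 0 := by positivity
  have h1 : r + 1 ≠ 0 := by positivity
  simp only [deviation, deviationDeriv, deviationDeriv₂]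
  generalize Real.log (r + 3) - Real.log (r + 1) - Real.log 2 + 1 = L
  field_simp
  ring

theorem contDiffAt_deviation (hr : 0 < r) : ContDiffAt ℝ ∞ deviation r := by
  have h3 : r + 3 ≠ 0 := by positivity
  have h1 : r + 1 ≠ 0 := by positivity
  unfold deviation
  fun_prop (disch := assumption)

theorem contDiffAt_deviationDeriv (hr : 0 < r) : ContDiffAt ℝ ∞ deviationDeriv r := by
  have h3 : r + 3 ≠ 0 := by positivity
  have h1 : r + 1 ≠ 0 := by positivity
  unfold deviationDeriv
  fun_prop (disch := assumption)

theorem contDiffAt_deviationDeriv₂ (hr : 0 < r) : ContDiffAt ℝ ∞ deviationDeriv₂ r := by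
  have h3 : r + 3 ≠ 0 := by positivity
  have h1 : r + 1 ≠ 0 := by positivity
  have h3' : (r + 3) ^ 2 ≠ 0 := by positivity
  have h1' : (r + 1) ^ 2 ≠ 0 := by positivity
  unfold deviationDeriv₂
  fun_prop (disch := assumption)

end Deviation

section Profile

/-- The outlying sphere in the unit direction `e` is mapped onto the unit sphere about `0` by
`y ↦ dilation ε ‖y‖ • (y - 2 • e)`. -/
def dilation (ε r : ℝ) : ℝ := 1 + 2 * ε * deviation r

/-- The outlying sphere in the unit direction `e` is `{y | ⟪e, y⟫ = height ε ‖y‖}`. -/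
def height (ε r : ℝ) : ℝ := (r ^ 2 + 4 - (dilation ε r ^ 2)⁻¹) / 4

/-- The derivative of `height ε`. -/
def heightDeriv (ε r : ℝ) : ℝ := r / 2 + ε * deviationDeriv r * (dilation ε r ^ 3)⁻¹

/-- The second derivative of `height ε`. -/
def heightDeriv₂ (ε r : ℝ) : ℝ :=
  1 / 2 + ε * deviationDeriv₂ r * (dilation ε r ^ 3)⁻¹ -
    6 * ε ^ 2 * deviationDeriv r ^ 2 * (dilation ε r ^ 4)⁻¹

/-- The squared length of the normal field `(heightDeriv ε ‖y‖ / ‖y‖) • y - e` of the outlying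
sphere, as a function of `r = ‖y‖`. -/
def normalSq (ε r : ℝ) : ℝ := 1 - 2 * heightDeriv ε r * height ε r / r + heightDeriv ε r ^ 2

/-- The length of the normal field of the outlying sphere. -/
def normalLen (ε r : ℝ) : ℝ := √(normalSq ε r)

/-- Minus the radial component of the normal field of the outlying sphere. -/
def radialPart (ε r : ℝ) : ℝ := height ε r / r - heightDeriv ε r

/-- The Euclidean mean curvature of the outlying sphere. -/
def flatMeanCurv (ε r : ℝ) : ℝ :=
  ((heightDeriv₂ ε r + heightDeriv ε r / r) * normalSq ε r -
    (heightDeriv₂ ε r - heightDeriv ε r / r) * radialPart ε r ^ 2) /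
    (normalLen ε r * normalSq ε r)

/-- The function `w` for which the Schwarzschild metric of mass `1`, dilated such that the sphere
of radius `ε⁻¹` becomes the unit sphere, is `w⁻² δ`. -/
def schwFactor (ε r : ℝ) : ℝ := ((1 + ε / (2 * r)) ^ 2)⁻¹

/-- The derivative of `schwFactor ε`. -/
def schwFactorDeriv (ε r : ℝ) : ℝ := ε / r ^ 2 * ((1 + ε / (2 * r)) ^ 3)⁻¹

/-- The mean curvature of the centred unit sphere in the dilated Schwarzschild metric. -/
def centredMeanCurv (ε : ℝ) : ℝ := 2 * schwFactor ε 1 - 2 * schwFactorDeriv ε 1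

/-- The difference between the mean curvatures of the outlying sphere and of the centred unit
sphere in the dilated Schwarzschild metric. -/
def defect (ε r : ℝ) : ℝ :=
  schwFactor ε r * flatMeanCurv ε r + 2 * radialPart ε r * schwFactorDeriv ε r / normalLen ε r -
    centredMeanCurv ε

/-- The change of the mean curvature of the outlying sphere in a metric `w⁻² δ` when the
coordinate along the axis is added to `w`. -/
def heightEffect (ε r : ℝ) : ℝ :=
  flatMeanCurv ε r * height ε r + 2 / normalLen ε r * (1 - heightDeriv ε r * height ε r / r)

/-- The change of the mean curvature of the outlying sphere in a metric `w⁻² δ` when the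
difference of `r` and the coordinate along the axis is added to `w`. -/
def gapEffect (ε r : ℝ) : ℝ :=
  flatMeanCurv ε r * (r - height ε r) +
    2 / normalLen ε r * (radialPart ε r - (1 - heightDeriv ε r * height ε r / r))

variable {ε r : ℝ}

theorem hasDerivAt_dilation (hr : 0 < r) :
    HasDerivAt (dilation ε) (2 * ε * deviationDeriv r) r :=
  ((hasDerivAt_deviation hr).const_mul (2 * ε)).const_add 1

theorem hasDerivAt_height (hr : 0 < r) (hD : dilation ε r ≠ 0) :
    HasDerivAt (height ε) (heightDeriv ε r) r := by
  refine ((((hasDerivAt_pow 2 r).add_const 4).sub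
    (((hasDerivAt_dilation (ε := ε) hr).pow 2).inv (pow_ne_zero 2 hD))).div_const
      4).congr_deriv ?_
  simp only [heightDeriv, Pi.pow_apply]
  field_simp
  ring

theorem hasDerivAt_heightDeriv (hr : 0 < r) (hD : dilation ε r ≠ 0) :
    HasDerivAt (heightDeriv ε) (heightDeriv₂ ε r) r := by
  refine (((hasDerivAt_id r).div_const 2).add (((hasDerivAt_deviationDeriv hr).const_mul ε).mul
    (((hasDerivAt_dilation (ε := ε) hr).pow 3).inv (pow_ne_zero 3 hD)))).congr_deriv ?_
  simp only [heightDeriv₂, Pi.pow_apply, Pi.inv_apply]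
  field_simp
  ring

theorem hasDerivAt_schwFactor (hr : r ≠ 0) (hw : 1 + ε / (2 * r) ≠ 0) :
    HasDerivAt (schwFactor ε) (schwFactorDeriv ε r) r := by
  have hinner : HasDerivAt (fun r => 1 + ε / (2 * r)) (-ε / (2 * r ^ 2)) r := by
    refine ((((hasDerivAt_id r).const_mul 2).inv (by simpa using hr)).const_mul ε).const_add
      1 |>.congr_deriv ?_
    simp only [id]
    field_simp
  refine ((hinner.pow 2).inv (pow_ne_zero 2 hw)).congr_deriv ?_
  simp only [schwFactorDeriv, Pi.pow_apply]
  generalize 1 + ε / (2 * r) = φ at hw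
  field_simp
  norm_num
  ring

end Profile

section FirstOrder

theorem dilation_zero (r : ℝ) : dilation 0 r = 1 := by simp [dilation]

theorem height_zero (r : ℝ) : height 0 r = (r ^ 2 + 3) / 4 := by
  rw [height, dilation_zero]
  ring

theorem heightDeriv_zero (r : ℝ) : heightDeriv 0 r = r / 2 := by simp [heightDeriv]

theorem heightDeriv₂_zero (r : ℝ) : heightDeriv₂ 0 r = 1 / 2 := by simp [heightDeriv₂]

theorem schwFactor_zero (r : ℝ) : schwFactor 0 r = 1 := by simp [schwFactor]

theorem schwFactorDeriv_zero (r : ℝ) : schwFactorDeriv 0 r = 0 := by simp [schwFactorDeriv]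

theorem centredMeanCurv_zero : centredMeanCurv 0 = 2 := by
  simp [centredMeanCurv, schwFactor_zero, schwFactorDeriv_zero]

theorem height_one (ε : ℝ) : height ε 1 = 1 := by norm_num [height, dilation, deviation_one]

theorem gapEffect_one (ε : ℝ) : gapEffect ε 1 = 0 := by simp [gapEffect, height_one, radialPart]

theorem hasDerivAt_dilation_zero (r : ℝ) :
    HasDerivAt (fun ε => dilation ε r) (2 * deviation r) 0 :=
  ((((hasDerivAt_id (0 : ℝ)).const_mul 2).mul_const (deviation r)).const_add 1).congr_deriv
    (by ring)

theorem hasDerivAt_height_zero (r : ℝ) : HasDerivAt (fun ε => height ε r) (deviation r) 0 := by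
  refine (((((hasDerivAt_dilation_zero r).pow 2).inv
    (by simp [dilation_zero])).const_sub (r ^ 2 + 4)).div_const 4).congr_deriv ?_
  simp only [Pi.pow_apply, dilation_zero]
  ring

theorem hasDerivAt_heightDeriv_zero (r : ℝ) :
    HasDerivAt (fun ε => heightDeriv ε r) (deviationDeriv r) 0 :=
  ((((hasDerivAt_id (0 : ℝ)).mul_const (deviationDeriv r)).mul (((hasDerivAt_dilation_zero r).pow
    3).inv (by simp [dilation_zero]))).const_add (r / 2)).congr_deriv (by simp [dilation_zero])

theorem hasDerivAt_heightDeriv₂_zero (r : ℝ) :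
    HasDerivAt (fun ε => heightDeriv₂ ε r) (deviationDeriv₂ r) 0 := by
  have hlinear := (((hasDerivAt_id (0 : ℝ)).mul_const (deviationDeriv₂ r)).mul
    (((hasDerivAt_dilation_zero r).pow 3).inv (by simp [dilation_zero]))).const_add (1 / 2)
  have hquadratic := ((((hasDerivAt_id (0 : ℝ)).pow 2).const_mul 6).mul_const
    (deviationDeriv r ^ 2)).mul (((hasDerivAt_dilation_zero r).pow 4).inv (by simp [dilation_zero]))
  exact (hlinear.sub hquadratic).congr_deriv (by simp [dilation_zero])

theorem hasDerivAt_schwFactor_zero (r : ℝ) :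
    HasDerivAt (fun ε => schwFactor ε r) (-1 / r) 0 := by
  refine ((((hasDerivAt_id (0 : ℝ)).div_const (2 * r)).const_add 1).pow 2).inv
    (by simp) |>.congr_deriv ?_
  simp only [Pi.pow_apply, id, zero_div, add_zero]
  norm_num
  ring

theorem hasDerivAt_schwFactorDeriv_zero (r : ℝ) :
    HasDerivAt (fun ε => schwFactorDeriv ε r) (1 / r ^ 2) 0 :=
  ((hasDerivAt_id (0 : ℝ)).div_const (r ^ 2)).mul
    (((((hasDerivAt_id (0 : ℝ)).div_const (2 * r)).const_add 1).pow 3).inv (by simp))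
    |>.congr_deriv (by simp)

variable {r : ℝ}

theorem radialPart_zero (hr : r ≠ 0) : radialPart 0 r = (3 - r ^ 2) / (4 * r) := by
  rw [radialPart, height_zero, heightDeriv_zero]
  field_simp
  ring

theorem normalSq_zero (hr : r ≠ 0) : normalSq 0 r = 1 / 4 := by
  rw [normalSq, height_zero, heightDeriv_zero]
  field_simp
  ring

theorem normalLen_zero (hr : r ≠ 0) : normalLen 0 r = 1 / 2 := by
  rw [normalLen, normalSq_zero hr, show (1 / 4 : ℝ) = (1 / 2) ^ 2 by norm_num,
    Real.sqrt_sq (by norm_num)]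

theorem flatMeanCurv_zero (hr : r ≠ 0) : flatMeanCurv 0 r = 2 := by
  rw [flatMeanCurv, heightDeriv₂_zero, heightDeriv_zero, normalLen_zero hr, normalSq_zero hr]
  field_simp
  ring

theorem defect_zero (hr : r ≠ 0) : defect 0 r = 0 := by
  simp [defect, schwFactor_zero, schwFactorDeriv_zero, flatMeanCurv_zero hr, centredMeanCurv_zero]

theorem heightEffect_zero_one : heightEffect 0 1 = 4 := by
  rw [heightEffect, flatMeanCurv_zero one_ne_zero, height_one, normalLen_zero one_ne_zero,
    heightDeriv_zero]
  norm_num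

theorem gapEffect_zero (hr : r ≠ 0) : gapEffect 0 r = r + 3 * r⁻¹ - 4 := by
  rw [gapEffect, flatMeanCurv_zero hr, height_zero, normalLen_zero hr, heightDeriv_zero,
    radialPart_zero hr]
  field_simp
  ring

theorem hasDerivAt_normalSq_zero (hr : r ≠ 0) :
    HasDerivAt (fun ε => normalSq ε r) (deviationDeriv r * (r ^ 2 - 3) / (2 * r) - deviation r)
      0 := by
  refine ((((((hasDerivAt_heightDeriv_zero r).const_mul 2).mul
    (hasDerivAt_height_zero r)).div_const r).const_sub 1).add
      ((hasDerivAt_heightDeriv_zero r).pow 2)).congr_deriv ?_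
  simp only [heightDeriv_zero, height_zero]
  field_simp
  ring

theorem hasDerivAt_normalLen_zero (hr : r ≠ 0) :
    HasDerivAt (fun ε => normalLen ε r) (deviationDeriv r * (r ^ 2 - 3) / (2 * r) - deviation r)
      0 := by
  have hlen : √(normalSq 0 r) = 1 / 2 := normalLen_zero hr
  refine ((hasDerivAt_normalSq_zero hr).sqrt (by simp [normalSq_zero hr])).congr_deriv ?_
  rw [hlen]
  ring

theorem hasDerivAt_radialPart_zero (r : ℝ) :
    HasDerivAt (fun ε => radialPart ε r) (deviation r / r - deviationDeriv r) 0 :=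
  ((hasDerivAt_height_zero r).div_const r).sub (hasDerivAt_heightDeriv_zero r)

theorem hasDerivAt_flatMeanCurv_zero (hr : r ≠ 0) :
    HasDerivAt (fun ε => flatMeanCurv ε r)
      (2 * (deviationDeriv₂ r + deviationDeriv r / r) -
        4 * (deviationDeriv r * (r ^ 2 - 3) / (2 * r) - deviation r) -
        (3 - r ^ 2) ^ 2 / (2 * r ^ 2) * (deviationDeriv₂ r - deviationDeriv r / r)) 0 := by
  have hquot := (hasDerivAt_heightDeriv_zero r).div_const r
  refine ((((hasDerivAt_heightDeriv₂_zero r).add hquot).mul (hasDerivAt_normalSq_zero hr)).sub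
    (((hasDerivAt_heightDeriv₂_zero r).sub hquot).mul
      ((hasDerivAt_radialPart_zero r).pow 2))).div
    ((hasDerivAt_normalLen_zero hr).mul (hasDerivAt_normalSq_zero hr))
    (by simp [normalSq_zero hr, normalLen_zero hr]) |>.congr_deriv ?_
  simp only [Pi.add_apply, Pi.sub_apply, Pi.mul_apply, Pi.pow_apply, heightDeriv₂_zero,
    heightDeriv_zero, normalSq_zero hr, normalLen_zero hr, radialPart_zero hr]
  field_simp
  ring

theorem hasDerivAt_defect_zero (hr : 0 < r) : HasDerivAt (fun ε => defect ε r) 0 0 := by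
  have hr' := hr.ne'
  have hcentred := ((hasDerivAt_schwFactor_zero 1).const_mul 2).sub
    ((hasDerivAt_schwFactorDeriv_zero 1).const_mul 2)
  refine (((hasDerivAt_schwFactor_zero r).mul (hasDerivAt_flatMeanCurv_zero hr')).add
    ((((hasDerivAt_radialPart_zero r).const_mul 2).mul (hasDerivAt_schwFactorDeriv_zero r)).div
      (hasDerivAt_normalLen_zero hr') (by simp [normalLen_zero hr']))).sub hcentred
        |>.congr_deriv ?_
  simp only [Pi.mul_apply, schwFactor_zero, schwFactorDeriv_zero, flatMeanCurv_zero hr',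
    normalLen_zero hr', radialPart_zero hr']
  refine Eq.trans ?_ (deviation_equation hr)
  field_simp
  ring

end FirstOrder

section Regularity

/-- The parameters `(ε, r)` at which the profile functions of the outlying sphere are smooth. -/
structure Regular (p : ℝ × ℝ) : Prop where
  pos : 0 < p.2
  dilation_pos : 0 < dilation p.1 p.2
  normalSq_pos : 0 < normalSq p.1 p.2
  schwFactor_base_pos : 0 < 1 + p.1 / (2 * p.2)

variable {p : ℝ × ℝ} {r : ℝ}

theorem contDiffAt_dilation (hp : 0 < p.2) :
    ContDiffAt ℝ ∞ (fun p : ℝ × ℝ => dilation p.1 p.2) p := by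
  have hdev := (contDiffAt_deviation hp).fun_comp p contDiffAt_snd
  unfold dilation
  fun_prop

theorem contDiffAt_height (hp : 0 < p.2) (hD : 0 < dilation p.1 p.2) :
    ContDiffAt ℝ ∞ (fun p : ℝ × ℝ => height p.1 p.2) p := by
  have hdil := contDiffAt_dilation hp
  have hD2 : dilation p.1 p.2 ^ 2 ≠ 0 := by positivity
  unfold height
  fun_prop (disch := assumption)

theorem contDiffAt_heightDeriv (hp : 0 < p.2) (hD : 0 < dilation p.1 p.2) :
    ContDiffAt ℝ ∞ (fun p : ℝ × ℝ => heightDeriv p.1 p.2) p := by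
  have hdil := contDiffAt_dilation hp
  have hdev := (contDiffAt_deviationDeriv hp).fun_comp p contDiffAt_snd
  have hD3 : dilation p.1 p.2 ^ 3 ≠ 0 := by positivity
  unfold heightDeriv
  fun_prop (disch := assumption)

theorem contDiffAt_heightDeriv₂ (hp : 0 < p.2) (hD : 0 < dilation p.1 p.2) :
    ContDiffAt ℝ ∞ (fun p : ℝ × ℝ => heightDeriv₂ p.1 p.2) p := by
  have hdil := contDiffAt_dilation hp
  have hdev := (contDiffAt_deviationDeriv hp).fun_comp p contDiffAt_snd
  have hdev₂ := (contDiffAt_deviationDeriv₂ hp).fun_comp p contDiffAt_snd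
  have hD3 : dilation p.1 p.2 ^ 3 ≠ 0 := by positivity
  have hD4 : dilation p.1 p.2 ^ 4 ≠ 0 := by positivity
  unfold heightDeriv₂
  fun_prop (disch := assumption)

theorem contDiffAt_normalSq (hp : 0 < p.2) (hD : 0 < dilation p.1 p.2) :
    ContDiffAt ℝ ∞ (fun p : ℝ × ℝ => normalSq p.1 p.2) p := by
  have hz := contDiffAt_height hp hD
  have hz' := contDiffAt_heightDeriv hp hD
  have hr := hp.ne'
  unfold normalSq
  fun_prop (disch := assumption)

theorem contDiffAt_radialPart (hp : 0 < p.2) (hD : 0 < dilation p.1 p.2) :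
    ContDiffAt ℝ ∞ (fun p : ℝ × ℝ => radialPart p.1 p.2) p := by
  have hz := contDiffAt_height hp hD
  have hz' := contDiffAt_heightDeriv hp hD
  have hr := hp.ne'
  unfold radialPart
  fun_prop (disch := assumption)

theorem contDiffAt_schwFactor (hp : p.2 ≠ 0) (hw : 1 + p.1 / (2 * p.2) ≠ 0) :
    ContDiffAt ℝ ∞ (fun p : ℝ × ℝ => schwFactor p.1 p.2) p := by
  have hp2 : 2 * p.2 ≠ 0 := by simpa using hp
  have hw2 : (1 + p.1 / (2 * p.2)) ^ 2 ≠ 0 := pow_ne_zero 2 hw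
  unfold schwFactor
  fun_prop (disch := assumption)

theorem contDiffAt_schwFactorDeriv (hp : p.2 ≠ 0) (hw : 1 + p.1 / (2 * p.2) ≠ 0) :
    ContDiffAt ℝ ∞ (fun p : ℝ × ℝ => schwFactorDeriv p.1 p.2) p := by
  have hp2 : 2 * p.2 ≠ 0 := by simpa using hp
  have hsq : p.2 ^ 2 ≠ 0 := pow_ne_zero 2 hp
  have hw3 : (1 + p.1 / (2 * p.2)) ^ 3 ≠ 0 := pow_ne_zero 3 hw
  unfold schwFactorDeriv
  fun_prop (disch := assumption)

theorem contDiffAt_centredMeanCurv {ε : ℝ} (hε : 1 + ε / 2 ≠ 0) :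
    ContDiffAt ℝ ∞ centredMeanCurv ε := by
  have hbase : 1 + ε / (2 * 1) ≠ 0 := by simpa using hε
  have hpair : ContDiffAt ℝ ∞ (fun ε : ℝ => (ε, (1 : ℝ))) ε := by fun_prop
  have hw := (contDiffAt_schwFactor (p := (ε, 1)) one_ne_zero hbase).fun_comp ε hpair
  have hw' := (contDiffAt_schwFactorDeriv (p := (ε, 1)) one_ne_zero hbase).fun_comp ε hpair
  unfold centredMeanCurv
  fun_prop

namespace Regular

theorem normalLen_pos (hp : Regular p) : 0 < normalLen p.1 p.2 :=
  Real.sqrt_pos.2 hp.normalSq_pos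

theorem contDiffAt_normalLen (hp : Regular p) :
    ContDiffAt ℝ ∞ (fun p : ℝ × ℝ => normalLen p.1 p.2) p :=
  (contDiffAt_normalSq hp.pos hp.dilation_pos).sqrt hp.normalSq_pos.ne'

theorem contDiffAt_flatMeanCurv (hp : Regular p) :
    ContDiffAt ℝ ∞ (fun p : ℝ × ℝ => flatMeanCurv p.1 p.2) p := by
  have hr := hp.pos.ne'
  have hz' := contDiffAt_heightDeriv hp.pos hp.dilation_pos
  have hz'' := contDiffAt_heightDeriv₂ hp.pos hp.dilation_pos
  have hsq := contDiffAt_normalSq hp.pos hp.dilation_pos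
  have hrad := contDiffAt_radialPart hp.pos hp.dilation_pos
  have hlen := hp.contDiffAt_normalLen
  have hden := (mul_pos hp.normalLen_pos hp.normalSq_pos).ne'
  unfold flatMeanCurv
  fun_prop (disch := assumption)

theorem contDiffAt_defect (hp : Regular p) (hε : 1 + p.1 / 2 ≠ 0) :
    ContDiffAt ℝ ∞ (fun p : ℝ × ℝ => defect p.1 p.2) p := by
  have hcentred := (contDiffAt_centredMeanCurv hε).fun_comp p contDiffAt_fst
  have hw := contDiffAt_schwFactor hp.pos.ne' hp.schwFactor_base_pos.ne'
  have hw' := contDiffAt_schwFactorDeriv hp.pos.ne' hp.schwFactor_base_pos.ne'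
  have hcurv := hp.contDiffAt_flatMeanCurv
  have hrad := contDiffAt_radialPart hp.pos hp.dilation_pos
  have hlen := hp.contDiffAt_normalLen
  have hlen_ne := hp.normalLen_pos.ne'
  unfold defect
  fun_prop (disch := assumption)

theorem contDiffAt_heightEffect (hp : Regular p) :
    ContDiffAt ℝ ∞ (fun p : ℝ × ℝ => heightEffect p.1 p.2) p := by
  have hr := hp.pos.ne'
  have hz := contDiffAt_height hp.pos hp.dilation_pos
  have hz' := contDiffAt_heightDeriv hp.pos hp.dilation_pos
  have hcurv := hp.contDiffAt_flatMeanCurv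
  have hlen := hp.contDiffAt_normalLen
  have hlen_ne := hp.normalLen_pos.ne'
  unfold heightEffect
  fun_prop (disch := assumption)

theorem contDiffAt_gapEffect (hp : Regular p) :
    ContDiffAt ℝ ∞ (fun p : ℝ × ℝ => gapEffect p.1 p.2) p := by
  have hr := hp.pos.ne'
  have hz := contDiffAt_height hp.pos hp.dilation_pos
  have hz' := contDiffAt_heightDeriv hp.pos hp.dilation_pos
  have hcurv := hp.contDiffAt_flatMeanCurv
  have hrad := contDiffAt_radialPart hp.pos hp.dilation_pos
  have hlen := hp.contDiffAt_normalLen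
  have hlen_ne := hp.normalLen_pos.ne'
  unfold gapEffect
  fun_prop (disch := assumption)

end Regular

theorem eventually_regular (hr : 0 < r) : ∀ᶠ p in 𝓝 ((0 : ℝ), r), Regular p := by
  have hD : 0 < dilation 0 r := by simp [dilation_zero]
  have hbase : ContinuousAt (fun p : ℝ × ℝ => 1 + p.1 / (2 * p.2)) (0, r) := by
    have : 2 * ((0 : ℝ), r).2 ≠ 0 := by simpa using hr.ne'
    fun_prop (disch := assumption)
  have hsq₀ : 0 < normalSq 0 r := by simp [normalSq_zero hr.ne']
  have hbase₀ : 0 < 1 + 0 / (2 * r) := by simp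
  filter_upwards [continuousAt_snd.eventually (lt_mem_nhds hr),
    (contDiffAt_dilation (p := (0, r)) hr).continuousAt.eventually (lt_mem_nhds hD),
    (contDiffAt_normalSq (p := (0, r)) hr hD).continuousAt.eventually
      (lt_mem_nhds hsq₀), hbase.eventually (lt_mem_nhds hbase₀)] with p hpos hdil hsq hw
  exact ⟨hpos, hdil, hsq, hw⟩

theorem eventually_forall_regular {K : Set ℝ} (hK : IsCompact K) (hpos : ∀ r ∈ K, 0 < r) :
    ∀ᶠ ε in 𝓝 (0 : ℝ), ∀ r ∈ K, Regular (ε, r) :=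
  hK.eventually_forall_of_forall_eventually fun r hr => eventually_regular (hpos r hr)

theorem regular_zero (hr : 0 < r) : Regular (0, r) := (eventually_regular hr).self_of_nhds

end Regularity

section Correction

theorem eventually_heightEffect_one_ne_zero : ∀ᶠ ε in 𝓝 (0 : ℝ), heightEffect ε 1 ≠ 0 := by
  have hcont : ContinuousAt (fun ε => heightEffect ε 1) 0 :=
    (regular_zero one_pos).contDiffAt_heightEffect.continuousAt.comp_of_eq
      (f := fun ε : ℝ => (ε, (1 : ℝ))) (by fun_prop) rfl
  exact hcont.eventually_ne (by simp [heightEffect_zero_one])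

theorem fderiv_gapEffect_zero_one :
    fderiv ℝ (fun p : ℝ × ℝ => gapEffect p.1 p.2) (0, 1) (0, 1) = -2 := by
  have hslice := hasDerivAt_comp_prodMk
    ((regular_zero one_pos).contDiffAt_gapEffect.differentiableAt (by simp))
  have hexplicit : HasDerivAt (fun r : ℝ => r + 3 * r⁻¹ - 4) (-2) 1 :=
    (((hasDerivAt_id (1 : ℝ)).add ((hasDerivAt_inv one_ne_zero).const_mul 3)).sub_const
      4).congr_deriv (by norm_num)
  refine hslice.unique (hexplicit.congr_of_eventuallyEq ?_)
  filter_upwards [isOpen_ne.mem_nhds one_ne_zero] with r hr using gapEffect_zero hr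

theorem eventually_fderiv_gapEffect_one_ne_zero : ∀ᶠ ε in 𝓝 (0 : ℝ),
    fderiv ℝ (fun p : ℝ × ℝ => gapEffect p.1 p.2) (ε, 1) (0, 1) ≠ 0 := by
  have hfderiv : ContinuousAt (fderiv ℝ fun p : ℝ × ℝ => gapEffect p.1 p.2) (0, 1) :=
    ((regular_zero one_pos).contDiffAt_gapEffect.fderiv_right (m := 0) (by simp)).continuousAt
  have hcont : ContinuousAt (fun ε : ℝ =>
      fderiv ℝ (fun p : ℝ × ℝ => gapEffect p.1 p.2) (ε, 1) (0, 1)) 0 :=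
    (hfderiv.comp_of_eq (f := fun ε : ℝ => (ε, (1 : ℝ))) (by fun_prop) rfl).clm_apply
      continuousAt_const
  exact hcont.eventually_ne (by simp [fderiv_gapEffect_zero_one])

theorem exists_contDiffOn_defect_eq_sq_mul {I J : Set ℝ} (hI : IsOpen I) (hJ : IsOpen J)
    (hIpos : ∀ ε ∈ I, 1 + ε / 2 ≠ 0) (hreg : ∀ ε ∈ I, ∀ r ∈ J, Regular (ε, r)) :
    ∃ q : ℝ × ℝ → ℝ, ContDiffOn ℝ ∞ q (I ×ˢ J) ∧
      ∀ ε ∈ I, ∀ r ∈ J, defect ε r = ε ^ 2 * q (ε, r) := by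
  have hswap : ContDiff ℝ ∞ (Prod.swap : ℝ × ℝ → ℝ × ℝ) := contDiff_snd.prodMk contDiff_fst
  obtain ⟨q, hq, hdefect⟩ := exists_contDiffOn_eq_sub_sq_smul (hJ.prod hI)
    (T := fun p => defect p.2 p.1)
    (fun p hp => (ContDiffAt.comp (f := Prod.swap) p
      ((hreg p.2 hp.2 p.1 hp.1).contDiffAt_defect (hIpos p.2 hp.2))
      hswap.contDiffAt).contDiffWithinAt) 0
    (fun r hr => defect_zero (hreg 0 hr.2 r hr.1).pos.ne')
    (fun r hr => hasDerivAt_defect_zero (hreg 0 hr.2 r hr.1).pos)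
  refine ⟨q ∘ Prod.swap, hq.comp hswap.contDiffOn fun p hp => ⟨hp.2, hp.1⟩, fun ε hε r hr => ?_⟩
  simpa using hdefect (r, ε) ⟨hr, hε⟩

/-- Coefficients of a perturbation of the conformal factor that makes the outlying sphere a
surface of constant mean curvature `centredMeanCurv ε`. -/
structure Correction where
  δ : ℝ
  pos : 0 < δ
  le_one : δ ≤ 1
  regular : ∀ ε ∈ Ioo (-δ) δ, ∀ r ∈ Icc (1 / 4 : ℝ) 5, Regular (ε, r)
  β : ℝ → ℝ
  γ : ℝ → ℝ
  m : ℝ × ℝ → ℝ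
  contDiffOn_β : ContDiffOn ℝ ∞ β (Ioo (-δ) δ)
  contDiffOn_γ : ContDiffOn ℝ ∞ γ (Ioo (-δ) δ)
  contDiffOn_m : ContDiffOn ℝ ∞ m (Ioo (-δ) δ ×ˢ Ioo (1 / 4) 5)
  defect_add : ∀ ε ∈ Ioo (-δ) δ, ∀ r ∈ Ioo (1 / 4 : ℝ) 5,
    defect ε r + ε ^ 2 * (β ε * heightEffect ε r + γ ε * gapEffect ε r +
      2 * normalLen ε r * (r - 1) ^ 2 * m (ε, r)) = 0

theorem nonempty_correction : Nonempty Correction := by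
  obtain ⟨δ₀, hδ₀, hnhds⟩ := Metric.eventually_nhds_iff.1
    ((eventually_forall_regular isCompact_Icc (fun r (hr : r ∈ Icc (1 / 4 : ℝ) 5) => by
      linarith [hr.1])).and
        (eventually_heightEffect_one_ne_zero.and eventually_fderiv_gapEffect_one_ne_zero))
  set I : Set ℝ := Ioo (-min δ₀ 1) (min δ₀ 1)
  set J : Set ℝ := Ioo (1 / 4) 5
  have hI : ∀ ε ∈ I, |ε| < δ₀ ∧ |ε| < 1 := fun ε hε => lt_min_iff.1 (abs_lt.2 hε)
  have hgood : ∀ ε ∈ I, _ := fun ε hε => hnhds (by simpa using (hI ε hε).1)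
  have hreg : ∀ ε ∈ I, ∀ r ∈ J, Regular (ε, r) := fun ε hε r hr =>
    (hgood ε hε).1 r (Ioo_subset_Icc_self hr)
  obtain ⟨q, hq, hdefect⟩ := exists_contDiffOn_defect_eq_sq_mul isOpen_Ioo isOpen_Ioo
    (fun ε hε => by linarith [(abs_lt.1 (hI ε hε).2).1]) hreg
  obtain ⟨β, γ, m, hβ, hγ, hm, hsum⟩ := exists_contDiffOn_add_mul_add_mul_add_sub_sq_mul_eq_zero
    isOpen_Ioo isOpen_Ioo (c := 1) (J := J) (by norm_num [J]) hq
    (a := fun p => heightEffect p.1 p.2) (b := fun p => gapEffect p.1 p.2)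
    (fun p hp => (hreg p.1 hp.1 p.2 hp.2).contDiffAt_heightEffect.contDiffWithinAt)
    (fun p hp => (hreg p.1 hp.1 p.2 hp.2).contDiffAt_gapEffect.contDiffWithinAt)
    (fun ε hε => (hgood ε hε).2.1) (fun ε _ => gapEffect_one ε) fun ε hε => (hgood ε hε).2.2
  refine ⟨⟨min δ₀ 1, lt_min hδ₀ one_pos, min_le_right _ _, fun ε hε => (hgood ε hε).1, β, γ,
    fun p => m p / (2 * normalLen p.1 p.2), hβ, hγ, hm.div (fun p hp => ?_) fun p hp => ?_,
    fun ε hε r hr => ?_⟩⟩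
  · exact (contDiffAt_const.mul
      (hreg p.1 hp.1 p.2 hp.2).contDiffAt_normalLen).contDiffWithinAt
  · exact mul_ne_zero two_ne_zero (hreg p.1 hp.1 p.2 hp.2).normalLen_pos.ne'
  · have hlen : normalLen ε r ≠ 0 := (hreg ε hε r hr).normalLen_pos.ne'
    rw [hdefect ε hε r hr]
    field_simp
    linear_combination ε ^ 2 * hsum ε hε r hr

end Correction

section Diffeomorphisms

variable {E : Type*} [NormedAddCommGroup E] [NormedSpace ℝ E] [CompleteSpace E]

theorem exists_hasFDerivAt_equiv_id_add {Θ : E → E} (hΘ : Differentiable ℝ Θ) {K : NNReal}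
    (hK : K < 1) (hL : LipschitzWith K Θ) (x : E) :
    ∃ L : E ≃L[ℝ] E, HasFDerivAt (fun y => y + Θ y) (L : E →L[ℝ] E) x := by
  have hnorm : ‖-fderiv ℝ Θ x‖ < 1 := by
    rw [norm_neg]
    exact (norm_fderiv_le_of_lipschitz ℝ hL).trans_lt (by exact_mod_cast hK)
  refine ⟨ContinuousLinearEquiv.unitsEquiv ℝ E (Units.oneSub _ hnorm), ?_⟩
  have hL : ((ContinuousLinearEquiv.unitsEquiv ℝ E (Units.oneSub _ hnorm) : E ≃L[ℝ] E) :
      E →L[ℝ] E) = ContinuousLinearMap.id ℝ E + fderiv ℝ Θ x :=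
    ContinuousLinearMap.ext fun v => by simp
  rw [hL]
  exact (hasFDerivAt_id x).add (hΘ x).hasFDerivAt

theorem exists_homeomorph_apply_eq_add {Θ : E → E} {K : NNReal} (hK : K < 1)
    (hL : LipschitzWith K Θ) : ∃ h : E ≃ₜ E, ∀ x, h x = x + Θ x := by
  have happrox : ApproximatesLinearOn (fun y => y + Θ y)
      ((ContinuousLinearEquiv.refl ℝ E : E ≃L[ℝ] E) : E →L[ℝ] E) univ K := by
    rw [ApproximatesLinearOn.approximatesLinearOn_iff_lipschitzOnWith, lipschitzOnWith_univ]
    convert hL using 1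
    ext y
    simp
  have hnorm : Subsingleton E ∨
      K < ‖((ContinuousLinearEquiv.refl ℝ E).symm : E →L[ℝ] E)‖₊⁻¹ := by
    refine (subsingleton_or_nontrivial E).imp_right fun hE => ?_
    have : NontrivialTopology E := EMetric.nontrivial_iff_nontrivialTopology.1 hE
    have hid : ‖((ContinuousLinearEquiv.refl ℝ E).symm : E →L[ℝ] E)‖₊ = 1 :=
      ContinuousLinearMap.nnnorm_id
    rwa [hid, inv_one]
  exact ⟨happrox.toHomeomorph _ hnorm, fun x => rfl⟩

theorem exists_diffeomorph_apply_eq_add {Θ : E → E} (hΘ : ContDiff ℝ ∞ Θ) {K : NNReal}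
    (hK : K < 1) (hL : LipschitzWith K Θ) : ∃ Φ : E ≃ₘ[ℝ] E, ∀ x, Φ x = x + Θ x := by
  obtain ⟨h, hh⟩ := exists_homeomorph_apply_eq_add hK hL
  have hsmooth : ContDiff ℝ ∞ h := funext hh ▸ contDiff_id.add hΘ
  refine ⟨⟨h.toEquiv, hsmooth.contMDiff, ContDiff.contMDiff ?_⟩, hh⟩
  refine contDiff_iff_contDiffAt.2 fun y => ?_
  obtain ⟨L, hL'⟩ := exists_hasFDerivAt_equiv_id_add (hΘ.differentiable (by simp)) hK hL (h.symm y)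
  rw [← funext hh] at hL'
  exact h.toOpenPartialHomeomorph.contDiffAt_symm (mem_univ _) hL' hsmooth.contDiffAt

end Diffeomorphisms

section Spheres

theorem isPreconnected_setOf_lt_norm {E : Type*} [NormedAddCommGroup E] [NormedSpace ℝ E]
    (hE : 1 < Module.rank ℝ E) {R : ℝ} (hR : 0 ≤ R) : IsPreconnected {y : E | R < ‖y‖} := by
  have hpolar : {y : E | R < ‖y‖} =
      (fun q : ℝ × E => q.1 • q.2) '' (Ioi R ×ˢ sphere (0 : E) 1) := by
    ext y
    constructor
    · intro hy
      have hy0 : ‖y‖ ≠ 0 := (hR.trans_lt hy).ne'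
      exact ⟨(‖y‖, ‖y‖⁻¹ • y), ⟨hy, by simp [norm_smul, hy0]⟩, by simp [smul_smul, hy0]⟩
    · rintro ⟨⟨t, u⟩, ⟨ht, hu⟩, rfl⟩
      have hu1 : ‖u‖ = 1 := by simpa using hu
      rw [mem_ofPred_eq, norm_smul, hu1, mul_one, Real.norm_eq_abs]
      exact lt_of_lt_of_le ht (le_abs_self t)
  rw [hpolar]
  exact (isPreconnected_Ioi.prod (isPreconnected_sphere hE 0 1)).image _ (by fun_prop)

namespace EmbeddedSphere

/-- The image of the round unit sphere under a diffeomorphism of `ℝ³`. -/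
def ofDiffeomorph (Φ : E3 ≃ₘ[ℝ] E3) : EmbeddedSphere where
  toFun p := Φ p
  smooth := Φ.contMDiff.comp contMDiff_coe_sphere
  injective := Φ.injective.comp Subtype.val_injective
  immersion p := by
    have hΦ : Function.Injective (mfderiv 𝓘(ℝ, E3) 𝓘(ℝ, E3) Φ p) :=
      (Φ.mfderivToContinuousLinearEquiv (by simp) (p : E3)).injective
    have hcomp := mfderiv_comp (I := 𝓡 2) (I' := 𝓘(ℝ, E3)) (I'' := 𝓘(ℝ, E3)) p (g := Φ)
      (f := ((↑) : S2 → E3)) (Φ.mdifferentiable (by simp) _)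
      (contMDiff_coe_sphere.mdifferentiableAt (n := ∞) (by simp))
    have hval : Function.Injective (mfderiv (𝓡 2) 𝓘(ℝ, E3) ((↑) : S2 → E3) p) := by
      convert! injective_mvfderiv_subtypeVal_sphere p
    exact hcomp ▸ hΦ.comp hval

section OfDiffeomorph

variable (Φ : E3 ≃ₘ[ℝ] E3) {x : E3}

@[simp]
theorem ofDiffeomorph_apply (p : S2) : (ofDiffeomorph Φ).toFun p = Φ p := rfl

theorem mem_carrier_ofDiffeomorph : x ∈ (ofDiffeomorph Φ).carrier ↔ ‖Φ.symm x‖ = 1 := by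
  constructor
  · rintro ⟨p, rfl⟩
    simp
  · intro h
    exact ⟨⟨Φ.symm x, by simpa using h⟩, Φ.apply_symm_apply x⟩

theorem norm_symm_lt_one_of_mem_enclosed (hx : x ∈ (ofDiffeomorph Φ).enclosed) :
    ‖Φ.symm x‖ < 1 := by
  obtain ⟨hx_carrier, hbounded⟩ := hx
  rw [mem_carrier_ofDiffeomorph] at hx_carrier
  by_contra hlt
  have hgt : 1 < ‖Φ.symm x‖ := lt_of_le_of_ne (not_lt.1 hlt) (Ne.symm hx_carrier)
  have hrank : 1 < Module.rank ℝ E3 := by simp [← Module.finrank_eq_rank]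
  have hsub : Φ '' {y | 1 < ‖y‖} ⊆ connectedComponentIn (ofDiffeomorph Φ).carrierᶜ x := by
    refine ((isPreconnected_setOf_lt_norm hrank zero_le_one).image _
      Φ.continuous.continuousOn).subset_connectedComponentIn ⟨_, hgt, Φ.apply_symm_apply x⟩ ?_
    rintro _ ⟨y, hy, rfl⟩
    rw [mem_compl_iff, mem_carrier_ofDiffeomorph, Φ.symm_apply_apply]
    exact ne_of_gt hy
  have hcompact : IsCompact (closure (Φ '' {y | 1 < ‖y‖})) :=
    (hbounded.subset hsub).isCompact_closure
  obtain ⟨C, hC⟩ := (hcompact.image Φ.symm.continuous).isBounded.exists_norm_le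
  obtain ⟨y, hy⟩ := NormedSpace.exists_lt_norm ℝ E3 (max C 1)
  have hyC := hC y ⟨Φ y, subset_closure ⟨y, (le_max_right _ _).trans_lt hy, rfl⟩,
    Φ.symm_apply_apply y⟩
  exact hyC.not_gt ((le_max_left C 1).trans_lt hy)

theorem mem_enclosed_of_norm_symm_lt_one (hx : ‖Φ.symm x‖ < 1) :
    x ∈ (ofDiffeomorph Φ).enclosed := by
  have hx_carrier : x ∉ (ofDiffeomorph Φ).carrier := fun h =>
    hx.ne ((mem_carrier_ofDiffeomorph Φ).1 h)
  refine ⟨hx_carrier,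
    ((isCompact_closedBall (0 : E3) 1).image Φ.continuous).isBounded.subset fun y hy => ?_⟩
  refine ⟨Φ.symm y, ?_, Φ.apply_symm_apply y⟩
  rw [mem_closedBall_zero_iff]
  by_contra! hgt
  have himage : IsPreconnected
      ((fun x => ‖Φ.symm x‖) '' connectedComponentIn (ofDiffeomorph Φ).carrierᶜ x) :=
    isPreconnected_connectedComponentIn.image _ Φ.symm.continuous.norm.continuousOn
  obtain ⟨z, hz, hz1⟩ := himage.Icc_subset ⟨x, mem_connectedComponentIn hx_carrier, rfl⟩
    ⟨y, hy, rfl⟩ ⟨hx.le, hgt.le⟩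
  exact connectedComponentIn_subset _ _ hz ((mem_carrier_ofDiffeomorph Φ).2 hz1)

theorem mem_enclosed_ofDiffeomorph : x ∈ (ofDiffeomorph Φ).enclosed ↔ ‖Φ.symm x‖ < 1 :=
  ⟨norm_symm_lt_one_of_mem_enclosed Φ, mem_enclosed_of_norm_symm_lt_one Φ⟩

end OfDiffeomorph

variable (S : EmbeddedSphere) {p : S2}

theorem fderiv_diff_eq_zero {f : E3 → ℝ} {c : ℝ} (hf : DifferentiableAt ℝ f (S.toFun p))
    (hc : ∀ᶠ q in 𝓝 p, f (S.toFun q) = c) (X : TangentSpace (𝓡 2) p) :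
    fderiv ℝ f (S.toFun p) (S.diff p X) = 0 := by
  have hchain := mfderiv_comp (I := 𝓡 2) (I' := 𝓘(ℝ, E3)) (I'' := 𝓘(ℝ, ℝ)) p
    (g := f) (f := S.toFun) hf.mdifferentiableAt (S.smooth.mdifferentiableAt (by simp))
  have hconst : mfderiv (𝓡 2) 𝓘(ℝ, ℝ) (f ∘ S.toFun) p = 0 := by
    have hc' : (f ∘ S.toFun) =ᶠ[𝓝 p] fun _ => c := hc
    rw [hc'.mfderiv_eq, mfderiv_const]
    rfl
  rw [hconst, mfderiv_eq_fderiv] at hchain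
  exact (congrArg (fun L => L X) hchain).symm

theorem finrank_tangentPlane (p : S2) : Module.finrank ℝ (S.tangentPlane p) = 2 := by
  rw [tangentPlane, LinearMap.finrank_range_of_inj (f := (S.diff p).toLinearMap) (S.immersion p)]
  exact finrank_euclideanSpace_fin

theorem tangentPlane_eq_of_inner_eq_zero {u : E3} (hu : u ≠ 0)
    (h : ∀ X, inner ℝ u (S.diff p X) = 0) : S.tangentPlane p = (Submodule.span ℝ {u})ᗮ := by
  refine Submodule.eq_of_le_of_finrank_eq ?_ ?_
  · rintro _ ⟨X, rfl⟩
    exact Submodule.mem_orthogonal_singleton_iff_inner_right.2 (h X)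
  · rw [S.finrank_tangentPlane]
    exact (Submodule.finrank_orthogonal_span_singleton (n := 2) hu).symm

end EmbeddedSphere

end Spheres

section Trace

theorem trace_eq_inner_add_inner_add_inner {E : Type*} [NormedAddCommGroup E]
    [InnerProductSpace ℝ E] (hE : Module.finrank ℝ E = 3) (T : E →ₗ[ℝ] E)
    {a b c : E} (h : Orthonormal ℝ ![a, b, c]) :
    LinearMap.trace ℝ E T = inner ℝ a (T a) + inner ℝ b (T b) + inner ℝ c (T c) := by
  have : FiniteDimensional ℝ E := Module.finite_of_finrank_pos (by simp [hE])
  have hspan : ⊤ ≤ Submodule.span ℝ (Set.range ![a, b, c]) := by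
    rw [h.linearIndependent.span_eq_top_of_card_eq_finrank' (by simp [hE])]
  rw [LinearMap.trace_eq_sum_inner _ (OrthonormalBasis.mk h hspan)]
  simp [Fin.sum_univ_three]

theorem orthonormal_vecCons_three {E : Type*} [NormedAddCommGroup E] [InnerProductSpace ℝ E]
    {a b c : E} (ha : ‖a‖ = 1) (hb : ‖b‖ = 1) (hc : ‖c‖ = 1) (hab : inner ℝ a b = 0)
    (hac : inner ℝ a c = 0) (hbc : inner ℝ b c = 0) : Orthonormal ℝ ![a, b, c] := by
  have hba := (real_inner_comm a b).trans hab
  have hca := (real_inner_comm a c).trans hac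
  have hcb := (real_inner_comm b c).trans hbc
  rw [orthonormal_iff_ite]
  intro i j
  fin_cases i <;> fin_cases j <;> simp [*]

end Trace

section MeanCurvature

/-- The mean curvature at `x`, with respect to the conformally flat metric `w⁻² δ`, of a surface
whose Euclidean normal direction is given by the (not necessarily unit) gradient field `v`. It is
affine in `w`. -/
def conformalMeanCurv (w : E3 → ℝ) (v : E3 → E3) (x : E3) : ℝ :=
  w x / ‖v x‖ * (LinearMap.trace ℝ E3 (fderiv ℝ v x).toLinearMap -
    inner ℝ (v x) (fderiv ℝ v x (v x)) / ‖v x‖ ^ 2) - 2 * fderiv ℝ w x (v x) / ‖v x‖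

theorem conformalMeanCurv_comp_smul (w : E3 → ℝ) (v : E3 → E3) (ε : ℝ) (x : E3) :
    conformalMeanCurv (fun y => w (ε • y)) (fun y => v (ε • y)) x =
      ε * conformalMeanCurv w v (ε • x) := by
  have htrace : LinearMap.trace ℝ E3 (ε • fderiv ℝ v (ε • x)).toLinearMap =
      ε * LinearMap.trace ℝ E3 (fderiv ℝ v (ε • x)).toLinearMap := by
    rw [ContinuousLinearMap.toLinearMap_smul, map_smul, smul_eq_mul]
  simp only [conformalMeanCurv, fderiv_comp_smul, htrace, smul_apply, real_inner_smul_right,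
    smul_eq_mul]
  ring

theorem hasFDerivAt_inv_mul_comp_smul {E : Type*} [NormedAddCommGroup E] [NormedSpace ℝ E]
    {ψ : E → ℝ} {ψ' : E →L[ℝ] ℝ} {ε : ℝ} (hε : ε ≠ 0) {x : E}
    (hψ : HasFDerivAt ψ ψ' (ε • x)) : HasFDerivAt (fun y => ε⁻¹ * ψ (ε • y)) ψ' x := by
  have hsmul : HasFDerivAt (fun y : E => ε • y) (ε • ContinuousLinearMap.id ℝ E) x :=
    (hasFDerivAt_id _).const_smul ε
  refine ((hψ.comp x hsmul).const_mul ε⁻¹).congr_fderiv ?_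
  ext u
  simp [hε]

theorem fderiv_inv_sq_smul_euclid {g : Metric3} {w : E3 → ℝ} {x : E3}
    (hg : ∀ᶠ y in 𝓝 x, g.toFun y = (w y ^ 2)⁻¹ • euclid) (hw : DifferentiableAt ℝ w x)
    (hw0 : w x ≠ 0) (u a b : E3) :
    fderiv ℝ g.toFun x u a b = -2 * (w x ^ 3)⁻¹ * fderiv ℝ w x u * inner ℝ a b := by
  have hinv : HasDerivAt (fun t : ℝ => (t ^ 2)⁻¹) (-2 * (w x ^ 3)⁻¹) (w x) := by
    refine ((hasDerivAt_pow 2 (w x)).inv (pow_ne_zero 2 hw0)).congr_deriv ?_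
    field_simp
    norm_num [mul_comm]
  have hgx : HasFDerivAt (fun y => g.toFun y a b) _ x :=
    (((g.smooth.differentiable (by simp) x).hasFDerivAt.clm_apply
      (hasFDerivAt_const a x)).clm_apply (hasFDerivAt_const b x))
  have hwx : HasFDerivAt (fun y => g.toFun y a b) _ x :=
    ((hinv.comp_hasFDerivAt x hw.hasFDerivAt).mul_const (inner ℝ a b)).congr_of_eventuallyEq <| by
      filter_upwards [hg] with y hy
      simp [hy, euclid_apply]
  have happly := congrArg (fun L => L u) (hgx.unique hwx)
  simpa [mul_comm, mul_left_comm, mul_assoc] using happly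

theorem eventually_nhdsGT_pos_add_smul {E : Type*} [NormedAddCommGroup E] [NormedSpace ℝ E]
    {ψ : E → ℝ} {ψ' : E →L[ℝ] ℝ} {x u : E} (hψ : HasFDerivAt ψ ψ' x) (hx : ψ x = 0)
    (hu : 0 < ψ' u) : ∀ᶠ t : ℝ in 𝓝[>] 0, 0 < ψ (x + t • u) := by
  have hline : HasDerivAt (fun t : ℝ => ψ (x + t • u)) (ψ' u) 0 := hψ.hasLineDerivAt u
  have hslope := (hasDerivAt_iff_tendsto_slope.1 hline).mono_left
    (nhdsWithin_mono (0 : ℝ) fun t (ht : 0 < t) => ht.ne')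
  filter_upwards [hslope.eventually (lt_mem_nhds hu), self_mem_nhdsWithin] with t hslope_pos ht
  rw [slope_def_field] at hslope_pos
  simp only [zero_smul, add_zero, sub_zero, hx] at hslope_pos
  exact (div_pos_iff_of_pos_right ht).1 hslope_pos

namespace EmbeddedSphere

/-- Near `S` the metric `g` is `w⁻² δ`, and `S` is contained in the zero set of a defining
function `ψ` which is positive only outside of `S` and whose Euclidean gradient along `S` is the
smooth nowhere vanishing field `v`. -/
structure IsConformalLevelSet (S : EmbeddedSphere) (g : Metric3) (w ψ : E3 → ℝ)
    (v : E3 → E3) : Prop where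
  metric_eq : ∀ p, ∀ᶠ x in 𝓝 (S.toFun p), g.toFun x = (w x ^ 2)⁻¹ • euclid
  contDiffAt_factor : ∀ p, ContDiffAt ℝ ∞ w (S.toFun p)
  factor_pos : ∀ p, 0 < w (S.toFun p)
  contDiffAt_gradient : ∀ p, ContDiffAt ℝ ∞ v (S.toFun p)
  gradient_ne_zero : ∀ p, v (S.toFun p) ≠ 0
  hasFDerivAt : ∀ p, HasFDerivAt ψ (innerSL ℝ (v (S.toFun p))) (S.toFun p)
  eq_zero : ∀ p, ψ (S.toFun p) = 0
  notMem_enclosed : ∀ p, ∀ᶠ x in 𝓝 (S.toFun p), 0 < ψ x → x ∉ S.enclosed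

namespace IsConformalLevelSet

variable {S : EmbeddedSphere} {g : Metric3} {w ψ : E3 → ℝ} {v : E3 → E3}

theorem inner_diff_eq_zero (h : S.IsConformalLevelSet g w ψ v) (p : S2)
    (X : TangentSpace (𝓡 2) p) : inner ℝ (v (S.toFun p)) (S.diff p X) = 0 := by
  have hzero := S.fderiv_diff_eq_zero (c := 0) (h.hasFDerivAt p).differentiableAt
    (Eventually.of_forall h.eq_zero) X
  rwa [(h.hasFDerivAt p).fderiv] at hzero

theorem metric_apply (h : S.IsConformalLevelSet g w ψ v) (p : S2) (a b : E3) :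
    g.toFun (S.toFun p) a b = (w (S.toFun p) ^ 2)⁻¹ * inner ℝ a b := by
  rw [(h.metric_eq p).self_of_nhds]
  simp [euclid_apply]

theorem contDiffAt_factor_div_norm (h : S.IsConformalLevelSet g w ψ v) (p : S2) :
    ContDiffAt ℝ ∞ (fun x => w x / ‖v x‖) (S.toFun p) :=
  (h.contDiffAt_factor p).div ((h.contDiffAt_gradient p).norm ℝ (h.gradient_ne_zero p))
    (norm_ne_zero_iff.2 (h.gradient_ne_zero p))

theorem isOutwardUnitNormal (h : S.IsConformalLevelSet g w ψ v) :
    S.IsOutwardUnitNormal g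
      fun p => (w (S.toFun p) / ‖v (S.toFun p)‖) • v (S.toFun p) where
  smooth p := ((h.contDiffAt_factor_div_norm p).smul
    (h.contDiffAt_gradient p)).contMDiffAt.comp p (S.smooth p)
  unit p := by
    have hw := h.factor_pos p
    have hv := norm_pos_iff.2 (h.gradient_ne_zero p)
    rw [h.metric_apply, real_inner_smul_left, real_inner_smul_right, real_inner_self_eq_norm_sq]
    field_simp
  normal p X := by
    rw [h.metric_apply, real_inner_smul_left, h.inner_diff_eq_zero, mul_zero, mul_zero]
  outward p := by
    have hv := norm_pos_iff.2 (h.gradient_ne_zero p)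
    set n : E3 := (w (S.toFun p) / ‖v (S.toFun p)‖) • v (S.toFun p) with hn
    have hincreasing : 0 < innerSL ℝ (v (S.toFun p)) n := by
      rw [innerSL_apply_apply, hn, real_inner_smul_right, real_inner_self_eq_norm_sq]
      exact mul_pos (div_pos (h.factor_pos p) hv) (pow_pos hv 2)
    have hline : Tendsto (fun t : ℝ => S.toFun p + t • n) (𝓝[>] 0) (𝓝 (S.toFun p)) := by
      have hcont : Continuous fun t : ℝ => S.toFun p + t • n := by fun_prop
      exact (hcont.tendsto' 0 _ (by simp)).mono_left nhdsWithin_le_nhds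
    filter_upwards [hline.eventually (h.notMem_enclosed p),
      eventually_nhdsGT_pos_add_smul (h.hasFDerivAt p) (h.eq_zero p) hincreasing] with t hout hpos
    exact hout hpos

theorem mfderiv_normal_apply (h : S.IsConformalLevelSet g w ψ v) (p : S2)
    (X : TangentSpace (𝓡 2) p) :
    (mfderiv (𝓡 2) 𝓘(ℝ, E3)
        (fun p => (w (S.toFun p) / ‖v (S.toFun p)‖) • v (S.toFun p)) p X : E3) =
      (w (S.toFun p) / ‖v (S.toFun p)‖) • fderiv ℝ v (S.toFun p) (S.diff p X) +
        fderiv ℝ (fun x => w x / ‖v x‖) (S.toFun p) (S.diff p X) • v (S.toFun p) := by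
  have hprod := ((h.contDiffAt_factor_div_norm p).differentiableAt (by simp)).hasFDerivAt.fun_smul
    ((h.contDiffAt_gradient p).differentiableAt (by simp)).hasFDerivAt
  have hchain := mfderiv_comp (I := 𝓡 2) (I' := 𝓘(ℝ, E3)) (I'' := 𝓘(ℝ, E3)) p
    (g := fun x => (w x / ‖v x‖) • v x) (f := S.toFun) hprod.differentiableAt.mdifferentiableAt
    (S.smooth.mdifferentiableAt (by simp))
  rw [mfderiv_eq_fderiv, hprod.fderiv] at hchain
  exact congrArg (fun L => L X) hchain

theorem secondFundamentalForm_self (h : S.IsConformalLevelSet g w ψ v) {p : S2}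
    {X : TangentSpace (𝓡 2) p}
    (hX : inner ℝ (S.diff p X) (S.diff p X) = w (S.toFun p) ^ 2) :
    S.secondFundamentalForm g
        (fun p => (w (S.toFun p) / ‖v (S.toFun p)‖) • v (S.toFun p)) p X X =
      (w (S.toFun p) * ‖v (S.toFun p)‖)⁻¹ *
          inner ℝ (S.diff p X) (fderiv ℝ v (S.toFun p) (S.diff p X)) -
        fderiv ℝ w (S.toFun p) (v (S.toFun p)) / ‖v (S.toFun p)‖ := by
  have hw := h.factor_pos p
  have hv := norm_pos_iff.2 (h.gradient_ne_zero p)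
  have hdw := (h.contDiffAt_factor p).differentiableAt (by simp)
  have htangent := h.inner_diff_eq_zero p X
  have htangent' := (real_inner_comm (v (S.toFun p)) (S.diff p X)).trans htangent
  simp only [secondFundamentalForm, Metric3.christoffel, h.mfderiv_normal_apply, h.metric_apply,
    fderiv_inv_sq_smul_euclid (h.metric_eq p) hdw hw.ne']
  simp only [map_smul, smul_eq_mul, hX, inner_add_left, real_inner_smul_left,
    real_inner_smul_right, htangent, htangent',
    real_inner_comm (S.diff p X) (fderiv ℝ v (S.toFun p) (S.diff p X))]
  field_simp
  ring

theorem conformalMeanCurv_eq (h : S.IsConformalLevelSet g w ψ v) {p : S2}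
    {X Y : TangentSpace (𝓡 2) p} (hX : inner ℝ (S.diff p X) (S.diff p X) = w (S.toFun p) ^ 2)
    (hY : inner ℝ (S.diff p Y) (S.diff p Y) = w (S.toFun p) ^ 2)
    (hXY : inner ℝ (S.diff p X) (S.diff p Y) = 0) :
    conformalMeanCurv w v (S.toFun p) =
      (w (S.toFun p) * ‖v (S.toFun p)‖)⁻¹ *
          (inner ℝ (S.diff p X) (fderiv ℝ v (S.toFun p) (S.diff p X)) +
            inner ℝ (S.diff p Y) (fderiv ℝ v (S.toFun p) (S.diff p Y))) -
        2 * fderiv ℝ w (S.toFun p) (v (S.toFun p)) / ‖v (S.toFun p)‖ := by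
  have hw := h.factor_pos p
  have hv := norm_pos_iff.2 (h.gradient_ne_zero p)
  have hnorm : ∀ {Z : TangentSpace (𝓡 2) p},
      inner ℝ (S.diff p Z) (S.diff p Z) = w (S.toFun p) ^ 2 →
        ‖(w (S.toFun p))⁻¹ • S.diff p Z‖ = 1 := fun {Z} hZ => by
    rw [real_inner_self_eq_norm_sq] at hZ
    rw [norm_smul, (sq_eq_sq₀ (norm_nonneg _) hw.le).1 hZ, norm_inv, Real.norm_of_nonneg hw.le,
      inv_mul_cancel₀ hw.ne']
  have horth := orthonormal_vecCons_three (a := (w (S.toFun p))⁻¹ • S.diff p X)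
    (b := (w (S.toFun p))⁻¹ • S.diff p Y) (c := ‖v (S.toFun p)‖⁻¹ • v (S.toFun p))
    (hnorm hX) (hnorm hY) (norm_smul_inv_norm (h.gradient_ne_zero p))
    (by simp [real_inner_smul_left, real_inner_smul_right, hXY])
    (by simp [real_inner_smul_left, real_inner_smul_right, real_inner_comm, h.inner_diff_eq_zero])
    (by simp [real_inner_smul_left, real_inner_smul_right, real_inner_comm, h.inner_diff_eq_zero])
  rw [conformalMeanCurv, trace_eq_inner_add_inner_add_inner (by simp) _ horth]
  simp only [ContinuousLinearMap.coe_coe, map_smul, real_inner_smul_left, real_inner_smul_right]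
  field_simp
  ring

theorem hasConstantMeanCurvature (h : S.IsConformalLevelSet g w ψ v) {H : ℝ}
    (hH : ∀ p, conformalMeanCurv w v (S.toFun p) = H) : S.HasConstantMeanCurvature g H := by
  refine ⟨_, h.isOutwardUnitNormal, fun p X Y hX hY hXY => ?_⟩
  have hw := h.factor_pos p
  have hw2 : w (S.toFun p) ^ 2 ≠ 0 := by positivity
  rw [h.metric_apply, inv_mul_eq_one₀ hw2, eq_comm] at hX hY
  rw [h.metric_apply, mul_eq_zero, or_iff_right (inv_ne_zero hw2)] at hXY
  rw [← hH p, h.conformalMeanCurv_eq hX hY hXY, h.secondFundamentalForm_self hX,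
    h.secondFundamentalForm_self hY]
  ring

theorem tangentPlane_eq (h : S.IsConformalLevelSet g w ψ v) (p : S2) :
    S.tangentPlane p = (Submodule.span ℝ {v (S.toFun p)})ᗮ :=
  S.tangentPlane_eq_of_inner_eq_zero (h.gradient_ne_zero p) (h.inner_diff_eq_zero p)

end IsConformalLevelSet

end EmbeddedSphere

end MeanCurvature

section Radial

variable {E : Type*} [NormedAddCommGroup E] [InnerProductSpace ℝ E] {y : E}

theorem hasFDerivAt_norm_of_ne_zero (hy : y ≠ 0) :
    HasFDerivAt (fun y : E => ‖y‖) (‖y‖⁻¹ • innerSL ℝ y) y := by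
  have hsqrt := (hasStrictFDerivAt_norm_sq y).hasFDerivAt.sqrt (by simpa using hy)
  simp only [Real.sqrt_sq (norm_nonneg _)] at hsqrt
  refine hsqrt.congr_fderiv ?_
  ext u
  simp only [one_div, mul_inv_rev, smul_apply, innerSL_apply_apply, nsmul_eq_mul, Nat.cast_ofNat,
    smul_eq_mul]
  ring

theorem hasFDerivAt_comp_norm {κ : ℝ → ℝ} {κ' : ℝ} (hy : y ≠ 0) (hκ : HasDerivAt κ κ' ‖y‖) :
    HasFDerivAt (fun y : E => κ ‖y‖) ((κ' / ‖y‖) • innerSL ℝ y) y := by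
  refine (hκ.comp_hasFDerivAt y (hasFDerivAt_norm_of_ne_zero hy)).congr_fderiv ?_
  rw [smul_smul, div_eq_mul_inv]

end Radial

section Cutoff

/-- A smooth cutoff function, equal to `1` on `[4/5, 7/2]` and supported in `[1/2, 4]`. -/
def radialCutoff (r : ℝ) : ℝ :=
  Real.smoothTransition ((r - 1 / 2) / (3 / 10)) * Real.smoothTransition ((4 - r) / (1 / 2))

/-- A smooth cutoff function, equal to `1` for `t ≥ 4/5` and vanishing for `t ≤ 0`. -/
def angularCutoff (t : ℝ) : ℝ := Real.smoothTransition (t / (4 / 5))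

theorem contDiff_radialCutoff : ContDiff ℝ ∞ radialCutoff :=
  (Real.smoothTransition.contDiff.comp (by fun_prop)).mul
    (Real.smoothTransition.contDiff.comp (by fun_prop))

theorem contDiff_angularCutoff : ContDiff ℝ ∞ angularCutoff :=
  Real.smoothTransition.contDiff.comp (by fun_prop)

theorem radialCutoff_eq_one {r : ℝ} (hr : r ∈ Icc (4 / 5 : ℝ) (7 / 2)) : radialCutoff r = 1 := by
  rw [radialCutoff, Real.smoothTransition.one_of_one_le, Real.smoothTransition.one_of_one_le,
    one_mul]
  · rw [le_div_iff₀ (by norm_num)]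
    linarith [hr.2]
  · rw [le_div_iff₀ (by norm_num)]
    linarith [hr.1]

theorem radialCutoff_eq_zero {r : ℝ} (hr : r ≤ 1 / 2 ∨ 4 ≤ r) : radialCutoff r = 0 := by
  rcases hr with hr | hr
  · rw [radialCutoff, Real.smoothTransition.zero_of_nonpos, zero_mul]
    exact div_nonpos_of_nonpos_of_nonneg (by linarith) (by norm_num)
  · rw [radialCutoff, mul_comm, Real.smoothTransition.zero_of_nonpos, zero_mul]
    exact div_nonpos_of_nonpos_of_nonneg (by linarith) (by norm_num)

theorem angularCutoff_eq_one {t : ℝ} (ht : 4 / 5 ≤ t) : angularCutoff t = 1 :=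
  Real.smoothTransition.one_of_one_le (by rw [le_div_iff₀ (by norm_num)]; linarith)

theorem angularCutoff_eq_zero {t : ℝ} (ht : t ≤ 0) : angularCutoff t = 0 :=
  Real.smoothTransition.zero_of_nonpos (div_nonpos_of_nonpos_of_nonneg ht (by norm_num))

theorem tsupport_radialCutoff_norm_subset {E : Type*} [NormedAddCommGroup E] :
    tsupport (fun y : E => radialCutoff ‖y‖) ⊆ {y | ‖y‖ ∈ Icc (1 / 2 : ℝ) 4} := by
  refine closure_minimal (fun y hy => ?_) (isClosed_Icc.preimage continuous_norm)
  contrapose! hy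
  refine Function.notMem_support.2 (radialCutoff_eq_zero ?_)
  rw [mem_ofPred_eq, mem_Icc, not_and_or, not_le, not_le] at hy
  exact hy.imp le_of_lt le_of_lt

theorem contDiff_radialCutoff_norm {E : Type*} [NormedAddCommGroup E] [InnerProductSpace ℝ E] :
    ContDiff ℝ ∞ fun y : E => radialCutoff ‖y‖ := by
  refine contDiff_iff_contDiffAt.2 fun y => ?_
  by_cases hy : y = 0
  · refine (contDiffAt_const (c := (0 : ℝ))).congr_of_eventuallyEq ?_
    have hsmall : ∀ᶠ z in 𝓝 y, ‖z‖ < 1 / 2 :=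
      continuous_norm.continuousAt.eventually (gt_mem_nhds (by simp [hy]))
    filter_upwards [hsmall] with z hz
    exact radialCutoff_eq_zero (Or.inl hz.le)
  · exact contDiff_radialCutoff.contDiffAt.comp y (contDiffAt_norm ℝ hy)

end Cutoff

section Axis

/-- The direction of the axis of symmetry. -/
def axisDir : E3 := EuclideanSpace.single 0 1

theorem norm_axisDir : ‖axisDir‖ = 1 := by simp [axisDir]

theorem norm_eq_one_of_eq_axisDir_or {c : E3} (hc : c = axisDir ∨ c = -axisDir) : ‖c‖ = 1 := by
  rcases hc with rfl | rfl <;> simp [norm_axisDir]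

theorem inner_axisDir (y : E3) : inner ℝ axisDir y = y 0 := by
  simp [axisDir, EuclideanSpace.inner_single_left]

theorem inner_rot (θ : ℝ) (u v : E3) : inner ℝ (rot θ u) (rot θ v) = inner ℝ u v := by
  simp only [PiLp.inner_apply, Fin.sum_univ_three, rot, RCLike.inner_apply, conj_trivial,
    Matrix.cons_val_zero, Matrix.cons_val_one, Matrix.cons_val]
  linear_combination (u 1 * v 1 + u 2 * v 2) * Real.sin_sq_add_cos_sq θ

theorem norm_rot (θ : ℝ) (x : E3) : ‖rot θ x‖ = ‖x‖ := by
  rw [norm_eq_sqrt_real_inner, inner_rot, ← norm_eq_sqrt_real_inner]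

theorem inner_axisDir_rot (θ : ℝ) (x : E3) : inner ℝ axisDir (rot θ x) = inner ℝ axisDir x := by
  simp [inner_axisDir, rot]

theorem rot_smul (θ a : ℝ) (x : E3) : rot θ (a • x) = a • rot θ x := by
  ext i
  fin_cases i <;> simp [rot] <;> ring

theorem rot_rot_neg (θ : ℝ) (x : E3) : rot θ (rot (-θ) x) = x := by
  have htrig := Real.sin_sq_add_cos_sq θ
  ext i
  fin_cases i <;> simp only [rot, Real.cos_neg, Real.sin_neg] <;> simp
  · linear_combination x 1 * htrig
  · linear_combination x 2 * htrig

end Axis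

section Perturbation

theorem fderiv_apply_self_of_eventually_eq_add_sub_sq_mul {E : Type*} [NormedAddCommGroup E]
    [NormedSpace ℝ E] {f : E → ℝ} {y : E} (hf : DifferentiableAt ℝ f y) {a : ℝ} {q : ℝ → ℝ}
    (hq : DifferentiableAt ℝ q 1)
    (h : ∀ᶠ t : ℝ in 𝓝 1, f (t • y) = t * a + (t - 1) ^ 2 * q t) :
    fderiv ℝ f y y = f y := by
  have hline : HasDerivAt (fun t : ℝ => t • y) y 1 := by
    simpa using (hasDerivAt_id (1 : ℝ)).smul_const y
  have hchain := hf.hasFDerivAt.comp_hasDerivAt_of_eq (1 : ℝ) hline (by simp)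
  have hradial := (((hasDerivAt_id (1 : ℝ)).mul_const a).add
    ((((hasDerivAt_id (1 : ℝ)).sub_const 1).pow 2).mul hq.hasDerivAt)).congr_of_eventuallyEq h
  rw [hchain.unique hradial]
  simpa using h.self_of_nhds.symm

namespace Correction

variable (K : Correction)

/-- The perturbation near the outlying sphere in the direction `c`. Its first two terms are
homogeneous of degree `1`, and the last one vanishes on the outlying sphere and to second order
on the unit sphere. -/
def core (c : E3) (q : ℝ × E3) : ℝ :=
  K.β q.1 * inner ℝ c q.2 + K.γ q.1 * (‖q.2‖ - inner ℝ c q.2) +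
    (inner ℝ c q.2 - height q.1 ‖q.2‖) * ((‖q.2‖ - 1) ^ 2 * K.m (q.1, ‖q.2‖))

/-- The function `core`, cut off to a sector of an annulus around the direction `c`. The angular
cutoff is homogeneous of degree `0`. -/
def localized (c : E3) (q : ℝ × E3) : ℝ :=
  radialCutoff ‖q.2‖ * (angularCutoff (inner ℝ c q.2 / ‖q.2‖) * K.core c q)

/-- The perturbation of the conformal factor for a pair of outlying spheres, one on either side of
the centred one. -/
def perturbation (q : ℝ × E3) : ℝ := K.localized axisDir q + K.localized (-axisDir) q

variable {K} {c y : E3} {q : ℝ × E3} {ε : ℝ}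

theorem contDiffAt_core (hε : q.1 ∈ Ioo (-K.δ) K.δ) (hr : ‖q.2‖ ∈ Ioo (1 / 4 : ℝ) 5) :
    ContDiffAt ℝ ∞ (K.core c) q := by
  have hq0 : q.2 ≠ 0 := norm_pos_iff.1 (by linarith [hr.1])
  have hnorm : ContDiffAt ℝ ∞ (fun q : ℝ × E3 => ‖q.2‖) q := contDiffAt_snd.norm ℝ hq0
  have hpair : ContDiffAt ℝ ∞ (fun q : ℝ × E3 => (q.1, ‖q.2‖)) q := contDiffAt_fst.prodMk hnorm
  have hreg := K.regular q.1 hε ‖q.2‖ (Ioo_subset_Icc_self hr)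
  have hβ : ContDiffAt ℝ ∞ (fun q : ℝ × E3 => K.β q.1) q :=
    (K.contDiffOn_β.contDiffAt (isOpen_Ioo.mem_nhds hε)).comp q contDiffAt_fst
  have hγ : ContDiffAt ℝ ∞ (fun q : ℝ × E3 => K.γ q.1) q :=
    (K.contDiffOn_γ.contDiffAt (isOpen_Ioo.mem_nhds hε)).comp q contDiffAt_fst
  have hm : ContDiffAt ℝ ∞ (fun q : ℝ × E3 => K.m (q.1, ‖q.2‖)) q :=
    (K.contDiffOn_m.contDiffAt
      ((isOpen_Ioo.prod isOpen_Ioo).mem_nhds (mk_mem_prod hε hr))).comp q hpair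
  have hheight : ContDiffAt ℝ ∞ (fun q : ℝ × E3 => height q.1 ‖q.2‖) q :=
    ContDiffAt.comp (g := fun p : ℝ × ℝ => height p.1 p.2) q
      (contDiffAt_height hreg.pos hreg.dilation_pos) hpair
  have hinner : ContDiffAt ℝ ∞ (fun q : ℝ × E3 => inner ℝ c q.2) q :=
    contDiffAt_const.inner ℝ contDiffAt_snd
  exact ((hβ.mul hinner).add (hγ.mul (hnorm.sub hinner))).add
    ((hinner.sub hheight).mul (((hnorm.sub contDiffAt_const).pow 2).mul hm))

theorem contDiffAt_localized (hε : q.1 ∈ Ioo (-K.δ) K.δ) : ContDiffAt ℝ ∞ (K.localized c) q := by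
  by_cases hr : ‖q.2‖ ∈ Ioo (1 / 4 : ℝ) 5
  · have hq0 : q.2 ≠ 0 := norm_pos_iff.1 (by linarith [hr.1])
    have hnorm : ContDiffAt ℝ ∞ (fun q : ℝ × E3 => ‖q.2‖) q := contDiffAt_snd.norm ℝ hq0
    have hinner : ContDiffAt ℝ ∞ (fun q : ℝ × E3 => inner ℝ c q.2) q :=
      contDiffAt_const.inner ℝ contDiffAt_snd
    exact (contDiff_radialCutoff.contDiffAt.comp q hnorm).mul
      ((contDiff_angularCutoff.contDiffAt.comp q
        (hinner.div hnorm (norm_ne_zero_iff.2 hq0))).mul (contDiffAt_core hε hr))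
  · have hcont : ContinuousAt (fun q : ℝ × E3 => ‖q.2‖) q := by fun_prop
    have hout : ∀ᶠ p : ℝ × E3 in 𝓝 q, ‖p.2‖ ≤ 1 / 2 ∨ 4 ≤ ‖p.2‖ := by
      rw [mem_Ioo, not_and_or, not_lt, not_lt] at hr
      rcases hr with hr | hr
      · filter_upwards [hcont.eventually (gt_mem_nhds (by linarith : ‖q.2‖ < 1 / 2))] with p hp
          using Or.inl hp.le
      · filter_upwards [hcont.eventually (lt_mem_nhds (by linarith : 4 < ‖q.2‖))] with p hp
          using Or.inr hp.le
    refine (contDiffAt_const (c := (0 : ℝ))).congr_of_eventuallyEq ?_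
    filter_upwards [hout] with p hp
    rw [localized, radialCutoff_eq_zero hp, zero_mul]

theorem contDiffAt_localized_right (hε : ε ∈ Ioo (-K.δ) K.δ) :
    ContDiffAt ℝ ∞ (fun y => K.localized c (ε, y)) y :=
  (contDiffAt_localized (q := (ε, y)) hε).comp y (contDiffAt_const.prodMk contDiffAt_id)

theorem contDiffAt_perturbation (hε : q.1 ∈ Ioo (-K.δ) K.δ) : ContDiffAt ℝ ∞ K.perturbation q :=
  (contDiffAt_localized hε).add (contDiffAt_localized hε)

theorem perturbation_eq_zero (hr : ‖q.2‖ ≤ 1 / 2 ∨ 4 ≤ ‖q.2‖) : K.perturbation q = 0 := by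
  simp [perturbation, localized, radialCutoff_eq_zero hr]

theorem eventually_localized_eq_core (hr : ‖y‖ ∈ Ioo (4 / 5 : ℝ) (7 / 2))
    (hangle : 4 / 5 < inner ℝ c y / ‖y‖) :
    ∀ᶠ z in 𝓝 y, K.localized c (ε, z) = K.core c (ε, z) ∧ K.localized (-c) (ε, z) = 0 := by
  have hnorm : ContinuousAt (fun y : E3 => ‖y‖) y := continuous_norm.continuousAt
  have hy : ‖y‖ ≠ 0 := by linarith [hr.1]
  have hcos : ContinuousAt (fun y : E3 => inner ℝ c y / ‖y‖) y := by fun_prop (disch := exact hy)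
  filter_upwards [hnorm.eventually (isOpen_Ioo.mem_nhds hr),
    hcos.eventually (lt_mem_nhds hangle)] with z hz hzangle
  constructor
  · rw [localized, radialCutoff_eq_one (Ioo_subset_Icc_self hz), angularCutoff_eq_one hzangle.le,
      one_mul, one_mul]
  · rw [localized, angularCutoff_eq_zero, zero_mul, mul_zero]
    rw [inner_neg_left, neg_div]
    linarith

theorem eventually_perturbation_eq_core (hc : c = axisDir ∨ c = -axisDir)
    (hr : ‖y‖ ∈ Ioo (4 / 5 : ℝ) (7 / 2)) (hangle : 4 / 5 < inner ℝ c y / ‖y‖) :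
    ∀ᶠ z in 𝓝 y, K.perturbation (ε, z) = K.core c (ε, z) := by
  filter_upwards [eventually_localized_eq_core (K := K) (ε := ε) hr hangle] with z hz
  rcases hc with rfl | rfl
  · rw [perturbation, hz.1, hz.2, add_zero]
  · rw [neg_neg] at hz
    rw [perturbation, hz.1, hz.2, zero_add]

theorem localized_smul (hy : ‖y‖ = 1) {t : ℝ} (ht : t ∈ Icc (4 / 5 : ℝ) (7 / 2)) :
    K.localized c (ε, t • y) =
      t * (angularCutoff (inner ℝ c y) * (K.β ε * inner ℝ c y + K.γ ε * (1 - inner ℝ c y))) +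
        (t - 1) ^ 2 *
          (angularCutoff (inner ℝ c y) * ((t * inner ℝ c y - height ε t) * K.m (ε, t))) := by
  have ht0 : 0 < t := by linarith [ht.1]
  have hnorm : ‖t • y‖ = t := by rw [norm_smul, hy, mul_one, Real.norm_of_nonneg ht0.le]
  simp only [localized, core, hnorm, radialCutoff_eq_one ht, real_inner_smul_right,
    mul_div_cancel_left₀ _ ht0.ne']
  ring

theorem fderiv_localized_self (hε : ε ∈ Ioo (-K.δ) K.δ) (hy : ‖y‖ = 1) :
    fderiv ℝ (fun y => K.localized c (ε, y)) y y = K.localized c (ε, y) := by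
  have hone : (1 : ℝ) ∈ Ioo (1 / 4 : ℝ) 5 := by norm_num
  have hheight : DifferentiableAt ℝ (height ε) 1 :=
    (hasDerivAt_height one_pos
      (K.regular ε hε 1 (Ioo_subset_Icc_self hone)).dilation_pos.ne').differentiableAt
  have hm : DifferentiableAt ℝ (fun t => K.m (ε, t)) 1 :=
    ((K.contDiffOn_m.contDiffAt ((isOpen_Ioo.prod isOpen_Ioo).mem_nhds
      (mk_mem_prod hε hone))).comp (1 : ℝ)
        (contDiffAt_const.prodMk contDiffAt_id)).differentiableAt (by simp)
  refine fderiv_apply_self_of_eventually_eq_add_sub_sq_mul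
    (a := angularCutoff (inner ℝ c y) * (K.β ε * inner ℝ c y + K.γ ε * (1 - inner ℝ c y)))
    (q := fun t => angularCutoff (inner ℝ c y) * ((t * inner ℝ c y - height ε t) * K.m (ε, t)))
    ((contDiffAt_localized_right hε).differentiableAt (by simp)) (by fun_prop) ?_
  filter_upwards [Icc_mem_nhds (by norm_num : (4 / 5 : ℝ) < 1) (by norm_num : (1 : ℝ) < 7 / 2)]
    with t ht
  exact localized_smul hy ht

theorem fderiv_perturbation_self (hε : ε ∈ Ioo (-K.δ) K.δ) (hy : ‖y‖ = 1) :
    fderiv ℝ (fun y => K.perturbation (ε, y)) y y = K.perturbation (ε, y) := by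
  have hdiff : ∀ c, DifferentiableAt ℝ (fun y => K.localized c (ε, y)) y := fun c =>
    (contDiffAt_localized_right hε).differentiableAt (by simp)
  simp only [perturbation]
  rw [fderiv_fun_add (hdiff _) (hdiff _), add_apply, fderiv_localized_self hε hy,
    fderiv_localized_self hε hy]

theorem perturbation_rot (θ ε : ℝ) (y : E3) :
    K.perturbation (ε, rot θ y) = K.perturbation (ε, y) := by
  simp only [perturbation, localized, core, inner_neg_left, norm_rot, inner_axisDir_rot]

end Correction

end Perturbation

section Profile

theorem abs_one_add_div_le_two {ε r : ℝ} (hε : |ε| ≤ 1) (hr : 1 / 2 ≤ r) :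
    |1 + ε / (2 * r)| ≤ 2 := by
  have hdiv : |ε / (2 * r)| ≤ 1 := by
    rw [abs_div, abs_of_pos (by linarith : 0 < 2 * r), div_le_one (by linarith)]
    linarith
  calc |1 + ε / (2 * r)| ≤ |(1 : ℝ)| + |ε / (2 * r)| := abs_add_le _ _
    _ ≤ 2 := by rw [abs_one]; linarith

theorem exists_contDiff_eq_one_tsupport_subset {δ : ℝ} (hδ : 0 < δ) :
    ∃ χ : ℝ → ℝ, ContDiff ℝ ∞ χ ∧ (∀ ε, |ε| ≤ δ → χ ε = 1) ∧
      tsupport χ ⊆ Icc (-(2 * δ)) (2 * δ) := by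
  let χ : ContDiffBump (0 : ℝ) := ⟨δ, 2 * δ, hδ, by linarith⟩
  refine ⟨χ, χ.contDiff, fun ε hε => χ.one_of_mem_closedBall (by simpa using hε), ?_⟩
  rw [χ.tsupport_eq, Real.closedBall_eq_Icc, zero_sub, zero_add]

namespace Correction

variable (K : Correction)

/-- The function `w` for which the perturbed metric, dilated by `ε`, is `w⁻² δ`. -/
def conformal (q : ℝ × E3) : ℝ := schwFactor q.1 ‖q.2‖ + q.1 ^ 2 * K.perturbation q

/-- The relative size of the perturbation: `conformal` is `1 + ratio` times `schwFactor`. -/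
def ratio (q : ℝ × E3) : ℝ := q.1 ^ 2 * K.perturbation q * (1 + q.1 / (2 * ‖q.2‖)) ^ 2

/-- The difference between the perturbed and the Schwarzschild metric is `ε²` times this function
times the Euclidean metric, as long as `ratio` is small. -/
def rawProfile (q : ℝ × E3) : ℝ :=
  -((1 + q.1 / (2 * ‖q.2‖)) ^ 6 * K.perturbation q * (2 + K.ratio q)) / (1 + K.ratio q) ^ 2

variable {K} {q : ℝ × E3}

theorem rawProfile_eq_zero (hr : ‖q.2‖ ≤ 1 / 2 ∨ 4 ≤ ‖q.2‖) : K.rawProfile q = 0 := by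
  simp [rawProfile, perturbation_eq_zero hr]

theorem rawProfile_rot (θ ε : ℝ) (y : E3) : K.rawProfile (ε, rot θ y) = K.rawProfile (ε, y) := by
  simp only [rawProfile, ratio, norm_rot, perturbation_rot]

theorem conformal_eq_mul (hφ : 1 + q.1 / (2 * ‖q.2‖) ≠ 0) :
    K.conformal q = (1 + K.ratio q) * ((1 + q.1 / (2 * ‖q.2‖)) ^ 2)⁻¹ := by
  rw [conformal, ratio, schwFactor, add_mul, one_mul, mul_inv_cancel_right₀ (pow_ne_zero 2 hφ)]

theorem pow_four_add_sq_mul_rawProfile (hφ : 1 + q.1 / (2 * ‖q.2‖) ≠ 0)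
    (hratio : 1 + K.ratio q ≠ 0) :
    (1 + q.1 / (2 * ‖q.2‖)) ^ 4 + q.1 ^ 2 * K.rawProfile q = (K.conformal q ^ 2)⁻¹ := by
  have hprofile : q.1 ^ 2 * K.rawProfile q =
      -((1 + q.1 / (2 * ‖q.2‖)) ^ 4 * K.ratio q * (2 + K.ratio q)) / (1 + K.ratio q) ^ 2 := by
    have hdef : K.ratio q = q.1 ^ 2 * K.perturbation q * (1 + q.1 / (2 * ‖q.2‖)) ^ 2 := rfl
    rw [rawProfile, mul_div_assoc']
    congr 1
    linear_combination (1 + q.1 / (2 * ‖q.2‖)) ^ 4 * (2 + K.ratio q) * hdef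
  rw [hprofile, conformal_eq_mul hφ]
  generalize K.ratio q = t at *
  generalize 1 + q.1 / (2 * ‖q.2‖) = φ at *
  field_simp
  ring

variable (K) in
theorem exists_bound_perturbation :
    ∃ B, ∀ q : ℝ × E3, |q.1| ≤ K.δ / 2 → |K.perturbation q| ≤ B := by
  have hcont : ContinuousOn K.perturbation
      (Icc (-(K.δ / 2)) (K.δ / 2) ×ˢ closedBall (0 : E3) 4) := fun q hq =>
    (contDiffAt_perturbation ⟨by linarith [hq.1.1, K.pos], by linarith [hq.1.2, K.pos]⟩
      ).continuousAt.continuousWithinAt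
  obtain ⟨B, hB⟩ := (isCompact_Icc.prod (isCompact_closedBall (0 : E3) 4)
    ).exists_bound_of_continuousOn hcont
  have hB0 : 0 ≤ B := (norm_nonneg _).trans (hB (0, 0) (by simpa using half_pos K.pos |>.le))
  refine ⟨B, fun q hq => ?_⟩
  by_cases hr : 4 ≤ ‖q.2‖
  · rwa [perturbation_eq_zero (Or.inr hr), abs_zero]
  · exact hB q ⟨abs_le.1 hq, by simpa using (not_le.1 hr).le⟩

theorem abs_ratio_le {B : ℝ} (hq : |q.1| ≤ 1) (hB : |K.perturbation q| ≤ B) :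
    |K.ratio q| ≤ 4 * B * |q.1| := by
  have hB0 : 0 ≤ B := (abs_nonneg _).trans hB
  by_cases hr : ‖q.2‖ ≤ 1 / 2
  · rw [ratio, perturbation_eq_zero (Or.inl hr), mul_zero, zero_mul, abs_zero]
    positivity
  · have hφ := abs_one_add_div_le_two hq (not_le.1 hr).le
    have hsq : |q.1| ^ 2 ≤ |q.1| := by nlinarith [abs_nonneg q.1]
    calc |K.ratio q| = |q.1| ^ 2 * |K.perturbation q| * |1 + q.1 / (2 * ‖q.2‖)| ^ 2 := by
          rw [ratio, abs_mul, abs_mul, abs_pow, abs_pow]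
      _ ≤ |q.1| * B * 2 ^ 2 := by gcongr
      _ = 4 * B * |q.1| := by ring

variable (K) in
theorem exists_forall_one_add_ratio_pos :
    ∃ δ > 0, δ < K.δ ∧ ∀ q : ℝ × E3, |q.1| < δ → 0 < 1 + K.ratio q := by
  obtain ⟨B, hB⟩ := K.exists_bound_perturbation
  have hpos := K.pos
  have hden : 0 < 8 * (|B| + 1) := by positivity
  refine ⟨min (K.δ / 2) (1 / (8 * (|B| + 1))), by positivity,
    (min_le_left _ _).trans_lt (by linarith), fun q hq => ?_⟩
  have hqδ : |q.1| ≤ K.δ / 2 := (hq.trans_le (min_le_left _ _)).le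
  have hqB := (lt_div_iff₀ hden).1 (hq.trans_le (min_le_right _ _))
  have hratio : |K.ratio q| ≤ 4 * B * |q.1| := abs_ratio_le (by linarith [K.le_one]) (hB q hqδ)
  nlinarith [neg_abs_le (K.ratio q), le_abs_self B, abs_nonneg q.1]

theorem contDiffAt_rawProfile (hε : q.1 ∈ Ioo (-K.δ) K.δ) (hratio : 1 + K.ratio q ≠ 0) :
    ContDiffAt ℝ ∞ K.rawProfile q := by
  by_cases hr : 1 / 4 < ‖q.2‖
  · have hq0 : q.2 ≠ 0 := norm_pos_iff.1 (by linarith)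
    have hnorm : ContDiffAt ℝ ∞ (fun q : ℝ × E3 => ‖q.2‖) q := contDiffAt_snd.norm ℝ hq0
    have hφ : ContDiffAt ℝ ∞ (fun q : ℝ × E3 => 1 + q.1 / (2 * ‖q.2‖)) q :=
      contDiffAt_const.add (contDiffAt_fst.div (contDiffAt_const.mul hnorm) (by simpa using hq0))
    have hpert := contDiffAt_perturbation hε
    have hratio' : ContDiffAt ℝ ∞ K.ratio q :=
      ((contDiffAt_fst.pow 2).mul hpert).mul (hφ.pow 2)
    exact (((hφ.pow 6).mul hpert).mul (contDiffAt_const.add hratio')).neg.div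
      ((contDiffAt_const.add hratio').pow 2) (pow_ne_zero 2 hratio)
  · refine (contDiffAt_const (c := (0 : ℝ))).congr_of_eventuallyEq ?_
    have hcont : ContinuousAt (fun q : ℝ × E3 => ‖q.2‖) q := by fun_prop
    filter_upwards [hcont.eventually (gt_mem_nhds (by linarith : ‖q.2‖ < 1 / 2))] with p hp
    exact rawProfile_eq_zero (Or.inl hp.le)

/-- A smooth and compactly supported function which for `0 < ε ≤ δ` describes the difference
between the perturbed and the Schwarzschild metric. -/
structure Profile (K : Correction) where
  δ : ℝ
  pos : 0 < δ
  lt : δ < K.δ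
  toFun : ℝ × E3 → ℝ
  contDiff : ContDiff ℝ ∞ toFun
  hasCompactSupport : HasCompactSupport toFun
  eq_zero : ∀ q, ‖q.2‖ ∉ Icc (1 / 2 : ℝ) 4 → toFun q = 0
  rot : ∀ θ ε y, toFun (ε, rot θ y) = toFun (ε, y)
  conformal_pos : ∀ ε ∈ Ioc 0 δ, ∀ y, 0 < K.conformal (ε, y)
  add_eq : ∀ ε ∈ Ioc 0 δ, ∀ y : E3,
    (1 + ε / (2 * ‖y‖)) ^ 4 + ε ^ 2 * toFun (ε, y) = (K.conformal (ε, y) ^ 2)⁻¹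

variable (K) in
theorem nonempty_profile : Nonempty (Profile K) := by
  obtain ⟨δ, hδ, hδK, hratio_pos⟩ := K.exists_forall_one_add_ratio_pos
  obtain ⟨χ, hχ, hχone, hχsupp⟩ := exists_contDiff_eq_one_tsupport_subset
    (show 0 < δ / 4 by positivity)
  have hφ : ∀ ε : ℝ, 0 < ε → ∀ y : E3, 0 < 1 + ε / (2 * ‖y‖) := fun ε hε y => by positivity
  have habs : ∀ ε ∈ Ioc (0 : ℝ) (δ / 4), |ε| ≤ δ / 4 := fun ε hε => by
    rw [abs_of_pos hε.1]
    exact hε.2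
  have hsupp : tsupport (fun q : ℝ × E3 => χ q.1) ⊆ {q | |q.1| < δ} :=
    (tsupport_comp_subset_preimage χ continuous_fst).trans fun q hq =>
      (abs_le.2 (hχsupp hq)).trans_lt (by linarith)
  refine ⟨⟨δ / 4, by positivity, by linarith, fun q => χ q.1 • K.rawProfile q, ?_, ?_,
    fun q hq => ?_, fun θ ε y => ?_, fun ε hε y => ?_, fun ε hε y => ?_⟩⟩
  · exact contDiff_smul_of_tsupport_subset (isOpen_lt (by fun_prop) continuous_const)
      (hχ.comp contDiff_fst) (fun q hq => (contDiffAt_rawProfile (abs_lt.1 (hq.trans hδK))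
        (hratio_pos q hq).ne').contDiffWithinAt) hsupp
  · have hcompact : IsCompact (tsupport χ) :=
      isCompact_Icc.of_isClosed_subset (isClosed_tsupport χ) hχsupp
    refine HasCompactSupport.intro (hcompact.prod (isCompact_closedBall (0 : E3) 4)) fun q hq => ?_
    rw [mem_prod, not_and_or, mem_closedBall_zero_iff, not_le] at hq
    rcases hq with hq | hq
    · rw [image_eq_zero_of_notMem_tsupport hq, zero_smul]
    · rw [rawProfile_eq_zero (Or.inr hq.le), smul_zero]
  · rw [mem_Icc, not_and_or, not_le, not_le] at hq
    rw [rawProfile_eq_zero (hq.imp le_of_lt le_of_lt), smul_zero]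
  · rw [rawProfile_rot]
  · rw [conformal_eq_mul (hφ ε hε.1 y).ne']
    have := hratio_pos (ε, y) ((habs ε hε).trans_lt (by linarith))
    have := hφ ε hε.1 y
    positivity
  · rw [hχone ε (habs ε hε), one_smul]
    exact pow_four_add_sq_mul_rawProfile (q := (ε, y)) (hφ ε hε.1 y).ne'
      (hratio_pos (ε, y) ((habs ε hε).trans_lt (by linarith))).ne'

end Correction

end Profile

section Superposition

/-- The scales at which the metric is perturbed. -/
def scale (δ : ℝ) (n : ℕ) : ℝ := δ * (1 / 64) ^ n

section Scale

variable {δ : ℝ}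

theorem scale_pos (hδ : 0 < δ) (n : ℕ) : 0 < scale δ n := by
  unfold scale
  positivity

theorem scale_le (hδ : 0 ≤ δ) (n : ℕ) : scale δ n ≤ δ :=
  mul_le_of_le_one_right hδ (pow_le_one₀ (by norm_num) (by norm_num))

theorem mul_scale_le (hδ : 0 ≤ δ) {m n : ℕ} (h : m < n) : 64 * scale δ n ≤ scale δ m := by
  have hpow : ((1 : ℝ) / 64) ^ n ≤ (1 / 64) ^ m * (1 / 64) := by
    rw [← pow_succ]
    exact pow_le_pow_of_le_one (by norm_num) (by norm_num) h
  unfold scale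
  nlinarith

theorem tendsto_scale (δ : ℝ) : Tendsto (scale δ) atTop (𝓝 0) := by
  have hpow := (tendsto_pow_atTop_nhds_zero_of_lt_one (by norm_num : (0 : ℝ) ≤ 1 / 64)
    (by norm_num)).const_mul δ
  rwa [mul_zero] at hpow

theorem eq_of_scale_mul_mem_Icc (hδ : 0 < δ) {R : ℝ} {m n : ℕ}
    (hm : scale δ m * R ∈ Icc (1 / 2 : ℝ) 4) (hn : scale δ n * R ∈ Icc (1 / 2 : ℝ) 4) : m = n := by
  have hR : 0 < R := pos_of_mul_pos_right (by linarith [hm.1]) (scale_pos hδ m).le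
  rcases lt_trichotomy m n with h | h | h
  · nlinarith [mul_scale_le hδ.le h, hm.2, hn.1]
  · exact h
  · nlinarith [mul_scale_le hδ.le h, hm.1, hn.2]

end Scale

variable {E : Type*} [NormedAddCommGroup E] [NormedSpace ℝ E]

/-- The contribution of the scale `ε` to the conformal factor. -/
def bump (P : ℝ × E → ℝ) (ε : ℝ) (x : E) : ℝ := ε ^ 2 * P (ε, ε • x)

/-- The superposition of the perturbations at all scales. -/
def series (P : ℝ × E → ℝ) (δ : ℝ) (x : E) : ℝ := ∑' n, bump P (scale δ n) x

variable {P : ℝ × E → ℝ} {δ ε : ℝ} {k n : ℕ} {x : E}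

theorem contDiff_bump (hP : ContDiff ℝ ∞ P) (ε : ℝ) : ContDiff ℝ ∞ (bump P ε) :=
  contDiff_const.mul (hP.comp (contDiff_const.prodMk (contDiff_const_smul _)))

theorem norm_iteratedFDeriv_bump_le (hP : ContDiff ℝ ∞ P) {C : ℝ}
    (hC : ∀ q, ‖iteratedFDeriv ℝ k P q‖ ≤ C) (hε : 0 ≤ ε) (x : E) :
    ‖iteratedFDeriv ℝ k (bump P ε) x‖ ≤ C * ε ^ (2 + k) := by
  set L : E →L[ℝ] ℝ × E := (ContinuousLinearMap.inr ℝ ℝ E).comp (ε • ContinuousLinearMap.id ℝ E)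
    with hL
  have hL_norm : ‖L‖ ≤ ε := by
    refine ContinuousLinearMap.opNorm_le_bound _ hε fun v => ?_
    rw [show L v = (0, ε • v) from rfl, Prod.norm_mk, norm_zero, norm_smul, Real.norm_of_nonneg hε]
    exact (max_eq_right (by positivity)).le
  set P' : ℝ × E → ℝ := fun q => P ((ε, 0) + q) with hP'
  have hP'_smooth : ContDiff ℝ ∞ P' := hP.comp (contDiff_const.add contDiff_id)
  have hbump : bump P ε = ε ^ 2 • (P' ∘ L) := by
    funext x
    simp [bump, hL, hP']
  have hk : (k : WithTop ℕ∞) ≤ ∞ := by exact_mod_cast le_top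
  have hC0 : 0 ≤ C := (norm_nonneg _).trans (hC 0)
  have hcomp := ContinuousMultilinearMap.norm_compContinuousLinearMap_le
    (iteratedFDeriv ℝ k P ((ε, 0) + L x)) (fun _ => L)
  simp only [Finset.prod_const, Finset.card_univ, Fintype.card_fin] at hcomp
  rw [hbump, iteratedFDeriv_const_smul_apply ((hP'_smooth.comp L.contDiff).of_le hk).contDiffAt,
    L.iteratedFDeriv_comp_right hP'_smooth x hk, norm_smul, hP', iteratedFDeriv_comp_add_left,
    Real.norm_of_nonneg (sq_nonneg ε)]
  calc _ ≤ ε ^ 2 * (C * ε ^ k) := by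
        gcongr
        exact hcomp.trans (by gcongr; exact hC _)
    _ = C * ε ^ (2 + k) := by ring

theorem bump_eq_zero (h0 : ∀ q : ℝ × E, ‖q.2‖ ∉ Icc (1 / 2 : ℝ) 4 → P q = 0)
    (hx : ‖ε • x‖ ∉ Icc (1 / 2 : ℝ) 4) : bump P ε x = 0 := by
  rw [bump, h0 _ hx, mul_zero]

theorem iteratedFDeriv_bump_eq_zero (h0 : ∀ q : ℝ × E, ‖q.2‖ ∉ Icc (1 / 2 : ℝ) 4 → P q = 0)
    (hx : ‖ε • x‖ ∉ Icc (1 / 2 : ℝ) 4) (k : ℕ) : iteratedFDeriv ℝ k (bump P ε) x = 0 := by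
  have hsupp : tsupport (bump P ε) ⊆ {x | ‖ε • x‖ ∈ Icc (1 / 2 : ℝ) 4} :=
    closure_minimal (fun y hy => not_imp_comm.1 (bump_eq_zero h0) hy)
      (isClosed_Icc.preimage (by fun_prop))
  exact image_eq_zero_of_notMem_tsupport fun h => hx (hsupp (tsupport_iteratedFDeriv_subset k h))

theorem norm_iteratedFDeriv_bump_le_div (hP : ContDiff ℝ ∞ P)
    (h0 : ∀ q : ℝ × E, ‖q.2‖ ∉ Icc (1 / 2 : ℝ) 4 → P q = 0) {C : ℝ}
    (hC : ∀ q, ‖iteratedFDeriv ℝ k P q‖ ≤ C) (hε : 0 ≤ ε) (x : E) :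
    ‖iteratedFDeriv ℝ k (bump P ε) x‖ ≤ C * 4 ^ (2 + k) / ‖x‖ ^ (2 + k) := by
  have hC0 : 0 ≤ C := (norm_nonneg _).trans (hC 0)
  by_cases hx : ‖ε • x‖ ∈ Icc (1 / 2 : ℝ) 4
  · rw [norm_smul, Real.norm_of_nonneg hε] at hx
    have hx0 : 0 < ‖x‖ := pos_of_mul_pos_right (by linarith [hx.1]) hε
    calc _ ≤ C * ε ^ (2 + k) := norm_iteratedFDeriv_bump_le hP hC hε x
      _ ≤ C * (4 / ‖x‖) ^ (2 + k) := by
          gcongr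
          exact (le_div_iff₀ hx0).2 hx.2
      _ = C * 4 ^ (2 + k) / ‖x‖ ^ (2 + k) := by rw [div_pow, mul_div_assoc]
  · rw [iteratedFDeriv_bump_eq_zero h0 hx, norm_zero]
    positivity

theorem norm_iteratedFDeriv_bump_scale_le (hP : ContDiff ℝ ∞ P) {C : ℝ}
    (hC : ∀ q, ‖iteratedFDeriv ℝ k P q‖ ≤ C) (hδ : δ ∈ Ioc 0 1) (n : ℕ) (x : E) :
    ‖iteratedFDeriv ℝ k (bump P (scale δ n)) x‖ ≤ C * scale δ n := by
  have hC0 : 0 ≤ C := (norm_nonneg _).trans (hC 0)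
  refine (norm_iteratedFDeriv_bump_le hP hC (scale_pos hδ.1 n).le x).trans ?_
  gcongr
  exact pow_le_of_le_one (scale_pos hδ.1 n).le ((scale_le hδ.1.le n).trans hδ.2) (by lia)

theorem summable_scale (δ : ℝ) : Summable (scale δ) :=
  (summable_geometric_of_lt_one (by norm_num) (by norm_num)).mul_left δ

theorem exists_bound_iteratedFDeriv (hP : ContDiff ℝ ∞ P) (hc : HasCompactSupport P) (k : ℕ) :
    ∃ C, ∀ q, ‖iteratedFDeriv ℝ k P q‖ ≤ C :=
  (hc.iteratedFDeriv (𝕜 := ℝ) k).exists_bound_of_continuous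
    (hP.continuous_iteratedFDeriv (by exact_mod_cast le_top))

theorem contDiff_series (hP : ContDiff ℝ ∞ P) (hc : HasCompactSupport P) (hδ : δ ∈ Ioc 0 1) :
    ContDiff ℝ ∞ (series P δ) := by
  choose C hC using exists_bound_iteratedFDeriv hP hc
  exact contDiff_tsum (N := ⊤) (fun n => contDiff_bump hP (scale δ n))
    (fun k _ => (summable_scale δ).mul_left (C k))
    (fun k n x _ => norm_iteratedFDeriv_bump_scale_le hP (hC k) hδ n x)

theorem iteratedFDeriv_series (hP : ContDiff ℝ ∞ P) (hc : HasCompactSupport P)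
    (hδ : δ ∈ Ioc 0 1) (k : ℕ) (x : E) :
    iteratedFDeriv ℝ k (series P δ) x = ∑' n, iteratedFDeriv ℝ k (bump P (scale δ n)) x := by
  choose C hC using exists_bound_iteratedFDeriv hP hc
  exact iteratedFDeriv_tsum_apply (N := ⊤) (fun n => contDiff_bump hP (scale δ n))
    (fun k _ => (summable_scale δ).mul_left (C k))
    (fun k n x _ => norm_iteratedFDeriv_bump_scale_le hP (hC k) hδ n x) le_top x

theorem exists_forall_ne_norm_scale_smul_notMem_Icc (hδ : 0 < δ) (x : E) :
    ∃ n, ∀ m ≠ n, ‖scale δ m • x‖ ∉ Icc (1 / 2 : ℝ) 4 := by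
  have hnorm : ∀ n, ‖scale δ n • x‖ = scale δ n * ‖x‖ := fun n => by
    rw [norm_smul, Real.norm_of_nonneg (scale_pos hδ n).le]
  simp only [hnorm]
  by_cases hx : ∃ n, scale δ n * ‖x‖ ∈ Icc (1 / 2 : ℝ) 4
  · obtain ⟨n, hn⟩ := hx
    exact ⟨n, fun m hmn hm => hmn (eq_of_scale_mul_mem_Icc hδ hm hn)⟩
  · exact ⟨0, fun m _ hm => hx ⟨m, hm⟩⟩

theorem exists_norm_iteratedFDeriv_series_le (hP : ContDiff ℝ ∞ P) (hc : HasCompactSupport P)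
    (h0 : ∀ q : ℝ × E, ‖q.2‖ ∉ Icc (1 / 2 : ℝ) 4 → P q = 0) (hδ : δ ∈ Ioc 0 1) (k : ℕ) :
    ∃ C : ℝ, ∀ x, ‖iteratedFDeriv ℝ k (series P δ) x‖ ≤ C / ‖x‖ ^ (2 + k) := by
  obtain ⟨C, hC⟩ := exists_bound_iteratedFDeriv hP hc k
  refine ⟨C * 4 ^ (2 + k), fun x => ?_⟩
  obtain ⟨n, hn⟩ := exists_forall_ne_norm_scale_smul_notMem_Icc hδ.1 x
  rw [iteratedFDeriv_series hP hc hδ, tsum_eq_single n fun m hm =>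
    iteratedFDeriv_bump_eq_zero h0 (hn m hm) k]
  exact norm_iteratedFDeriv_bump_le_div hP h0 hC (scale_pos hδ.1 n).le x

theorem series_eq_bump (h0 : ∀ q : ℝ × E, ‖q.2‖ ∉ Icc (1 / 2 : ℝ) 4 → P q = 0) (hδ : 0 < δ)
    (hx : ‖scale δ n • x‖ ∈ Icc (1 / 2 : ℝ) 4) : series P δ x = bump P (scale δ n) x := by
  obtain ⟨l, hl⟩ := exists_forall_ne_norm_scale_smul_notMem_Icc hδ x
  obtain rfl : n = l := not_imp_comm.1 (hl n) (not_not.2 hx)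
  exact tsum_eq_single n fun m hm => bump_eq_zero h0 (hl m hm)

theorem abs_series_le (h0 : ∀ q : ℝ × E, ‖q.2‖ ∉ Icc (1 / 2 : ℝ) 4 → P q = 0) {C : ℝ}
    (hC : ∀ q, |P q| ≤ C) (hδ : 0 < δ) (x : E) : |series P δ x| ≤ δ ^ 2 * C := by
  obtain ⟨n, hn⟩ := exists_forall_ne_norm_scale_smul_notMem_Icc hδ x
  rw [series, tsum_eq_single n fun m hm => bump_eq_zero h0 (hn m hm), bump, abs_mul,
    abs_of_nonneg (sq_nonneg _)]
  have hpos := scale_pos hδ n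
  gcongr
  · exact scale_le hδ.le n
  · exact hC _

end Superposition

section ConformalMetric

theorem contDiff_smul_vec {E F : Type*} [NormedAddCommGroup E] [NormedSpace ℝ E]
    [NormedAddCommGroup F] [NormedSpace ℝ F] {f : E → ℝ} (hf : ContDiff ℝ ∞ f) (c : F) :
    ContDiff ℝ ∞ (fun y => f y • c) :=
  hf.smul contDiff_const

theorem norm_iteratedFDeriv_smul_vec_le {E F : Type*} [NormedAddCommGroup E] [NormedSpace ℝ E]
    [NormedAddCommGroup F] [NormedSpace ℝ F] {f : E → ℝ} (hf : ContDiff ℝ ∞ f) (c : F) (k : ℕ)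
    (x : E) :
    ‖iteratedFDeriv ℝ k (fun y => f y • c) x‖ ≤ ‖c‖ * ‖iteratedFDeriv ℝ k f x‖ := by
  have hle := (ContinuousLinearMap.toSpanSingleton ℝ c).norm_iteratedFDeriv_comp_left (f := f)
    (x := x) (N := ∞) (n := k) hf.contDiffAt (by exact_mod_cast le_top)
  simpa [Function.comp_def] using hle

/-- The conformally flat metric `F δ`. -/
def conformalMetric (F : E3 → ℝ) (hF : ContDiff ℝ ∞ F) (hpos : ∀ x, 0 < F x) : Metric3 where
  toFun x := F x • euclid
  smooth := contDiff_smul_vec hF euclid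
  symm x u v := congrArg (F x * ·) (real_inner_comm v u)
  pos x _ hu := mul_pos (hpos x) (real_inner_self_pos.2 hu)

variable {F : E3 → ℝ} {hF : ContDiff ℝ ∞ F} {hpos : ∀ x, 0 < F x} {a b : ℝ}

theorem conformalMetric_apply (x u v : E3) :
    (conformalMetric F hF hpos).toFun x u v = F x * inner ℝ u v := rfl

theorem curveLength_conformalMetric (γ : ℝ → E3) :
    (conformalMetric F hF hpos).curveLength γ = ∫ t in (0 : ℝ)..1, √(F (γ t)) * ‖deriv γ t‖ := by
  unfold Metric3.curveLength
  congr 1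
  funext t
  rw [conformalMetric_apply, real_inner_self_eq_norm_sq, Real.sqrt_mul (hpos _).le,
    Real.sqrt_sq (norm_nonneg _)]

theorem curveLength_conformalMetric_nonneg (γ : ℝ → E3) :
    0 ≤ (conformalMetric F hF hpos).curveLength γ := by
  rw [curveLength_conformalMetric]
  exact intervalIntegral.integral_nonneg zero_le_one fun t _ => by positivity

theorem le_curveLength_conformalMetric (ha : ∀ x, a ≤ F x) {γ : ℝ → E3} (hγ : ContDiff ℝ 1 γ) :
    √a * ‖γ 1 - γ 0‖ ≤ (conformalMetric F hF hpos).curveLength γ := by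
  have hderiv : Continuous (deriv γ) := hγ.continuous_deriv le_rfl
  have hspeed : Continuous fun t => √(F (γ t)) * ‖deriv γ t‖ :=
    (Real.continuous_sqrt.comp (hF.continuous.comp hγ.continuous)).mul hderiv.norm
  have hftc : ∫ t in (0 : ℝ)..1, deriv γ t = γ 1 - γ 0 :=
    intervalIntegral.integral_deriv_eq_sub (fun t _ => hγ.differentiable one_ne_zero t)
      (hderiv.intervalIntegrable _ _)
  rw [curveLength_conformalMetric, ← hftc]
  calc √a * ‖∫ t in (0 : ℝ)..1, deriv γ t‖
      ≤ √a * ∫ t in (0 : ℝ)..1, ‖deriv γ t‖ := by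
        gcongr
        exact intervalIntegral.norm_integral_le_integral_norm zero_le_one
    _ = ∫ t in (0 : ℝ)..1, √a * ‖deriv γ t‖ := (intervalIntegral.integral_const_mul _ _).symm
    _ ≤ ∫ t in (0 : ℝ)..1, √(F (γ t)) * ‖deriv γ t‖ := by
        refine intervalIntegral.integral_mono_on zero_le_one
          ((continuous_const.mul hderiv.norm).intervalIntegrable _ _)
          (hspeed.intervalIntegrable _ _) fun t _ => ?_
        gcongr
        exact ha (γ t)

theorem gdist_conformalMetric_nonneg (x y : E3) : 0 ≤ (conformalMetric F hF hpos).gdist x y := by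
  refine Real.sInf_nonneg ?_
  rintro _ ⟨γ, -, -, -, rfl⟩
  exact curveLength_conformalMetric_nonneg γ

theorem deriv_segment {E : Type*} [NormedAddCommGroup E] [NormedSpace ℝ E] (x y : E) (t : ℝ) :
    deriv (fun t : ℝ => x + t • (y - x)) t = y - x := by
  simpa using (((hasDerivAt_id t).smul_const (y - x)).const_add x).deriv

theorem curveLength_conformalMetric_segment_le (hb : ∀ x, F x ≤ b) (x y : E3) :
    (conformalMetric F hF hpos).curveLength (fun t : ℝ => x + t • (y - x)) ≤ √b * ‖y - x‖ := by
  have hspeed : Continuous fun t : ℝ => √(F (x + t • (y - x))) * ‖y - x‖ :=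
    (Real.continuous_sqrt.comp (hF.continuous.comp (by fun_prop))).mul continuous_const
  rw [curveLength_conformalMetric]
  simp only [deriv_segment]
  calc ∫ t in (0 : ℝ)..1, √(F (x + t • (y - x))) * ‖y - x‖
      ≤ ∫ _ in (0 : ℝ)..1, √b * ‖y - x‖ := by
        refine intervalIntegral.integral_mono_on zero_le_one (hspeed.intervalIntegrable _ _)
          intervalIntegrable_const fun t _ => ?_
        gcongr
        exact hb _
    _ = √b * ‖y - x‖ := by simp

theorem gdist_conformalMetric_le (hb : ∀ x, F x ≤ b) (x y : E3) :
    (conformalMetric F hF hpos).gdist x y ≤ √b * ‖y - x‖ := by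
  refine le_trans (csInf_le ⟨0, ?_⟩ ⟨fun t : ℝ => x + t • (y - x), by fun_prop, by simp, by simp,
    rfl⟩) (curveLength_conformalMetric_segment_le hb x y)
  rintro _ ⟨γ, -, -, -, rfl⟩
  exact curveLength_conformalMetric_nonneg γ

theorem le_gdist_conformalMetric (ha : ∀ x, a ≤ F x) (x y : E3) :
    √a * ‖y - x‖ ≤ (conformalMetric F hF hpos).gdist x y := by
  refine le_csInf ⟨_, fun t : ℝ => x + t • (y - x), by fun_prop, by simp, by simp, rfl⟩ ?_
  rintro _ ⟨γ, hγ, rfl, rfl, rfl⟩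
  exact le_curveLength_conformalMetric ha hγ

theorem complete_conformalMetric (ha0 : 0 < a) (ha : ∀ x, a ≤ F x) (hb : ∀ x, F x ≤ b) :
    (conformalMetric F hF hpos).Complete := by
  intro u hu
  have hsqrt : 0 < √a := Real.sqrt_pos.2 ha0
  have hcauchy : CauchySeq u := by
    rw [Metric.cauchySeq_iff]
    intro ε hε
    obtain ⟨N, hN⟩ := hu (√a * ε) (by positivity)
    refine ⟨N, fun m hm n hn => ?_⟩
    rw [dist_comm, dist_eq_norm]
    exact lt_of_mul_lt_mul_left
      ((le_gdist_conformalMetric ha (u m) (u n)).trans_lt (hN m hm n hn)) hsqrt.le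
  obtain ⟨x, hx⟩ := cauchySeq_tendsto_of_complete hcauchy
  have hlim : Tendsto (fun n => √b * ‖x - u n‖) atTop (𝓝 0) := by
    simpa using (tendsto_const_nhds (x := x).sub hx).norm.const_mul (√b)
  exact ⟨x, squeeze_zero (fun n => gdist_conformalMetric_nonneg _ _)
    (fun n => gdist_conformalMetric_le hb _ _) hlim⟩

end ConformalMetric

section PerturbedSchwarzschild

/-- The conformal factor of the Schwarzschild metric of mass `1`, filled in near the origin. -/
def baseFactor (x : E3) : ℝ := (1 + Real.smoothTransition (4 * ‖x‖ ^ 2 - 1) / (2 * ‖x‖)) ^ 4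

theorem contDiff_baseFactor : ContDiff ℝ ∞ baseFactor := by
  rw [contDiff_iff_contDiffAt]
  intro x
  by_cases hx : x = 0
  · refine (contDiffAt_const (c := (1 : ℝ))).congr_of_eventuallyEq ?_
    have hsmall : ∀ᶠ y in 𝓝 x, ‖y‖ < 1 / 2 :=
      continuous_norm.continuousAt.eventually (gt_mem_nhds (by simp [hx]))
    filter_upwards [hsmall] with y hy
    rw [baseFactor, Real.smoothTransition.zero_of_nonpos (by nlinarith [norm_nonneg y]), zero_div,
      add_zero, one_pow]
  · have hnorm : ContDiffAt ℝ ∞ (fun x : E3 => ‖x‖) x := contDiffAt_norm ℝ hx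
    exact (contDiffAt_const.add ((Real.smoothTransition.contDiff.contDiffAt.comp x
      ((contDiffAt_const.mul (hnorm.pow 2)).sub contDiffAt_const)).div
      (contDiffAt_const.mul hnorm) (by simpa using hx))).pow 4

theorem one_le_baseFactor (x : E3) : 1 ≤ baseFactor x :=
  one_le_pow₀ (le_add_of_nonneg_right
    (div_nonneg (Real.smoothTransition.nonneg _) (by positivity)))

theorem baseFactor_le (x : E3) : baseFactor x ≤ 16 := by
  have h0 := Real.smoothTransition.nonneg (4 * ‖x‖ ^ 2 - 1)
  have hle : Real.smoothTransition (4 * ‖x‖ ^ 2 - 1) / (2 * ‖x‖) ≤ 1 := by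
    by_cases hx : ‖x‖ ≤ 1 / 2
    · rw [Real.smoothTransition.zero_of_nonpos (by nlinarith [norm_nonneg x]), zero_div]
      exact zero_le_one
    · rw [div_le_one (by linarith)]
      linarith [Real.smoothTransition.le_one (4 * ‖x‖ ^ 2 - 1)]
  calc baseFactor x ≤ 2 ^ 4 := pow_le_pow_left₀ (by positivity) (by linarith) 4
    _ = 16 := by norm_num

theorem baseFactor_eq {x : E3} (hx : 1 ≤ ‖x‖) : baseFactor x = (1 + 1 / (2 * ‖x‖)) ^ 4 := by
  rw [baseFactor, Real.smoothTransition.one_of_one_le (by nlinarith)]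

theorem baseFactor_rot (θ : ℝ) (x : E3) : baseFactor (rot θ x) = baseFactor x := by
  rw [baseFactor, baseFactor, norm_rot]

theorem series_rot {P : ℝ × E3 → ℝ} (hP : ∀ θ ε y, P (ε, rot θ y) = P (ε, y)) (δ θ : ℝ) (x : E3) :
    series P δ (rot θ x) = series P δ x := by
  simp only [series, bump, ← rot_smul, hP]

theorem isAxisymmetric_conformalMetric {F : E3 → ℝ} (hF : ContDiff ℝ ∞ F) (hpos : ∀ x, 0 < F x)
    (hrot : ∀ θ x, F (rot θ x) = F x) : (conformalMetric F hF hpos).IsAxisymmetric :=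
  fun θ x u v => by rw [conformalMetric_apply, conformalMetric_apply, hrot, inner_rot]

theorem isAsymptoticallySchwarzschild_conformalMetric {f : E3 → ℝ} (hf : ContDiff ℝ ∞ f)
    (hle : ∀ x, |f x| ≤ 1 / 2)
    (hdecay : ∀ k, ∃ C : ℝ, ∀ x, ‖iteratedFDeriv ℝ k f x‖ ≤ C / ‖x‖ ^ (2 + k))
    (hpos : ∀ x, 0 < baseFactor x + f x) :
    IsAsymptoticallySchwarzschild 1
      (conformalMetric (fun x => baseFactor x + f x) (contDiff_baseFactor.add hf) hpos) := by
  refine ⟨complete_conformalMetric (a := 1 / 2) (b := 17) (by norm_num) (fun x => ?_)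
    fun x => ?_, fun k => ?_⟩
  · linarith [one_le_baseFactor x, (abs_le.1 (hle x)).1]
  · linarith [baseFactor_le x, (abs_le.1 (hle x)).2]
  · obtain ⟨C, hC⟩ := hdecay k
    refine ⟨‖euclid‖ * C, fun x hx => ?_⟩
    have hdiff : (fun y => (conformalMetric (fun x => baseFactor x + f x)
        (contDiff_baseFactor.add hf) hpos).toFun y - schwarzschild 1 y) =ᶠ[𝓝 x]
        fun y => f y • euclid := by
      filter_upwards [continuous_norm.continuousAt.eventually (lt_mem_nhds hx)] with y hy
      ext u v
      change (baseFactor y + f y) * inner ℝ u v - (1 + 1 / (2 * ‖y‖)) ^ 4 * inner ℝ u v =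
        f y * inner ℝ u v
      rw [baseFactor_eq hy.le]
      ring
    rw [(Filter.EventuallyEq.iteratedFDeriv ℝ hdiff k).self_of_nhds, mul_div_assoc]
    exact (norm_iteratedFDeriv_smul_vec_le hf euclid k x).trans (by gcongr; exact hC x)

namespace Correction

/-- In the annulus `1 / 2 ≤ ε |x| ≤ 4` the metric `g` is the rescaled perturbed Schwarzschild metric
with parameter `ε`. -/
structure IsConformalAt (K : Correction) (g : Metric3) (ε : ℝ) : Prop where
  pos : 0 < ε
  lt : ε < K.δ
  conformal_pos : ∀ y, 0 < K.conformal (ε, y)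
  toFun_eq : ∀ x, ‖ε • x‖ ∈ Icc (1 / 2 : ℝ) 4 →
    g.toFun x = (K.conformal (ε, ε • x) ^ 2)⁻¹ • euclid

theorem Profile.baseFactor_add_series {K : Correction} (P : K.Profile) {δ : ℝ} (hδ : 0 < δ)
    (hδP : δ ≤ P.δ) (hδ2 : δ ≤ 1 / 2) {n : ℕ} {x : E3}
    (hx : ‖scale δ n • x‖ ∈ Icc (1 / 2 : ℝ) 4) :
    baseFactor x + series P.toFun δ x = (K.conformal (scale δ n, scale δ n • x) ^ 2)⁻¹ := by
  have hpos := scale_pos hδ n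
  have hle := scale_le hδ.le n
  rw [series_eq_bump P.eq_zero hδ hx, bump, ← P.add_eq _ ⟨hpos, hle.trans hδP⟩]
  rw [norm_smul, Real.norm_of_nonneg hpos.le] at hx ⊢
  rw [baseFactor_eq (by nlinarith [hx.1, norm_nonneg x]), mul_left_comm,
    ← mul_div_mul_left 1 (2 * ‖x‖) hpos.ne', mul_one]

theorem exists_metric (K : Correction) {δ₀ : ℝ} (hδ₀ : 0 < δ₀) :
    ∃ δ ∈ Ioc 0 δ₀, ∃ g : Metric3, IsAsymptoticallySchwarzschild 1 g ∧ g.IsAxisymmetric ∧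
      ∀ n, K.IsConformalAt g (scale δ n) := by
  obtain ⟨P⟩ := K.nonempty_profile
  obtain ⟨C, hC⟩ := P.hasCompactSupport.exists_bound_of_continuous P.contDiff.continuous
  have hC0 : 0 ≤ C := (norm_nonneg _).trans (hC 0)
  obtain ⟨δ, hδ, hδ₀', hδP, hδ2, hδC⟩ : ∃ δ > 0, δ ≤ δ₀ ∧ δ ≤ P.δ ∧ δ ≤ 1 / 2 ∧
      δ ≤ 1 / (2 * (C + 1)) := by
    refine ⟨min δ₀ (min P.δ (min (1 / 2) (1 / (2 * (C + 1))))), ?_, ?_⟩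
    · simp only [gt_iff_lt, lt_min_iff]
      exact ⟨hδ₀, P.pos, by norm_num, by positivity⟩
    · simp only [← le_min_iff, le_refl]
  have hδ1 : δ ∈ Ioc 0 1 := ⟨hδ, by linarith⟩
  have hle : ∀ x, |series P.toFun δ x| ≤ 1 / 2 := fun x => by
    refine (abs_series_le P.eq_zero hC hδ x).trans ?_
    rw [le_div_iff₀ (by positivity)] at hδC
    nlinarith
  have hpos : ∀ x, 0 < baseFactor x + series P.toFun δ x := fun x => by
    linarith [one_le_baseFactor x, (abs_le.1 (hle x)).1]
  have hsmooth := contDiff_series P.contDiff P.hasCompactSupport hδ1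
  refine ⟨δ, ⟨hδ, hδ₀'⟩, conformalMetric _ (contDiff_baseFactor.add hsmooth) hpos,
    isAsymptoticallySchwarzschild_conformalMetric hsmooth hle
      (exists_norm_iteratedFDeriv_series_le P.contDiff P.hasCompactSupport P.eq_zero hδ1) hpos,
    isAxisymmetric_conformalMetric _ _ fun θ x => by rw [baseFactor_rot, series_rot P.rot],
    fun n => ?_⟩
  have hmem : scale δ n ∈ Ioc 0 P.δ := ⟨scale_pos hδ n, (scale_le hδ.le n).trans hδP⟩
  exact ⟨hmem.1, hmem.2.trans_lt P.lt, P.conformal_pos _ hmem, fun x hx =>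
    congrArg (· • euclid) (P.baseFactor_add_series hδ hδP hδ2 hx)⟩

end Correction

end PerturbedSchwarzschild

section RescaledSpheres

variable {ε : ℝ}

/-- The dilation `x ↦ ε⁻¹ x`. -/
def scaling (hε : ε ≠ 0) : E3 ≃ₘ[ℝ] E3 :=
  (ContinuousLinearEquiv.smulLeft (R₁ := ℝ) (M₁ := E3) (Units.mk0 ε hε)).symm.toDiffeomorph

/-- The sphere `{x | ‖Ψ (ε x)‖ = 1}`, that is, the preimage of the unit sphere under `Ψ` blown up
by the factor `ε⁻¹`. -/
def rescaledSphere (Ψ : E3 ≃ₘ[ℝ] E3) (hε : ε ≠ 0) : EmbeddedSphere :=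
  EmbeddedSphere.ofDiffeomorph (Ψ.symm.trans (scaling hε))

variable {Ψ : E3 ≃ₘ[ℝ] E3} {hε : ε ≠ 0} {x : E3}

theorem mem_carrier_rescaledSphere : x ∈ (rescaledSphere Ψ hε).carrier ↔ ‖Ψ (ε • x)‖ = 1 :=
  EmbeddedSphere.mem_carrier_ofDiffeomorph _

theorem mem_enclosed_rescaledSphere : x ∈ (rescaledSphere Ψ hε).enclosed ↔ ‖Ψ (ε • x)‖ < 1 :=
  EmbeddedSphere.mem_enclosed_ofDiffeomorph _

theorem norm_apply_rescaledSphere (p : S2) : ‖Ψ (ε • (rescaledSphere Ψ hε).toFun p)‖ = 1 :=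
  mem_carrier_rescaledSphere.1 ⟨p, rfl⟩

theorem isAxisymmetric_rescaledSphere (hΨ : ∀ θ y, ‖Ψ (rot θ y)‖ = ‖Ψ y‖) :
    (rescaledSphere Ψ hε).IsAxisymmetric := by
  intro θ
  ext x
  constructor
  · rintro ⟨y, hy, rfl⟩
    rw [mem_carrier_rescaledSphere] at hy ⊢
    rw [← rot_smul, hΨ, hy]
  · intro hx
    refine ⟨rot (-θ) x, ?_, rot_rot_neg θ x⟩
    rw [mem_carrier_rescaledSphere] at hx ⊢
    rw [← rot_smul, hΨ, hx]

theorem isOutlying_rescaledSphere (hzero : 1 < ‖Ψ 0‖)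
    (hend : ∀ x ∈ (rescaledSphere Ψ hε).carrier, 1 < ‖x‖) :
    (rescaledSphere Ψ hε).IsOutlying := by
  refine ⟨hend, Set.disjoint_left.2 fun x hx hball => ?_⟩
  have hΨx : ‖Ψ (ε • x)‖ ≤ 1 := by
    rcases hx with hx | hx
    · exact (mem_carrier_rescaledSphere.1 hx).le
    · exact (mem_enclosed_rescaledSphere.1 hx).le
  have hcont : Continuous fun t : ℝ => ‖Ψ (ε • t • x)‖ :=
    (Ψ.continuous.comp (by fun_prop)).norm
  -- The segment from the origin to `x` crosses the surface no farther from the origin than `x`.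
  obtain ⟨t, ht, hteq⟩ := intermediate_value_Icc' zero_le_one hcont.continuousOn
    (show (1 : ℝ) ∈ _ by simpa using ⟨hΨx, hzero.le⟩)
  have hle : sInf (norm '' (rescaledSphere Ψ hε).carrier) ≤ ‖t • x‖ :=
    csInf_le ⟨0, by rintro _ ⟨y, _, rfl⟩; exact norm_nonneg y⟩
      ⟨_, mem_carrier_rescaledSphere.2 hteq, rfl⟩
  rw [norm_smul, Real.norm_of_nonneg ht.1] at hle
  have hlt := mem_ball_zero_iff.1 hball
  exact hlt.not_ge (hle.trans (mul_le_of_le_one_left (norm_nonneg x) ht.2))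

end RescaledSpheres

section RescaledMeanCurvature

/-- The preimage of the unit sphere under `Ψ` lies in the annulus `1 / 2 < ‖y‖ < 4` and is contained
in the zero set of a defining function `ψ`, which is positive only outside of it and whose gradient
along it is the smooth nowhere vanishing field `v`. -/
structure IsAnnularLevelSet (Ψ : E3 ≃ₘ[ℝ] E3) (ψ : E3 → ℝ) (v : E3 → E3) : Prop where
  norm_mem : ∀ y, ‖Ψ y‖ = 1 → ‖y‖ ∈ Ioo (1 / 2 : ℝ) 4
  contDiffAt_gradient : ∀ y, ‖Ψ y‖ = 1 → ContDiffAt ℝ ∞ v y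
  gradient_ne_zero : ∀ y, ‖Ψ y‖ = 1 → v y ≠ 0
  hasFDerivAt : ∀ y, ‖Ψ y‖ = 1 → HasFDerivAt ψ (innerSL ℝ (v y)) y
  eq_zero : ∀ y, ‖Ψ y‖ = 1 → ψ y = 0
  one_le_norm : ∀ y, ‖Ψ y‖ = 1 → ∀ᶠ z in 𝓝 y, 0 < ψ z → 1 ≤ ‖Ψ z‖

namespace Correction

variable {K : Correction} {g : Metric3} {ε : ℝ} {y : E3}

theorem contDiffAt_conformal (hε : ε ∈ Ioo (-K.δ) K.δ) (hy : y ≠ 0)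
    (hφ : 1 + ε / (2 * ‖y‖) ≠ 0) : ContDiffAt ℝ ∞ (fun y => K.conformal (ε, y)) y := by
  have hschw : ContDiffAt ℝ ∞ (fun y : E3 => schwFactor ε ‖y‖) y :=
    ContDiffAt.comp (g := fun p : ℝ × ℝ => schwFactor p.1 p.2) y
      (contDiffAt_schwFactor (norm_ne_zero_iff.2 hy) hφ)
      (contDiffAt_const.prodMk (contDiffAt_norm ℝ hy))
  have hperturbation : ContDiffAt ℝ ∞ (fun y => K.perturbation (ε, y)) y :=
    (contDiffAt_perturbation (q := (ε, y)) hε).comp y (contDiffAt_const.prodMk contDiffAt_id)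
  exact hschw.add ((contDiffAt_const (c := ε ^ 2)).mul hperturbation)

theorem hasFDerivAt_conformal (hε : ε ∈ Ioo (-K.δ) K.δ) (hy : y ≠ 0)
    (hφ : 1 + ε / (2 * ‖y‖) ≠ 0) :
    HasFDerivAt (fun y => K.conformal (ε, y)) ((schwFactorDeriv ε ‖y‖ / ‖y‖) • innerSL ℝ y +
      ε ^ 2 • fderiv ℝ (fun y => K.perturbation (ε, y)) y) y := by
  have hschw := hasFDerivAt_comp_norm hy (hasDerivAt_schwFactor (norm_ne_zero_iff.2 hy) hφ)
  have hperturbation : DifferentiableAt ℝ (fun y => K.perturbation (ε, y)) y :=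
    ((contDiffAt_perturbation (q := (ε, y)) hε).comp y
      (contDiffAt_const.prodMk contDiffAt_id)).differentiableAt (by simp)
  exact hschw.add (hperturbation.hasFDerivAt.const_mul (ε ^ 2))

namespace IsConformalAt

variable {Ψ : E3 ≃ₘ[ℝ] E3} {ψ : E3 → ℝ} {v : E3 → E3}

theorem mem_Ioo (h : K.IsConformalAt g ε) : ε ∈ Ioo (-K.δ) K.δ :=
  ⟨(neg_neg_of_pos K.pos).trans h.pos, h.lt⟩

theorem isConformalLevelSet (h : K.IsConformalAt g ε) (hΨ : IsAnnularLevelSet Ψ ψ v) :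
    (rescaledSphere Ψ h.pos.ne').IsConformalLevelSet g (fun x => K.conformal (ε, ε • x))
      (fun x => ε⁻¹ * ψ (ε • x)) (fun x => v (ε • x)) := by
  have hsmul : ContDiff ℝ ∞ fun x : E3 => ε • x := contDiff_const_smul ε
  have hnorm := fun p => norm_apply_rescaledSphere (Ψ := Ψ) (hε := h.pos.ne') p
  refine ⟨fun p => ?_, fun p => ?_, fun p => h.conformal_pos _,
    fun p => (hΨ.contDiffAt_gradient _ (hnorm p)).comp _ hsmul.contDiffAt,
    fun p => hΨ.gradient_ne_zero _ (hnorm p),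
    fun p => hasFDerivAt_inv_mul_comp_smul h.pos.ne' (hΨ.hasFDerivAt _ (hnorm p)),
    fun p => by rw [hΨ.eq_zero _ (hnorm p), mul_zero], fun p => ?_⟩
  · have hcont : ContinuousAt (fun x : E3 => ‖ε • x‖) ((rescaledSphere Ψ h.pos.ne').toFun p) := by
      fun_prop
    filter_upwards [hcont.eventually (isOpen_Ioo.mem_nhds (hΨ.norm_mem _ (hnorm p)))] with x hx
    exact h.toFun_eq x (Ioo_subset_Icc_self hx)
  · have hpos : 0 < ‖ε • (rescaledSphere Ψ h.pos.ne').toFun p‖ := by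
      linarith [(hΨ.norm_mem _ (hnorm p)).1]
    have hε := h.pos
    exact (contDiffAt_conformal h.mem_Ioo (norm_pos_iff.1 hpos) (by positivity)).comp _
      hsmul.contDiffAt
  · filter_upwards [hsmul.continuous.continuousAt.eventually (hΨ.one_le_norm _ (hnorm p))]
      with x hx hpos
    rw [mem_enclosed_rescaledSphere, not_lt]
    exact hx ((mul_pos_iff_of_pos_left (inv_pos.2 h.pos)).1 hpos)

theorem hasConstantMeanCurvature (h : K.IsConformalAt g ε) (hΨ : IsAnnularLevelSet Ψ ψ v) {H : ℝ}
    (hH : ∀ y, ‖Ψ y‖ = 1 → conformalMeanCurv (fun y => K.conformal (ε, y)) v y = H) :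
    (rescaledSphere Ψ h.pos.ne').HasConstantMeanCurvature g (ε * H) := by
  refine (h.isConformalLevelSet hΨ).hasConstantMeanCurvature fun p => ?_
  rw [conformalMeanCurv_comp_smul (fun y => K.conformal (ε, y)), hH _ (norm_apply_rescaledSphere p)]

theorem tangentPlane_eq (h : K.IsConformalAt g ε) (hΨ : IsAnnularLevelSet Ψ ψ v) {p : S2} {c : E3}
    (hp : (rescaledSphere Ψ h.pos.ne').toFun p = ε⁻¹ • c) :
    (rescaledSphere Ψ h.pos.ne').tangentPlane p = (Submodule.span ℝ {v c})ᗮ := by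
  rw [(h.isConformalLevelSet hΨ).tangentPlane_eq, hp, smul_inv_smul₀ h.pos.ne']

end IsConformalAt

end Correction

end RescaledMeanCurvature

section CentredSphere

variable {ε : ℝ}

/-- The sphere of radius `ε⁻¹` about the origin. -/
def centredSphere (hε : ε ≠ 0) : EmbeddedSphere :=
  rescaledSphere (Diffeomorph.refl 𝓘(ℝ, E3) E3 ∞) hε

theorem mem_carrier_centredSphere {hε : ε ≠ 0} {x : E3} :
    x ∈ (centredSphere hε).carrier ↔ ‖ε • x‖ = 1 :=
  mem_carrier_rescaledSphere

theorem isAxisymmetric_centredSphere (hε : ε ≠ 0) : (centredSphere hε).IsAxisymmetric :=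
  isAxisymmetric_rescaledSphere norm_rot

theorem separatesCompactPart_centredSphere (hε : ε ∈ Ioo 0 1) :
    (centredSphere hε.1.ne').SeparatesCompactPart := by
  have hnorm : ∀ x : E3, ‖ε • x‖ = ε * ‖x‖ := fun x => by
    rw [norm_smul, Real.norm_of_nonneg hε.1.le]
  constructor
  · intro x hx
    rw [mem_carrier_centredSphere, hnorm] at hx
    change 1 < ‖x‖
    nlinarith [norm_nonneg x, hε.1, hε.2]
  · intro x hx
    rw [mem_closedBall_zero_iff] at hx
    rw [centredSphere, mem_enclosed_rescaledSphere]
    change ‖ε • x‖ < 1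
    rw [hnorm]
    nlinarith [norm_nonneg x, hε.1, hε.2]

theorem mem_axis_iff {x : E3} : x ∈ axis ↔ x = x 0 • axisDir := by
  constructor
  · rintro ⟨h1, h2⟩
    ext i
    fin_cases i <;> simp [axisDir, h1, h2]
  · intro hx
    rw [hx]
    simp [axisDir, axis]

theorem carrier_centredSphere_inter_axis (hε : 0 < ε) :
    (centredSphere hε.ne').carrier ∩ axis = {ε⁻¹ • axisDir, ε⁻¹ • -axisDir} := by
  ext x
  rw [mem_inter_iff, mem_carrier_centredSphere, mem_insert_iff, mem_singleton_iff]
  constructor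
  · rintro ⟨hx, haxis⟩
    rw [mem_axis_iff] at haxis
    rw [haxis, norm_smul, norm_smul, norm_axisDir, mul_one, Real.norm_of_nonneg hε.le,
      Real.norm_eq_abs] at hx
    have habs : |x 0| = ε⁻¹ := eq_inv_of_mul_eq_one_right hx
    rw [haxis, smul_neg, ← neg_smul]
    exact ((abs_eq (by positivity)).1 habs).imp (fun h => by rw [h]) fun h => by rw [h]
  · rintro (rfl | rfl) <;> rw [smul_inv_smul₀ hε.ne'] <;> simp [axisDir, axis]

theorem inv_smul_axisDir_ne_neg (hε : ε ≠ 0) : ε⁻¹ • axisDir ≠ ε⁻¹ • -axisDir := by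
  intro h
  have hzero := congrArg (fun x : E3 => x 0) (smul_right_injective E3 (inv_ne_zero hε) h)
  norm_num [axisDir] at hzero

theorem isAnnularLevelSet_refl :
    IsAnnularLevelSet (Diffeomorph.refl 𝓘(ℝ, E3) E3 ∞) (fun y => (‖y‖ ^ 2 - 1) / 2)
      (fun y => y) where
  norm_mem y (hy : ‖y‖ = 1) := by rw [hy]; norm_num
  contDiffAt_gradient _ _ := contDiffAt_id
  gradient_ne_zero y (hy : ‖y‖ = 1) := norm_pos_iff.1 (hy ▸ one_pos)
  hasFDerivAt y _ := by
    refine (((hasStrictFDerivAt_norm_sq y).hasFDerivAt.sub_const 1).mul_const (2⁻¹)).congr_fderiv ?_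
    ext u
    simp
  eq_zero y (hy : ‖y‖ = 1) := by simp [hy]
  one_le_norm y _ := Eventually.of_forall fun z hz => by
    change 1 ≤ ‖z‖
    nlinarith [norm_nonneg z]

namespace Correction

variable {K : Correction} {g : Metric3}

theorem conformalMeanCurv_id {y : E3} (hε : ε ∈ Ioo (-K.δ) K.δ) (hy : ‖y‖ = 1) :
    conformalMeanCurv (fun y => K.conformal (ε, y)) (fun y => y) y = centredMeanCurv ε := by
  have hreg := K.regular ε hε 1 (by norm_num)
  have hφ : 1 + ε / (2 * ‖y‖) ≠ 0 := by
    rw [hy]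
    exact hreg.schwFactor_base_pos.ne'
  have htrace : LinearMap.trace ℝ E3 (ContinuousLinearMap.id ℝ E3).toLinearMap = 3 := by simp
  rw [conformalMeanCurv, fderiv_fun_id, htrace,
    (hasFDerivAt_conformal hε (norm_pos_iff.1 (hy ▸ one_pos)) hφ).fderiv]
  simp only [add_apply, smul_apply, fderiv_perturbation_self hε hy, innerSL_apply_apply,
    ContinuousLinearMap.id_apply, real_inner_self_eq_norm_sq, hy, smul_eq_mul, conformal,
    centredMeanCurv]
  ring

theorem IsConformalAt.hasConstantMeanCurvature_centredSphere (h : K.IsConformalAt g ε) :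
    (centredSphere h.pos.ne').HasConstantMeanCurvature g (ε * centredMeanCurv ε) :=
  h.hasConstantMeanCurvature isAnnularLevelSet_refl fun _ hy => conformalMeanCurv_id h.mem_Ioo hy

end Correction

end CentredSphere

section CutDeviation

/-- The deviation of the outlying sphere from a round one, as a function on space cut off to an
annulus. -/
def cutDeviation (y : E3) : ℝ := radialCutoff ‖y‖ * deviation ‖y‖

variable {G : Type*} [NormedAddCommGroup G] [NormedSpace ℝ G]

theorem contDiff_cutDeviation_smul {T : E3 → G} (hT : ContDiff ℝ ∞ T) :
    ContDiff ℝ ∞ fun y => cutDeviation y • T y := by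
  have hopen : IsOpen {y : E3 | 0 < ‖y‖} := isOpen_lt continuous_const continuous_norm
  have hsmooth : ∀ y ∈ {y : E3 | 0 < ‖y‖},
      ContDiffWithinAt ℝ ∞ (fun y => deviation ‖y‖ • T y) {y : E3 | 0 < ‖y‖} y := fun y hy =>
    (((contDiffAt_deviation hy).comp y (contDiffAt_norm ℝ (norm_pos_iff.1 hy))).smul
      hT.contDiffAt).contDiffWithinAt
  simpa only [cutDeviation, mul_smul] using contDiff_smul_of_tsupport_subset hopen
    contDiff_radialCutoff_norm hsmooth (tsupport_radialCutoff_norm_subset.trans fun y hy =>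
      lt_of_lt_of_le (by norm_num) hy.1)

theorem hasCompactSupport_cutDeviation_smul (T : E3 → G) :
    HasCompactSupport fun y => cutDeviation y • T y := by
  refine HasCompactSupport.of_support_subset_isCompact (isCompact_closedBall (0 : E3) 4) ?_
  intro y hy
  by_contra hfar
  rw [mem_closedBall_zero_iff, not_le] at hfar
  exact hy (by simp only [cutDeviation, radialCutoff_eq_zero (Or.inr hfar.le), zero_mul, zero_smul])

theorem one_add_cutDeviation_eq_dilation (ε : ℝ) {y : E3} (hy : ‖y‖ ∈ Icc (4 / 5 : ℝ) (7 / 2)) :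
    1 + 2 * ε * cutDeviation y = dilation ε ‖y‖ := by
  rw [cutDeviation, radialCutoff_eq_one hy, one_mul, dilation]

/-- A diffeomorphism which maps the outlying sphere `{⟪c, y⟫ = height ε ‖y‖}` to the unit sphere: a
small perturbation of the translation by `-2 c`. -/
structure OutlyingChart (ε : ℝ) (c : E3) where
  toDiffeomorph : E3 ≃ₘ[ℝ] E3
  abs_cutDeviation_le : ∀ y, |2 * ε * cutDeviation y| ≤ 1 / 20
  apply_eq : ∀ y, toDiffeomorph y = (1 + 2 * ε * cutDeviation y) • (y - (2 : ℝ) • c)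

theorem exists_diffeomorph_outlying {ε : ℝ} (hε : 0 ≤ ε) {c : E3} {L : NNReal}
    (hL : LipschitzWith L fun y => cutDeviation y • (y - (2 : ℝ) • c)) (hεL : 2 * ε * L < 1) :
    ∃ Ψ : E3 ≃ₘ[ℝ] E3, ∀ y, Ψ y = (1 + 2 * ε * cutDeviation y) • (y - (2 : ℝ) • c) := by
  have hsmooth : ContDiff ℝ ∞ fun y => cutDeviation y • (y - (2 : ℝ) • c) :=
    contDiff_cutDeviation_smul (by fun_prop)
  have hlip : LipschitzWith (Real.toNNReal (2 * ε) * L)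
      fun y => (2 * ε) • cutDeviation y • (y - (2 : ℝ) • c) - (2 : ℝ) • c := by
    refine LipschitzWith.of_dist_le_mul fun x y => ?_
    rw [dist_sub_right, dist_smul₀, NNReal.coe_mul, Real.coe_toNNReal _ (by positivity), mul_assoc,
      Real.norm_of_nonneg (by positivity)]
    exact mul_le_mul_of_nonneg_left (hL.dist_le_mul x y) (by positivity)
  have hlt : Real.toNNReal (2 * ε) * L < 1 := by
    rwa [← NNReal.coe_lt_coe, NNReal.coe_mul, Real.coe_toNNReal _ (by positivity), NNReal.coe_one]
  obtain ⟨Ψ, hΨ⟩ := exists_diffeomorph_apply_eq_add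
    ((hsmooth.const_smul (2 * ε)).sub contDiff_const) hlt hlip
  refine ⟨Ψ, fun y => ?_⟩
  rw [hΨ, add_smul, one_smul, mul_smul (2 * ε)]
  abel

theorem exists_forall_nonempty_outlyingChart (c : E3) :
    ∃ δ > 0, ∀ ε ∈ Ioc 0 δ, Nonempty (OutlyingChart ε c) := by
  obtain ⟨L, hL⟩ := (contDiff_cutDeviation_smul (T := fun y : E3 => y - (2 : ℝ) • c)
    (by fun_prop)).lipschitzWith_of_hasCompactSupport
    (hasCompactSupport_cutDeviation_smul fun y : E3 => y - (2 : ℝ) • c) (by simp)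
  obtain ⟨M, hM⟩ := (hasCompactSupport_cutDeviation_smul fun _ : E3 => (1 : ℝ)
    ).exists_bound_of_continuous (contDiff_cutDeviation_smul contDiff_const).continuous
  have hM0 : 0 ≤ M := (norm_nonneg _).trans (hM 0)
  refine ⟨1 / (40 * (M + L + 1)), by positivity, fun ε hε => ?_⟩
  have hε0 := hε.1
  have hsmall : ε * (40 * (M + L + 1)) ≤ 1 := (le_div_iff₀ (by positivity)).1 hε.2
  obtain ⟨Ψ, hΨ⟩ := exists_diffeomorph_outlying hε0.le hL (by nlinarith)
  refine ⟨Ψ, fun y => ?_, hΨ⟩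
  have hbound : |cutDeviation y| ≤ M := by simpa using hM y
  rw [abs_mul, abs_of_pos (by positivity : 0 < 2 * ε)]
  nlinarith

end CutDeviation

section OutlyingNormal

variable {ε : ℝ} {c y : E3}

/-- The gradient of the defining function `height ε ‖y‖ - ⟪c, y⟫` of the outlying sphere. -/
def outlyingNormal (ε : ℝ) (c y : E3) : E3 := (heightDeriv ε ‖y‖ / ‖y‖) • y - c

theorem hasFDerivAt_height_sub_inner (hy : y ≠ 0) (hD : dilation ε ‖y‖ ≠ 0) :
    HasFDerivAt (fun y => height ε ‖y‖ - inner ℝ c y) (innerSL ℝ (outlyingNormal ε c y)) y := by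
  refine ((hasFDerivAt_comp_norm hy (hasDerivAt_height (norm_pos_iff.2 hy) hD)).sub
    (innerSL ℝ c).hasFDerivAt).congr_fderiv ?_
  rw [outlyingNormal, map_sub, map_smul]

theorem hasFDerivAt_outlyingNormal (hy : y ≠ 0) (hD : dilation ε ‖y‖ ≠ 0) :
    HasFDerivAt (outlyingNormal ε c)
      ((heightDeriv ε ‖y‖ / ‖y‖) • ContinuousLinearMap.id ℝ E3 +
        (((heightDeriv₂ ε ‖y‖ - heightDeriv ε ‖y‖ / ‖y‖) / ‖y‖ ^ 2) • innerSL ℝ y).smulRight y)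
      y := by
  have hnorm : 0 < ‖y‖ := norm_pos_iff.2 hy
  have hcoeff : HasDerivAt (fun r => heightDeriv ε r / r)
      ((heightDeriv₂ ε ‖y‖ - heightDeriv ε ‖y‖ / ‖y‖) / ‖y‖) ‖y‖ := by
    refine ((hasDerivAt_heightDeriv hnorm hD).div (hasDerivAt_id _) hnorm.ne').congr_deriv ?_
    simp only [id]
    field_simp
  refine (((hasFDerivAt_comp_norm hy hcoeff).smul (hasFDerivAt_id y)).sub_const c).congr_fderiv ?_
  ext1 u
  simp only [add_apply, smul_apply, ContinuousLinearMap.smulRight_apply, id,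
    ContinuousLinearMap.id_apply]
  congr 2
  rw [div_div, sq]

theorem contDiffAt_outlyingNormal (hy : y ≠ 0) (hD : 0 < dilation ε ‖y‖) :
    ContDiffAt ℝ ∞ (outlyingNormal ε c) y := by
  have hnorm := contDiffAt_norm (n := ∞) ℝ hy
  have hderiv : ContDiffAt ℝ ∞ (fun y : E3 => heightDeriv ε ‖y‖) y :=
    ContDiffAt.comp (g := fun p : ℝ × ℝ => heightDeriv p.1 p.2) y
      (contDiffAt_heightDeriv (norm_pos_iff.2 hy) hD) (contDiffAt_const.prodMk hnorm)
  exact ((hderiv.div hnorm (norm_ne_zero_iff.2 hy)).smul contDiffAt_id).sub contDiffAt_const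

theorem trace_fderiv_outlyingNormal (hy : y ≠ 0) (hD : dilation ε ‖y‖ ≠ 0) :
    LinearMap.trace ℝ E3 (fderiv ℝ (outlyingNormal ε c) y).toLinearMap =
      heightDeriv₂ ε ‖y‖ + 2 * (heightDeriv ε ‖y‖ / ‖y‖) := by
  have hnorm := norm_ne_zero_iff.2 hy
  have hid : LinearMap.trace ℝ E3 (ContinuousLinearMap.id ℝ E3).toLinearMap = 3 := by simp
  have hrankOne (a : ℝ) : LinearMap.trace ℝ E3
      ((a • innerSL ℝ y).smulRight y).toLinearMap = a * ‖y‖ ^ 2 := by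
    rw [← real_inner_self_eq_norm_sq]
    exact LinearMap.trace_smulRight _ y
  rw [(hasFDerivAt_outlyingNormal hy hD).fderiv, ContinuousLinearMap.toLinearMap_add, map_add,
    ContinuousLinearMap.toLinearMap_smul, map_smul, hid, hrankOne, smul_eq_mul]
  field_simp
  ring

theorem inner_self_outlyingNormal (hy : y ≠ 0) (hinner : inner ℝ c y = height ε ‖y‖) :
    inner ℝ y (outlyingNormal ε c y) = -(‖y‖ * radialPart ε ‖y‖) := by
  have hnorm := norm_ne_zero_iff.2 hy
  rw [outlyingNormal, inner_sub_right, real_inner_smul_right, real_inner_self_eq_norm_sq,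
    real_inner_comm, hinner, radialPart]
  field_simp
  ring

theorem inner_dir_outlyingNormal (hc : ‖c‖ = 1) (hinner : inner ℝ c y = height ε ‖y‖) :
    inner ℝ c (outlyingNormal ε c y) = heightDeriv ε ‖y‖ * height ε ‖y‖ / ‖y‖ - 1 := by
  rw [outlyingNormal, inner_sub_right, real_inner_smul_right, real_inner_self_eq_norm_sq, hc,
    hinner]
  ring

theorem norm_outlyingNormal (hc : ‖c‖ = 1) (hy : y ≠ 0)
    (hinner : inner ℝ c y = height ε ‖y‖) : ‖outlyingNormal ε c y‖ = normalLen ε ‖y‖ := by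
  have hnorm := norm_ne_zero_iff.2 hy
  have hsq : normalSq ε ‖y‖ = ‖outlyingNormal ε c y‖ ^ 2 := by
    rw [← real_inner_self_eq_norm_sq]
    nth_rw 1 [outlyingNormal]
    rw [inner_sub_left, real_inner_smul_left, inner_self_outlyingNormal hy hinner,
      inner_dir_outlyingNormal hc hinner, normalSq, radialPart]
    field_simp
    ring
  rw [normalLen, hsq, Real.sqrt_sq (norm_nonneg _)]

theorem inner_fderiv_outlyingNormal (hc : ‖c‖ = 1) (hy : y ≠ 0) (hreg : Regular (ε, ‖y‖))
    (hinner : inner ℝ c y = height ε ‖y‖) :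
    inner ℝ (outlyingNormal ε c y) (fderiv ℝ (outlyingNormal ε c) y (outlyingNormal ε c y)) =
      heightDeriv ε ‖y‖ / ‖y‖ * normalSq ε ‖y‖ +
        (heightDeriv₂ ε ‖y‖ - heightDeriv ε ‖y‖ / ‖y‖) * radialPart ε ‖y‖ ^ 2 := by
  have hnorm := norm_ne_zero_iff.2 hy
  rw [(hasFDerivAt_outlyingNormal hy hreg.dilation_pos.ne').fderiv]
  simp only [add_apply, smul_apply, ContinuousLinearMap.smulRight_apply,
    ContinuousLinearMap.id_apply, inner_add_right, real_inner_smul_right, innerSL_apply_apply,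
    smul_eq_mul, real_inner_self_eq_norm_sq]
  rw [real_inner_comm y (outlyingNormal ε c y), inner_self_outlyingNormal hy hinner,
    norm_outlyingNormal hc hy hinner, normalLen, Real.sq_sqrt hreg.normalSq_pos.le]
  field_simp

theorem flatMeanCurv_eq (hc : ‖c‖ = 1) (hy : y ≠ 0) (hreg : Regular (ε, ‖y‖))
    (hinner : inner ℝ c y = height ε ‖y‖) :
    flatMeanCurv ε ‖y‖ =
      (LinearMap.trace ℝ E3 (fderiv ℝ (outlyingNormal ε c) y).toLinearMap -
        inner ℝ (outlyingNormal ε c y) (fderiv ℝ (outlyingNormal ε c) y (outlyingNormal ε c y)) /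
          ‖outlyingNormal ε c y‖ ^ 2) / ‖outlyingNormal ε c y‖ := by
  have hsq : normalSq ε ‖y‖ = normalLen ε ‖y‖ ^ 2 := (Real.sq_sqrt hreg.normalSq_pos.le).symm
  have hlen : 0 < normalLen ε ‖y‖ := hreg.normalLen_pos
  rw [trace_fderiv_outlyingNormal hy hreg.dilation_pos.ne',
    inner_fderiv_outlyingNormal hc hy hreg hinner, norm_outlyingNormal hc hy hinner, flatMeanCurv,
    hsq]
  field_simp
  ring

end OutlyingNormal

section OutlyingMeanCurvature

variable {ε : ℝ} {c y : E3}

/-- The point `y` lies on the outlying sphere `{⟪c, y⟫ = height ε ‖y‖}`, in the region where the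
cutoffs in the perturbation and in the chart are equal to one. -/
structure OnOutlying (ε : ℝ) (c y : E3) : Prop where
  norm_mem : ‖y‖ ∈ Ioo (4 / 5 : ℝ) (7 / 2)
  angle : 4 / 5 < inner ℝ c y / ‖y‖
  inner_eq : inner ℝ c y = height ε ‖y‖

theorem OnOutlying.ne_zero (hy : OnOutlying ε c y) : y ≠ 0 :=
  norm_pos_iff.1 (by linarith [hy.norm_mem.1])

namespace Correction

variable {K : Correction}

theorem regular_of_norm_mem (hε : ε ∈ Ioo (-K.δ) K.δ) (hy : ‖y‖ ∈ Ioo (4 / 5 : ℝ) (7 / 2)) :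
    Regular (ε, ‖y‖) :=
  K.regular ε hε ‖y‖ ⟨by linarith [hy.1], by linarith [hy.2]⟩

theorem hasFDerivAt_core (hε : ε ∈ Ioo (-K.δ) K.δ) (hy : OnOutlying ε c y) :
    HasFDerivAt (fun y => K.core c (ε, y))
      (K.β ε • innerSL ℝ c + K.γ ε • (‖y‖⁻¹ • innerSL ℝ y - innerSL ℝ c) +
        ((‖y‖ - 1) ^ 2 * K.m (ε, ‖y‖)) •
          (innerSL ℝ c - (heightDeriv ε ‖y‖ / ‖y‖) • innerSL ℝ y)) y := by
  have hreg := regular_of_norm_mem hε hy.norm_mem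
  have hinner : HasFDerivAt (fun y : E3 => (inner ℝ c y : ℝ)) (innerSL ℝ c) y :=
    (innerSL ℝ c).hasFDerivAt
  have hheight := hasFDerivAt_comp_norm hy.ne_zero
    (hasDerivAt_height hreg.pos hreg.dilation_pos.ne')
  have hfactor : DifferentiableAt ℝ (fun y : E3 => (‖y‖ - 1) ^ 2 * K.m (ε, ‖y‖)) y := by
    have hnorm := contDiffAt_norm (n := ∞) ℝ hy.ne_zero
    have hm := (K.contDiffOn_m.contDiffAt ((isOpen_Ioo.prod isOpen_Ioo).mem_nhds
      (mk_mem_prod hε ⟨by linarith [hy.norm_mem.1], by linarith [hy.norm_mem.2]⟩))).comp y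
        (contDiffAt_const.prodMk hnorm)
    exact (((hnorm.sub contDiffAt_const).pow 2).mul hm).differentiableAt (by simp)
  refine (((hinner.const_mul (K.β ε)).add
    (((hasFDerivAt_norm_of_ne_zero hy.ne_zero).sub hinner).const_mul (K.γ ε))).add
      ((hinner.sub hheight).mul hfactor.hasFDerivAt)).congr_fderiv ?_
  simp only [Pi.sub_apply, hy.inner_eq, sub_self, zero_smul, zero_add]

theorem conformal_eq_of_onOutlying (hc : c = axisDir ∨ c = -axisDir) (hy : OnOutlying ε c y) :
    K.conformal (ε, y) = schwFactor ε ‖y‖ + ε ^ 2 *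
      (K.β ε * height ε ‖y‖ + K.γ ε * (‖y‖ - height ε ‖y‖)) := by
  rw [conformal, (eventually_perturbation_eq_core hc hy.norm_mem hy.angle).self_of_nhds, core]
  simp only [hy.inner_eq]
  ring

theorem fderiv_conformal_outlyingNormal (hc : c = axisDir ∨ c = -axisDir)
    (hε : ε ∈ Ioo (-K.δ) K.δ) (hy : OnOutlying ε c y) :
    fderiv ℝ (fun y => K.conformal (ε, y)) y (outlyingNormal ε c y) =
      -(schwFactorDeriv ε ‖y‖ * radialPart ε ‖y‖) + ε ^ 2 *
        (K.β ε * (heightDeriv ε ‖y‖ * height ε ‖y‖ / ‖y‖ - 1) +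
          K.γ ε * (-radialPart ε ‖y‖ - (heightDeriv ε ‖y‖ * height ε ‖y‖ / ‖y‖ - 1)) -
          (‖y‖ - 1) ^ 2 * K.m (ε, ‖y‖) * normalSq ε ‖y‖) := by
  have hreg := regular_of_norm_mem hε hy.norm_mem
  have hnorm := norm_ne_zero_iff.2 hy.ne_zero
  have hnormalSq : normalSq ε ‖y‖ = 1 - heightDeriv ε ‖y‖ * height ε ‖y‖ / ‖y‖ -
      heightDeriv ε ‖y‖ * radialPart ε ‖y‖ := by
    rw [normalSq, radialPart]
    ring
  rw [(hasFDerivAt_conformal hε hy.ne_zero hreg.schwFactor_base_pos.ne').fderiv,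
    ((hasFDerivAt_core hε hy).congr_of_eventuallyEq
      (eventually_perturbation_eq_core hc hy.norm_mem hy.angle)).fderiv]
  simp only [add_apply, sub_apply, smul_apply, innerSL_apply_apply, smul_eq_mul,
    inner_self_outlyingNormal hy.ne_zero hy.inner_eq,
    inner_dir_outlyingNormal (norm_eq_one_of_eq_axisDir_or hc) hy.inner_eq, hnormalSq]
  field_simp
  ring

theorem conformalMeanCurv_outlyingNormal (hc : c = axisDir ∨ c = -axisDir)
    (hε : ε ∈ Ioo (-K.δ) K.δ) (hy : OnOutlying ε c y) :
    conformalMeanCurv (fun y => K.conformal (ε, y)) (outlyingNormal ε c) y =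
      centredMeanCurv ε := by
  have hc1 := norm_eq_one_of_eq_axisDir_or hc
  have hreg := regular_of_norm_mem hε hy.norm_mem
  have hnorm : 0 < ‖y‖ := hreg.pos
  have hlen : 0 < normalLen ε ‖y‖ := hreg.normalLen_pos
  have hsq : normalSq ε ‖y‖ = normalLen ε ‖y‖ ^ 2 := (Real.sq_sqrt hreg.normalSq_pos.le).symm
  have hdefect := K.defect_add ε hε ‖y‖ ⟨by linarith [hy.norm_mem.1], by linarith [hy.norm_mem.2]⟩
  rw [conformalMeanCurv, div_mul_eq_mul_div, mul_div_assoc,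
    ← flatMeanCurv_eq hc1 hy.ne_zero hreg hy.inner_eq, norm_outlyingNormal hc1 hy.ne_zero
      hy.inner_eq, fderiv_conformal_outlyingNormal hc hε hy, conformal_eq_of_onOutlying hc hy, hsq]
  rw [defect, heightEffect, gapEffect] at hdefect
  field_simp at hdefect ⊢
  linear_combination hdefect

end Correction

end OutlyingMeanCurvature

section OutlyingSphere

variable {ε : ℝ} {c y : E3}

theorem norm_sub_two_smul_sq (hc : ‖c‖ = 1) (y : E3) :
    ‖y - (2 : ℝ) • c‖ ^ 2 = ‖y‖ ^ 2 - 4 * inner ℝ c y + 4 := by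
  rw [norm_sub_sq_real, real_inner_smul_right, norm_smul, hc, real_inner_comm, Real.norm_two]
  ring

theorem inner_rot_of_eq_axisDir_or (hc : c = axisDir ∨ c = -axisDir) (θ : ℝ) (y : E3) :
    inner ℝ c (rot θ y) = inner ℝ c y := by
  rcases hc with rfl | rfl
  · exact inner_axisDir_rot θ y
  · rw [inner_neg_left, inner_neg_left, inner_axisDir_rot]

theorem outlyingNormal_self (hc : ‖c‖ = 1) : outlyingNormal ε c c = (heightDeriv ε 1 - 1) • c := by
  rw [outlyingNormal, hc, div_one, sub_smul, one_smul]

namespace OutlyingChart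

variable (F : OutlyingChart ε c)

theorem mul_norm_eq_one (hy : ‖F.toDiffeomorph y‖ = 1) :
    (1 + 2 * ε * cutDeviation y) * ‖y - (2 : ℝ) • c‖ = 1 := by
  have hsmall := (abs_le.1 (F.abs_cutDeviation_le y)).1
  rwa [F.apply_eq, norm_smul, Real.norm_of_nonneg (by linarith)] at hy

theorem norm_sub_two_smul_le (hy : ‖F.toDiffeomorph y‖ = 1) : ‖y - (2 : ℝ) • c‖ ≤ 20 / 19 := by
  have hsmall := (abs_le.1 (F.abs_cutDeviation_le y)).1
  nlinarith [F.mul_norm_eq_one hy, norm_nonneg (y - (2 : ℝ) • c)]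

theorem norm_mem_Ioo (hc : ‖c‖ = 1) (hy : ‖F.toDiffeomorph y‖ = 1) :
    ‖y‖ ∈ Ioo (4 / 5 : ℝ) (7 / 2) := by
  have hdist : |‖y‖ - 2| ≤ 20 / 19 := by
    have hnorm : ‖(2 : ℝ) • c‖ = 2 := by rw [norm_smul, hc, mul_one, Real.norm_two]
    simpa only [hnorm] using
      (abs_norm_sub_norm_le y ((2 : ℝ) • c)).trans (F.norm_sub_two_smul_le hy)
  constructor <;> linarith [abs_le.1 hdist]

theorem onOutlying (hc : ‖c‖ = 1) (hy : ‖F.toDiffeomorph y‖ = 1) : OnOutlying ε c y := by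
  have hmem := F.norm_mem_Ioo hc hy
  have hsq := norm_sub_two_smul_sq hc y
  refine ⟨hmem, ?_, ?_⟩
  · have hle := F.norm_sub_two_smul_le hy
    rw [lt_div_iff₀ (by linarith [hmem.1])]
    nlinarith [sq_nonneg (‖y‖ - 8 / 5), norm_nonneg (y - (2 : ℝ) • c)]
  · have hmul := F.mul_norm_eq_one hy
    rw [one_add_cutDeviation_eq_dilation ε (Ioo_subset_Icc_self hmem)] at hmul
    rw [height, ← inv_pow, ← eq_inv_of_mul_eq_one_right hmul, hsq]
    ring

theorem one_lt_norm_of_inner_lt (hc : ‖c‖ = 1) (hy : ‖y‖ ∈ Icc (4 / 5 : ℝ) (7 / 2))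
    (hD : 0 < dilation ε ‖y‖) (hinner : inner ℝ c y < height ε ‖y‖) :
    1 < ‖F.toDiffeomorph y‖ := by
  rw [F.apply_eq, one_add_cutDeviation_eq_dilation ε hy, norm_smul, Real.norm_of_nonneg hD.le]
  have hsq : (dilation ε ‖y‖ ^ 2)⁻¹ < ‖y - (2 : ℝ) • c‖ ^ 2 := by
    rw [height] at hinner
    linarith [norm_sub_two_smul_sq hc y]
  rw [inv_lt_iff_one_lt_mul₀' (by positivity), ← mul_pow] at hsq
  exact (one_lt_sq_iff₀ (by positivity)).1 hsq

theorem isAnnularLevelSet {K : Correction} (hε : ε ∈ Ioo (-K.δ) K.δ) (hc : ‖c‖ = 1) :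
    IsAnnularLevelSet F.toDiffeomorph (fun y => height ε ‖y‖ - inner ℝ c y)
      (outlyingNormal ε c) := by
  have hreg {y : E3} (hy : ‖y‖ ∈ Ioo (4 / 5 : ℝ) (7 / 2)) : Regular (ε, ‖y‖) :=
    Correction.regular_of_norm_mem hε hy
  have hon := fun y => F.onOutlying (y := y) hc
  refine ⟨fun y hy => ?_, fun y hy => ?_, fun y hy => ?_, fun y hy => ?_,
    fun y hy => sub_eq_zero.2 (hon y hy).inner_eq.symm, fun y hy => ?_⟩
  · exact Ioo_subset_Ioo (by norm_num) (by norm_num) (hon y hy).norm_mem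
  · exact contDiffAt_outlyingNormal (hon y hy).ne_zero (hreg (hon y hy).norm_mem).dilation_pos
  · rw [← norm_pos_iff, norm_outlyingNormal hc (hon y hy).ne_zero (hon y hy).inner_eq]
    exact (hreg (hon y hy).norm_mem).normalLen_pos
  · exact hasFDerivAt_height_sub_inner (hon y hy).ne_zero
      (hreg (hon y hy).norm_mem).dilation_pos.ne'
  · filter_upwards [continuous_norm.continuousAt.eventually
      (isOpen_Ioo.mem_nhds (hon y hy).norm_mem)] with z hz hpos
    exact (F.one_lt_norm_of_inner_lt hc (Ioo_subset_Icc_self hz) (hreg hz).dilation_pos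
      (sub_pos.1 hpos)).le

theorem norm_apply_dir (hc : ‖c‖ = 1) : ‖F.toDiffeomorph c‖ = 1 := by
  rw [F.apply_eq, cutDeviation, hc, deviation_one, mul_zero, mul_zero, add_zero, one_smul,
    two_smul, sub_add_cancel_left, norm_neg, hc]

theorem norm_apply_zero (hc : ‖c‖ = 1) : ‖F.toDiffeomorph 0‖ = 2 := by
  rw [F.apply_eq, cutDeviation, norm_zero, radialCutoff_eq_zero (Or.inl (by norm_num)), zero_mul,
    mul_zero, add_zero, one_smul, zero_sub, norm_neg, norm_smul, hc, mul_one, Real.norm_two]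

theorem norm_apply_rot (hc : c = axisDir ∨ c = -axisDir) (θ : ℝ) (y : E3) :
    ‖F.toDiffeomorph (rot θ y)‖ = ‖F.toDiffeomorph y‖ := by
  have hc1 := norm_eq_one_of_eq_axisDir_or hc
  have hnorm : ‖rot θ y - (2 : ℝ) • c‖ = ‖y - (2 : ℝ) • c‖ := by
    rw [← sq_eq_sq₀ (norm_nonneg _) (norm_nonneg _), norm_sub_two_smul_sq hc1,
      norm_sub_two_smul_sq hc1, norm_rot, inner_rot_of_eq_axisDir_or hc]
  rw [F.apply_eq, F.apply_eq, norm_smul, norm_smul, hnorm, cutDeviation, cutDeviation, norm_rot]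

/-- The outlying sphere touching `centredSphere` at `ε⁻¹ c`. -/
def sphere (hε : ε ≠ 0) : EmbeddedSphere := rescaledSphere F.toDiffeomorph hε

theorem lt_mul_norm_of_mem_carrier (hε : 0 < ε) (hc : ‖c‖ = 1) {x : E3}
    (hx : x ∈ (F.sphere hε.ne').carrier) : 4 / 5 < ε * ‖x‖ := by
  have hlt := (F.norm_mem_Ioo hc (mem_carrier_rescaledSphere.1 hx)).1
  rwa [norm_smul, Real.norm_of_nonneg hε.le] at hlt

theorem isOutlying_sphere (hε : ε ∈ Ioc 0 (1 / 2)) (hc : ‖c‖ = 1) :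
    (F.sphere hε.1.ne').IsOutlying := by
  refine isOutlying_rescaledSphere (by rw [F.norm_apply_zero hc]; norm_num) fun x hx => ?_
  nlinarith [F.lt_mul_norm_of_mem_carrier hε.1 hc hx, hε.2, norm_nonneg x]

theorem isAxisymmetric_sphere (hε : ε ≠ 0) (hc : c = axisDir ∨ c = -axisDir) :
    (F.sphere hε).IsAxisymmetric :=
  isAxisymmetric_rescaledSphere (F.norm_apply_rot hc)

theorem carrier_sphere_inter_centredSphere (hε : ε ≠ 0) (hc : ‖c‖ = 1) :
    (F.sphere hε).carrier ∩ (centredSphere hε).carrier = {ε⁻¹ • c} := by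
  ext x
  rw [mem_inter_iff, mem_singleton_iff, mem_carrier_centredSphere, sphere,
    mem_carrier_rescaledSphere, eq_inv_smul_iff₀ hε]
  constructor
  · rintro ⟨hx, hunit⟩
    have hinner := (F.onOutlying hc hx).inner_eq
    rw [hunit, height_one, inner_eq_one_iff_of_norm_eq_one hc hunit] at hinner
    exact hinner.symm
  · intro hx
    rw [hx]
    exact ⟨F.norm_apply_dir hc, hc⟩

variable {K : Correction} {g : Metric3}

theorem hasConstantMeanCurvature_sphere (h : K.IsConformalAt g ε)
    (hc : c = axisDir ∨ c = -axisDir) :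
    (F.sphere h.pos.ne').HasConstantMeanCurvature g (ε * centredMeanCurv ε) := by
  have hc1 := norm_eq_one_of_eq_axisDir_or hc
  exact h.hasConstantMeanCurvature (F.isAnnularLevelSet h.mem_Ioo hc1) fun y hy =>
    Correction.conformalMeanCurv_outlyingNormal hc h.mem_Ioo (F.onOutlying hc1 hy)

theorem tangentExactlyAt_centredSphere (h : K.IsConformalAt g ε) (hc : ‖c‖ = 1) :
    (F.sphere h.pos.ne').TangentExactlyAt (centredSphere h.pos.ne') (ε⁻¹ • c) := by
  have hinter := F.carrier_sphere_inter_centredSphere h.pos.ne' hc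
  have hlevel := F.isAnnularLevelSet h.mem_Ioo hc
  obtain ⟨⟨p, hp⟩, ⟨q, hq⟩⟩ : ε⁻¹ • c ∈ (F.sphere h.pos.ne').carrier ∩
      (centredSphere h.pos.ne').carrier := by rw [hinter]; exact mem_singleton _
  have hcoeff : heightDeriv ε 1 - 1 ≠ 0 := fun hzero =>
    hlevel.gradient_ne_zero c (F.norm_apply_dir hc)
      (by rw [outlyingNormal_self hc, hzero, zero_smul])
  refine ⟨hinter, p, q, hp, hq, ?_⟩
  rw [sphere, h.tangentPlane_eq hlevel hp, centredSphere,
    h.tangentPlane_eq isAnnularLevelSet_refl hq, outlyingNormal_self hc,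
    Submodule.span_singleton_smul_eq hcoeff.isUnit]

end OutlyingChart

end OutlyingSphere

section Construction

theorem exists_centredMeanCurv_mem_Ioo :
    ∃ δ > 0, ∀ ε ∈ Ioc 0 δ, centredMeanCurv ε ∈ Ioo (1 : ℝ) 3 := by
  have hcont : ContinuousAt centredMeanCurv 0 :=
    (contDiffAt_centredMeanCurv (by norm_num)).continuousAt
  have hmem : ∀ᶠ ε in 𝓝 (0 : ℝ), centredMeanCurv ε ∈ Ioo (1 : ℝ) 3 :=
    hcont.eventually (isOpen_Ioo.mem_nhds (by rw [centredMeanCurv_zero]; norm_num))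
  obtain ⟨δ, hδ, hball⟩ := Metric.eventually_nhds_iff.1 hmem
  refine ⟨δ / 2, by positivity, fun ε hε => hball ?_⟩
  rw [Real.dist_eq, sub_zero, abs_of_pos hε.1]
  linarith [hε.2]

section Scales

variable {δ : ℝ}

theorem strictAnti_scale_mul (hδ : 0 < δ) {a : ℕ → ℝ} (ha : ∀ n, a n ∈ Ioo (1 : ℝ) 3) :
    StrictAnti fun n => scale δ n * a n := by
  refine strictAnti_nat_of_succ_lt fun n => ?_
  nlinarith [(ha n).1, (ha (n + 1)).2, mul_scale_le hδ.le n.lt_succ_self, scale_pos hδ (n + 1)]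

theorem tendsto_scale_mul (δ : ℝ) {a : ℕ → ℝ} (ha : ∀ n, a n ∈ Ioo (1 : ℝ) 3) :
    Tendsto (fun n => scale δ n * a n) atTop (𝓝 0) :=
  (tendsto_scale δ).zero_mul_isBoundedUnder_le
    (isBoundedUnder_of ⟨3, fun n => abs_le.2 ⟨by linarith [(ha n).1], (ha n).2.le⟩⟩)

theorem eventually_lt_norm_of_lt_scale_mul (hδ : 0 < δ) (R : ℝ) :
    ∀ᶠ n in atTop, ∀ x : E3, 4 / 5 < scale δ n * ‖x‖ → R < ‖x‖ := by
  have hR : Tendsto (fun n => scale δ n * R) atTop (𝓝 0) := by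
    simpa only [zero_mul] using (tendsto_scale δ).mul_const R
  filter_upwards [hR.eventually_lt_const (by norm_num : (0 : ℝ) < 4 / 5)] with n hn x hx
  exact lt_of_mul_lt_mul_left (hn.trans hx) (scale_pos hδ n).le

end Scales

/-- Three spheres of constant mean curvature `H` configured as in the theorem: `S₁` and `S₂` are
outlying and touch the separating sphere `S₃` at its two poles. -/
structure IsTouchingTriple (g : Metric3) (H : ℝ) (S₁ S₂ S₃ : EmbeddedSphere) : Prop where
  hasConstantMeanCurvature₁ : S₁.HasConstantMeanCurvature g H
  hasConstantMeanCurvature₂ : S₂.HasConstantMeanCurvature g H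
  hasConstantMeanCurvature₃ : S₃.HasConstantMeanCurvature g H
  isAxisymmetric₁ : S₁.IsAxisymmetric
  isAxisymmetric₂ : S₂.IsAxisymmetric
  isAxisymmetric₃ : S₃.IsAxisymmetric
  isOutlying₁ : S₁.IsOutlying
  isOutlying₂ : S₂.IsOutlying
  separatesCompactPart₃ : S₃.SeparatesCompactPart
  exists_poles : ∃ P Q : E3, P ≠ Q ∧ S₃.carrier ∩ axis = {P, Q} ∧
    S₁.TangentExactlyAt S₃ P ∧ S₂.TangentExactlyAt S₃ Q

theorem Correction.IsConformalAt.isTouchingTriple {K : Correction} {g : Metric3} {ε : ℝ}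
    (h : K.IsConformalAt g ε) (hε : ε ≤ 1 / 2) (F : OutlyingChart ε axisDir)
    (G : OutlyingChart ε (-axisDir)) :
    IsTouchingTriple g (ε * centredMeanCurv ε) (F.sphere h.pos.ne') (G.sphere h.pos.ne')
      (centredSphere h.pos.ne') where
  hasConstantMeanCurvature₁ := F.hasConstantMeanCurvature_sphere h (Or.inl rfl)
  hasConstantMeanCurvature₂ := G.hasConstantMeanCurvature_sphere h (Or.inr rfl)
  hasConstantMeanCurvature₃ := h.hasConstantMeanCurvature_centredSphere
  isAxisymmetric₁ := F.isAxisymmetric_sphere _ (Or.inl rfl)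
  isAxisymmetric₂ := G.isAxisymmetric_sphere _ (Or.inr rfl)
  isAxisymmetric₃ := isAxisymmetric_centredSphere _
  isOutlying₁ := F.isOutlying_sphere ⟨h.pos, hε⟩ norm_axisDir
  isOutlying₂ := G.isOutlying_sphere ⟨h.pos, hε⟩ (norm_eq_one_of_eq_axisDir_or (Or.inr rfl))
  separatesCompactPart₃ := separatesCompactPart_centredSphere ⟨h.pos, by linarith⟩
  exists_poles := ⟨ε⁻¹ • axisDir, ε⁻¹ • -axisDir, inv_smul_axisDir_ne_neg h.pos.ne',
    carrier_centredSphere_inter_axis h.pos, F.tangentExactlyAt_centredSphere h norm_axisDir,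
    G.tangentExactlyAt_centredSphere h (norm_eq_one_of_eq_axisDir_or (Or.inr rfl))⟩

theorem Correction.exists_forall_isTouchingTriple (K : Correction) :
    ∃ δ > 0, ∀ ε ∈ Ioc 0 δ, ∀ g, K.IsConformalAt g ε → ∃ S₁ S₂ S₃,
      IsTouchingTriple g (ε * centredMeanCurv ε) S₁ S₂ S₃ ∧
      ∀ x ∈ S₁.carrier ∪ S₂.carrier ∪ S₃.carrier, 4 / 5 < ε * ‖x‖ := by
  obtain ⟨δ₁, hδ₁, hF⟩ := exists_forall_nonempty_outlyingChart axisDir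
  obtain ⟨δ₂, hδ₂, hG⟩ := exists_forall_nonempty_outlyingChart (-axisDir)
  refine ⟨min (1 / 2) (min δ₁ δ₂), by positivity, fun ε hε g h => ?_⟩
  obtain ⟨hhalf, hle₁, hle₂⟩ : ε ≤ 1 / 2 ∧ ε ≤ δ₁ ∧ ε ≤ δ₂ := by
    simpa only [le_min_iff] using hε.2
  obtain ⟨F⟩ := hF ε ⟨hε.1, hle₁⟩
  obtain ⟨G⟩ := hG ε ⟨hε.1, hle₂⟩
  refine ⟨_, _, _, h.isTouchingTriple hhalf F G, ?_⟩
  rintro x ((hx | hx) | hx)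
  · exact F.lt_mul_norm_of_mem_carrier h.pos norm_axisDir hx
  · exact G.lt_mul_norm_of_mem_carrier h.pos (norm_eq_one_of_eq_axisDir_or (Or.inr rfl)) hx
  · rw [mem_carrier_centredSphere, norm_smul, Real.norm_of_nonneg h.pos.le] at hx
    rw [hx]
    norm_num

end Construction

end CMC

end

theorem theorem2 :
    ∃ g : CMC.Metric3,
      CMC.IsAsymptoticallySchwarzschild 1 g ∧ g.IsAxisymmetric ∧
      ∃ (H : ℕ → ℝ) (S₁ S₂ S₃ : ℕ → CMC.EmbeddedSphere),
        (∀ n, 0 < H n) ∧ StrictAnti H ∧ Filter.Tendsto H Filter.atTop (nhds 0) ∧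
        (∀ R : ℝ, ∀ᶠ n in Filter.atTop,
          ∀ x ∈ (S₁ n).carrier ∪ (S₂ n).carrier ∪ (S₃ n).carrier, R < ‖x‖) ∧
        ∀ n,
          (S₁ n).HasConstantMeanCurvature g (H n) ∧
          (S₂ n).HasConstantMeanCurvature g (H n) ∧
          (S₃ n).HasConstantMeanCurvature g (H n) ∧
          (S₁ n).IsAxisymmetric ∧ (S₂ n).IsAxisymmetric ∧ (S₃ n).IsAxisymmetric ∧
          (S₁ n).IsOutlying ∧ (S₂ n).IsOutlying ∧
          (S₃ n).SeparatesCompactPart ∧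
          ∃ P Q : CMC.E3, P ≠ Q ∧ (S₃ n).carrier ∩ CMC.axis = {P, Q} ∧
            (S₁ n).TangentExactlyAt (S₃ n) P ∧ (S₂ n).TangentExactlyAt (S₃ n) Q := by
  obtain ⟨K⟩ := CMC.nonempty_correction
  obtain ⟨δ₁, hδ₁, hcurv⟩ := CMC.exists_centredMeanCurv_mem_Ioo
  obtain ⟨δ₂, hδ₂, hspheres⟩ := K.exists_forall_isTouchingTriple
  obtain ⟨δ, ⟨hδ, hle⟩, g, hschw, haxi, hg⟩ := K.exists_metric (lt_min hδ₁ hδ₂)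
  have hpos := CMC.scale_pos hδ
  have hsmall (n : ℕ) : CMC.scale δ n ≤ min δ₁ δ₂ := (CMC.scale_le hδ.le n).trans hle
  have hmem (n : ℕ) : CMC.centredMeanCurv (CMC.scale δ n) ∈ Ioo (1 : ℝ) 3 :=
    hcurv _ ⟨hpos n, (hsmall n).trans (min_le_left _ _)⟩
  choose S₁ S₂ S₃ htriple hfar using fun n =>
    hspheres (CMC.scale δ n) ⟨hpos n, (hsmall n).trans (min_le_right _ _)⟩ g (hg n)
  refine ⟨g, hschw, haxi, fun n => CMC.scale δ n * CMC.centredMeanCurv (CMC.scale δ n),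
    S₁, S₂, S₃, fun n => mul_pos (hpos n) (one_pos.trans (hmem n).1),
    CMC.strictAnti_scale_mul hδ hmem, CMC.tendsto_scale_mul δ hmem, fun R => ?_, fun n => ?_⟩
  · exact (CMC.eventually_lt_norm_of_lt_scale_mul hδ R).mono fun n hn x hx => hn x (hfar n x hx)
  · obtain ⟨hcmc₁, hcmc₂, hcmc₃, haxi₁, haxi₂, haxi₃, hout₁, hout₂, hsep, hpoles⟩ := htriple n
    exact ⟨hcmc₁, hcmc₂, hcmc₃, haxi₁, haxi₂, haxi₃, hout₁, hout₂, hsep, hpoles⟩
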